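/- All manifolds are smooth, finite-dimensional (of constant dimension) and without boundary; in (1) and (2) they need be neither Hausdorff nor second countable. Let $\Gamma$ be a Lie groupoid over a manifold $P$, with source $s$ and target $t$ (surjective submersions); $gh$ is defined when $s(g)=t(h)$. A right action of $\Gamma$ on a manifold $E$ has a smooth moment $J:E\to P$, and $xg$ is defined when $J(x)=t(g)$, with $J(xg)=s(g)$; for a left action with moment $J$, $gx$ is defined when $s(g)=J(x)$, with $J(gx)=t(g)$. An action on $E$ is principal with respect to $p:E\to B$ if $p$ is a surjective submersion and $\Gamma$ acts freely and transitively on each fibre of $p$, with smooth division map $E\times_B E\to\Gamma$; then $E$ is called a principal $\Gamma$-bundle over $B$. The gauge groupoid $\mathcal G(E)$ of a right principal $\Gamma$-bundle $p:E\to B$ with moment $J$ is the Lie groupoid over $B$ whose manifold of arrows is the quotient manifold $(E\times_P E)/\Gamma$ of $E\times_P E=\{(x,y): J(x)=J(y)\}$ by the diagonal action $(x,y)g=(xg,yg)$, with $t[(x,y)]=p(x)$, $s[(x,y)]=p(y)$ and $[(x,y)][(y,z)]=[(x,z)]$. A $(\Gamma_1,\Gamma_2)$-bibundle is a manifold $S$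 with commuting left $\Gamma_1$- and right $\Gamma_2$-actions with moments $J_1$ and $J_2$, each invariant under the other action; it is biprincipal if the left action is principal with respect to $J_2$ and the right action is principal with respect to $J_1$. Isomorphisms of bibundles are diffeomorphisms commuting with the moments and the actions. The tensor product of a $(\Gamma_1,\Gamma_2)$-bibundle $S$ and a $(\Gamma_2,\Gamma_3)$-bibundle $S'$ is the quotient manifold $S*S'=(S\times_{P_2}S')/\Gamma_2$ by $(x,y)\mapsto (xg,g^{-1}y)$, with the induced actions. The Picard group $\mathrm{Pic}(\Gamma)$ is the set of isomorphism classes of biprincipal $(\Gamma,\Gamma)$-bibundles with the multiplication $[S][S']=[S*S']$ and the class of $\Gamma$ itself as unit. For a Lie group $G$, $\mathrm{Out}(G)=\mathrm{Aut}(G)/\mathrm{InnAut}(G)$, where $\mathrm{Aut}(G)$ is the group of smooth group automorphisms with smooth inverse and $\mathrm{InnAut}(G)$ is the subgroup of conjugations. (1) Let $E\to B$ be a right principal $\Gamma$-bundle whose moment $J:E\to P$ is a surjective submersion. Then the gauge groupoid $\mathcal G(E)$ exists as a Lie groupoid, the Picard groups of $\mathcal G(E)$ and of $\Gamma$ are well-defined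 groups, and $$\mathrm{Pic}(\mathcal G(E))\cong \mathrm{Pic}(\Gamma)\quad\text{as groups.}$$ (2) In particular, if $\Gamma=G$ is a Lie group, regarded as a Lie groupoid over a point (so that the condition on the moment says that $E\neq\emptyset$), then $\mathrm{Pic}(\mathcal G(E))\cong \mathrm{Out}(G)$ as groups. (3) Let $\Gamma$ be a transitive Lie groupoid over $P$ (any two points of $P$ are joined by an arrow) whose manifold of arrows is second countable, and let $x\in P$. Then the isotropy group $\Gamma_x=\{g: s(g)=t(g)=x\}$ is a Lie group as an embedded submanifold of the manifold of arrows, and $\mathrm{Pic}(\Gamma)\cong \mathrm{Out}(\Gamma_x)$ as groups. -/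

import Mathlib

open scoped Manifold ContDiff Topology

universe u

/-! ### Smooth manifolds -/

/-- A (finite-dimensional, real) smooth manifold without boundary, as a bundled object.
Neither the Hausdorff property nor second countability is built in. -/
structure SmoothMfd : Type (u + 1) where
  carrier : Type u
  dim : ℕ
  [top : TopologicalSpace carrier]
  [charted : ChartedSpace (EuclideanSpace ℝ (Fin dim)) carrier]
  [mfd : IsManifold (𝓡 dim) ∞ carrier]

namespace SmoothMfd

instance : CoeSort SmoothMfd.{u} (Type u) := ⟨SmoothMfd.carrier⟩

instance (M : SmoothMfd.{u}) : TopologicalSpace M := M.top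

instance (M : SmoothMfd.{u}) : ChartedSpace (EuclideanSpace ℝ (Fin M.dim)) M := M.charted

instance (M : SmoothMfd.{u}) : IsManifold (𝓡 M.dim) ∞ M := M.mfd

/-- Smooth maps between manifolds. -/
def Smooth {M N : SmoothMfd.{u}} (f : M → N) : Prop :=
  ContMDiff (𝓡 M.dim) (𝓡 N.dim) ∞ f

/-- `f` is smooth on the subset `A` of `M × N`. In all uses `A` is a fibre product over a
submersion, hence an embedded submanifold of `M × N`, and smoothness on `A` (existence of local
Taylor expansions along `A`) is the same as smoothness for the submanifold structure. -/
def SmoothOn₂ {M N K : SmoothMfd.{u}} (f : M × N → K) (A : Set (M × N)) : Prop :=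
  ContMDiffOn ((𝓡 M.dim).prod (𝓡 N.dim)) (𝓡 K.dim) ∞ f A

/-- Surjective submersions. -/
def SurjSubmersion {M N : SmoothMfd.{u}} (f : M → N) : Prop :=
  Function.Surjective f ∧ Manifold.IsSubmersion (𝓡 M.dim) (𝓡 N.dim) ∞ f

theorem SurjSubmersion.smooth {M N : SmoothMfd.{u}} {f : M → N} (h : SurjSubmersion f) :
    Smooth f := h.2.contMDiff

/-- `q` exhibits the manifold `Q` as the quotient of the fibre product `A ⊆ M × N` by the
equivalence relation `r` on `A`: it is a surjective submersion `A → Q` whose fibres are the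
`r`-classes. Being a submersion is expressed by the existence of a smooth local section through
every point of `A`. Values of `q` outside `A` are irrelevant. -/
structure IsQuotientOf {M N Q : SmoothMfd.{u}} (A : Set (M × N)) (r : M × N → M × N → Prop)
    (q : M × N → Q) : Prop where
  smooth : SmoothOn₂ q A
  surj : ∀ z : Q, ∃ a ∈ A, q a = z
  eq_iff : ∀ a ∈ A, ∀ b ∈ A, q a = q b ↔ r a b
  exists_section : ∀ a ∈ A, ∃ σ : Q → M × N, ∃ U ∈ 𝓝 (q a),
    ContMDiffOn (𝓡 Q.dim) ((𝓡 M.dim).prod (𝓡 N.dim)) ∞ σ U ∧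
      σ (q a) = a ∧ ∀ z ∈ U, σ z ∈ A ∧ q (σ z) = z

/-- The one-point manifold. -/
def point : SmoothMfd.{u} :=
  letI : ChartedSpace (EuclideanSpace ℝ (Fin 0)) PUnit.{u + 1} :=
    ChartedSpace.ofDiscreteTopology
  have : IsManifold (𝓡 0) ∞ PUnit.{u + 1} := IsManifold.of_discreteTopology _
  { carrier := PUnit.{u + 1}
    dim := 0 }

instance : Unique point.{u} := inferInstanceAs (Unique PUnit.{u + 1})

/-- The map from a nonempty manifold to a point is a surjective submersion. -/
theorem surjSubmersion_point (M : SmoothMfd.{u}) [Nonempty M] :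
    SurjSubmersion (fun _ : M => (default : point.{u})) := by
  refine ⟨fun y => ⟨Classical.arbitrary M, Subsingleton.elim _ _⟩,
    EuclideanSpace ℝ (Fin M.dim), inferInstance, inferInstance, fun x => ?_⟩
  have : Unique (EuclideanSpace ℝ (Fin point.{u}.dim)) :=
    inferInstanceAs (Unique (EuclideanSpace ℝ (Fin 0)))
  refine Manifold.IsSubmersionAtOfComplement.mk_of_continuousAt continuousAt_const
    (ContinuousLinearEquiv.uniqueProd ℝ (EuclideanSpace ℝ (Fin M.dim))
      (EuclideanSpace ℝ (Fin point.{u}.dim))).symm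
    (chartAt _ x) (chartAt _ _) (mem_chart_source _ x) (mem_chart_source _ _)
    (IsManifold.chart_mem_maximalAtlas x) (IsManifold.chart_mem_maximalAtlas _) ?_
  intro y _
  exact Subsingleton.elim _ _

end SmoothMfd

open SmoothMfd

/-! ### Lie groupoids -/

/-- A Lie groupoid over the manifold `P`. The product `mul g h` is meaningful only if
`src g = tgt h`; its values on other pairs are irrelevant. -/
structure LieGroupoid (P : SmoothMfd.{u}) : Type (u + 1) where
  Arr : SmoothMfd.{u}
  src : Arr → P
  tgt : Arr → P
  unit : P → Arr
  inv : Arr → Arr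
  mul : Arr → Arr → Arr
  src_unit : ∀ x, src (unit x) = x
  tgt_unit : ∀ x, tgt (unit x) = x
  src_inv : ∀ g, src (inv g) = tgt g
  tgt_inv : ∀ g, tgt (inv g) = src g
  src_mul : ∀ g h, src g = tgt h → src (mul g h) = src h
  tgt_mul : ∀ g h, src g = tgt h → tgt (mul g h) = tgt g
  mul_assoc : ∀ g h k, src g = tgt h → src h = tgt k → mul (mul g h) k = mul g (mul h k)
  unit_mul : ∀ g, mul (unit (tgt g)) g = g
  mul_unit : ∀ g, mul g (unit (src g)) = g
  inv_mul : ∀ g, mul (inv g) g = unit (src g)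
  mul_inv : ∀ g, mul g (inv g) = unit (tgt g)
  src_submersion : SurjSubmersion src
  tgt_submersion : SurjSubmersion tgt
  smooth_unit : Smooth unit
  smooth_inv : Smooth inv
  smooth_mul : SmoothOn₂ (fun a : Arr × Arr => mul a.1 a.2) {a | src a.1 = tgt a.2}

/-- A left action of `Γ` on the manifold `S` along a moment map; `act g x` is meaningful only if
`src g = moment x`. -/
structure LeftAction {P : SmoothMfd.{u}} (Γ : LieGroupoid P) (S : SmoothMfd.{u}) : Type u where
  moment : S → P
  act : Γ.Arr → S → S
  smooth_moment : Smooth moment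
  smooth_act : SmoothOn₂ (fun a : Γ.Arr × S => act a.1 a.2) {a | Γ.src a.1 = moment a.2}
  moment_act : ∀ g x, Γ.src g = moment x → moment (act g x) = Γ.tgt g
  unit_act : ∀ x, act (Γ.unit (moment x)) x = x
  mul_act : ∀ g h x, Γ.src g = Γ.tgt h → Γ.src h = moment x →
    act (Γ.mul g h) x = act g (act h x)

/-- A right action of `Γ` on the manifold `S` along a moment map; `act x g` is meaningful only if
`moment x = tgt g`. -/
structure RightAction {P : SmoothMfd.{u}} (Γ : LieGroupoid P) (S : SmoothMfd.{u}) : Type u where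
  moment : S → P
  act : S → Γ.Arr → S
  smooth_moment : Smooth moment
  smooth_act : SmoothOn₂ (fun a : S × Γ.Arr => act a.1 a.2) {a | moment a.1 = Γ.tgt a.2}
  moment_act : ∀ x g, moment x = Γ.tgt g → moment (act x g) = Γ.src g
  act_unit : ∀ x, act x (Γ.unit (moment x)) = x
  act_mul : ∀ x g h, moment x = Γ.tgt g → Γ.src g = Γ.tgt h →
    act x (Γ.mul g h) = act (act x g) h

/-- The left action is principal with respect to `p : S → M`: `p` is a surjective submersion,
and the groupoid acts freely and transitively on each fibre of `p`, with smooth division map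
`S ×_M S → Γ` (so that `Γ ×_P S → S ×_M S`, `(g, x) ↦ (g x, x)`, is a diffeomorphism). -/
structure LeftAction.IsPrincipal {P : SmoothMfd.{u}} {Γ : LieGroupoid P} {S M : SmoothMfd.{u}}
    (a : LeftAction Γ S) (p : S → M) : Prop where
  submersion : SurjSubmersion p
  invariant : ∀ g x, Γ.src g = a.moment x → p (a.act g x) = p x
  free : ∀ g x, Γ.src g = a.moment x → a.act g x = x → g = Γ.unit (a.moment x)
  transitive : ∀ x y, p x = p y → ∃ g, Γ.src g = a.moment y ∧ a.act g y = x
  smooth_div : ∃ δ : S × S → Γ.Arr, SmoothOn₂ δ {z | p z.1 = p z.2} ∧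
    ∀ x y, p x = p y → Γ.src (δ (x, y)) = a.moment y ∧ a.act (δ (x, y)) y = x

/-- The right action is principal with respect to `p : S → M`. -/
structure RightAction.IsPrincipal {P : SmoothMfd.{u}} {Γ : LieGroupoid P} {S M : SmoothMfd.{u}}
    (a : RightAction Γ S) (p : S → M) : Prop where
  submersion : SurjSubmersion p
  invariant : ∀ x g, a.moment x = Γ.tgt g → p (a.act x g) = p x
  free : ∀ x g, a.moment x = Γ.tgt g → a.act x g = x → g = Γ.unit (a.moment x)
  transitive : ∀ x y, p x = p y → ∃ g, a.moment x = Γ.tgt g ∧ a.act x g = y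
  smooth_div : ∃ δ : S × S → Γ.Arr, SmoothOn₂ δ {z | p z.1 = p z.2} ∧
    ∀ x y, p x = p y → a.moment x = Γ.tgt (δ (x, y)) ∧ a.act x (δ (x, y)) = y

/-! ### Gauge groupoids -/

/-- For a right principal `Γ`-bundle `p : E → B` with moment `J`, the Lie groupoid `𝒢` over `B` is
the gauge groupoid of `E`: its manifold of arrows is the quotient, through the map
`(x, y) ↦ [(x, y)]`, of `E ×_P E = {(x, y) | J x = J y}` by the diagonal action of `Γ`, the target
and source of `[(x, y)]` are `p x` and `p y`, and `[(x, y)] [(y, z)] = [(x, z)]`. -/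
def IsGaugeGroupoid {P B E : SmoothMfd.{u}} {Γ : LieGroupoid P} (a : RightAction Γ E)
    (p : E → B) (𝒢 : LieGroupoid B) : Prop :=
  ∃ q : E × E → 𝒢.Arr,
    IsQuotientOf {z : E × E | a.moment z.1 = a.moment z.2}
      (fun z w => ∃ g, a.moment z.1 = Γ.tgt g ∧ w = (a.act z.1 g, a.act z.2 g)) q ∧
    (∀ x y, a.moment x = a.moment y → 𝒢.tgt (q (x, y)) = p x ∧ 𝒢.src (q (x, y)) = p y) ∧
    ∀ x y z, a.moment x = a.moment y → a.moment y = a.moment z →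
      𝒢.mul (q (x, y)) (q (y, z)) = q (x, z)

/-! ### Bibundles -/

/-- A `(Γ₁, Γ₂)`-bibundle: a manifold with commuting left `Γ₁`- and right `Γ₂`-actions. -/
structure Bibundle {P₁ P₂ : SmoothMfd.{u}} (Γ₁ : LieGroupoid P₁) (Γ₂ : LieGroupoid P₂) :
    Type (u + 1) where
  space : SmoothMfd.{u}
  left : LeftAction Γ₁ space
  right : RightAction Γ₂ space
  right_moment_left : ∀ g x, Γ₁.src g = left.moment x →
    right.moment (left.act g x) = right.moment x
  left_moment_right : ∀ x h, right.moment x = Γ₂.tgt h →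
    left.moment (right.act x h) = left.moment x
  comm : ∀ g x h, Γ₁.src g = left.moment x → right.moment x = Γ₂.tgt h →
    right.act (left.act g x) h = left.act g (right.act x h)

namespace Bibundle

variable {P₁ P₂ P₃ : SmoothMfd.{u}} {Γ₁ : LieGroupoid P₁} {Γ₂ : LieGroupoid P₂}
  {Γ₃ : LieGroupoid P₃}

/-- Left and right principal bibundles, also called Morita bibundles. -/
def IsBiprincipal (S : Bibundle Γ₁ Γ₂) : Prop :=
  S.left.IsPrincipal S.right.moment ∧ S.right.IsPrincipal S.left.moment

/-- Two bibundles are isomorphic if there is a diffeomorphism between them that commutes with the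
moments and with both actions. -/
def Isomorphic (S T : Bibundle Γ₁ Γ₂) : Prop :=
  ∃ f : Diffeomorph (𝓡 S.space.dim) (𝓡 T.space.dim) S.space T.space ∞,
    (∀ x, T.left.moment (f x) = S.left.moment x) ∧
    (∀ x, T.right.moment (f x) = S.right.moment x) ∧
    (∀ g x, Γ₁.src g = S.left.moment x → f (S.left.act g x) = T.left.act g (f x)) ∧
    ∀ x h, S.right.moment x = Γ₂.tgt h → f (S.right.act x h) = T.right.act (f x) h

theorem Isomorphic.refl (S : Bibundle Γ₁ Γ₂) : Isomorphic S S :=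
  ⟨Diffeomorph.refl _ _ _, fun _ => rfl, fun _ => rfl, fun _ _ _ => rfl, fun _ _ _ => rfl⟩

theorem Isomorphic.symm {S T : Bibundle Γ₁ Γ₂} (h : Isomorphic S T) : Isomorphic T S := by
  obtain ⟨f, h1, h2, h3, h4⟩ := h
  have k1 : ∀ y, S.left.moment (f.symm y) = T.left.moment y := fun y => by
    rw [← h1, f.apply_symm_apply]
  have k2 : ∀ y, S.right.moment (f.symm y) = T.right.moment y := fun y => by
    rw [← h2, f.apply_symm_apply]
  refine ⟨f.symm, k1, k2, fun g y hg => ?_, fun y k hk => ?_⟩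
  · have := h3 g (f.symm y) (by rw [k1, hg])
    rw [f.apply_symm_apply] at this
    rw [← this, f.symm_apply_apply]
  · have := h4 (f.symm y) k (by rw [k2, hk])
    rw [f.apply_symm_apply] at this
    rw [← this, f.symm_apply_apply]

theorem Isomorphic.trans {S T U : Bibundle Γ₁ Γ₂} (h : Isomorphic S T) (k : Isomorphic T U) :
    Isomorphic S U := by
  obtain ⟨f, h1, h2, h3, h4⟩ := h
  obtain ⟨e, k1, k2, k3, k4⟩ := k
  refine ⟨f.trans e, fun x => ?_, fun x => ?_, fun g x hg => ?_, fun x g hg => ?_⟩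
  · simp [k1, h1]
  · simp [k2, h2]
  · simp only [Diffeomorph.coe_trans, Function.comp_apply]
    rw [h3 g x hg, k3 g _ (by rw [h1, hg])]
  · simp only [Diffeomorph.coe_trans, Function.comp_apply]
    rw [h4 x g hg, k4 _ g (by rw [h2, hg])]

/-- `T` is (a model of) the tensor product `S * S'`: the quotient, through the map
`(x, y) ↦ [(x, y)]`, of `S ×_{P₂} S'` by the `Γ₂`-action `(x, y) ↦ (x g, g⁻¹ y)`, with the left
`Γ₁`-action and the right `Γ₃`-action induced from those of `S` and `S'`. -/
def IsTensorProduct (S : Bibundle Γ₁ Γ₂) (S' : Bibundle Γ₂ Γ₃) (T : Bibundle Γ₁ Γ₃) : Prop :=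
  ∃ q : S.space × S'.space → T.space,
    IsQuotientOf {z : S.space × S'.space | S.right.moment z.1 = S'.left.moment z.2}
      (fun z w => ∃ g, S.right.moment z.1 = Γ₂.tgt g ∧
        w = (S.right.act z.1 g, S'.left.act (Γ₂.inv g) z.2)) q ∧
    ∀ x y, S.right.moment x = S'.left.moment y →
      T.left.moment (q (x, y)) = S.left.moment x ∧
      T.right.moment (q (x, y)) = S'.right.moment y ∧
      (∀ g, Γ₁.src g = S.left.moment x → T.left.act g (q (x, y)) = q (S.left.act g x, y)) ∧
      ∀ h, S'.right.moment y = Γ₃.tgt h → T.right.act (q (x, y)) h = q (x, S'.right.act y h)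

end Bibundle

/-! ### Picard groups -/

namespace LieGroupoid

variable {P : SmoothMfd.{u}} (Γ : LieGroupoid P)

/-- `Γ` as a `(Γ, Γ)`-bibundle, with respect to left and right multiplication. -/
def unitBibundle : Bibundle Γ Γ where
  space := Γ.Arr
  left :=
    { moment := Γ.tgt
      act := Γ.mul
      smooth_moment := Γ.tgt_submersion.smooth
      smooth_act := Γ.smooth_mul
      moment_act := Γ.tgt_mul
      unit_act := Γ.unit_mul
      mul_act := Γ.mul_assoc }
  right :=
    { moment := Γ.src
      act := Γ.mul
      smooth_moment := Γ.src_submersion.smooth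
      smooth_act := Γ.smooth_mul
      moment_act := Γ.src_mul
      act_unit := Γ.mul_unit
      act_mul := fun x g h hx hg => (Γ.mul_assoc x g h hx hg).symm }
  right_moment_left := Γ.src_mul
  left_moment_right := Γ.tgt_mul
  comm := Γ.mul_assoc

theorem unitBibundle_isBiprincipal : Γ.unitBibundle.IsBiprincipal := by
  have hl : ∀ x y : Γ.Arr, Γ.src x = Γ.src y → Γ.mul (Γ.mul x (Γ.inv y)) y = x := by
    intro x y h
    rw [Γ.mul_assoc _ _ _ (by rw [Γ.tgt_inv, h]) (Γ.src_inv y), Γ.inv_mul, ← h, Γ.mul_unit]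
  have hr : ∀ x y : Γ.Arr, Γ.tgt x = Γ.tgt y → Γ.mul x (Γ.mul (Γ.inv x) y) = y := by
    intro x y h
    rw [← Γ.mul_assoc _ _ _ (Γ.tgt_inv x).symm (by rw [Γ.src_inv, h]), Γ.mul_inv, h,
      Γ.unit_mul]
  have hsl : ∀ x y : Γ.Arr, Γ.src x = Γ.src y → Γ.src (Γ.mul x (Γ.inv y)) = Γ.tgt y := by
    intro x y h
    rw [Γ.src_mul _ _ (by rw [Γ.tgt_inv, h]), Γ.src_inv]
  have hsr : ∀ x y : Γ.Arr, Γ.tgt x = Γ.tgt y → Γ.src x = Γ.tgt (Γ.mul (Γ.inv x) y) := by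
    intro x y h
    rw [Γ.tgt_mul _ _ (by rw [Γ.src_inv, h]), Γ.tgt_inv]
  have fl : ∀ g x : Γ.Arr, Γ.src g = Γ.tgt x → Γ.mul g x = x → g = Γ.unit (Γ.tgt x) := by
    intro g x h hx
    rw [← Γ.mul_unit g, h, ← Γ.mul_inv, ← Γ.mul_assoc _ _ _ h (Γ.tgt_inv x).symm, hx]
  have fr : ∀ x g : Γ.Arr, Γ.src x = Γ.tgt g → Γ.mul x g = x → g = Γ.unit (Γ.src x) := by
    intro x g h hx
    rw [← Γ.unit_mul g, ← h, ← Γ.inv_mul, Γ.mul_assoc _ _ _ (Γ.src_inv x) h, hx]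
  have dl : SmoothOn₂ (fun z : Γ.Arr × Γ.Arr => Γ.mul z.1 (Γ.inv z.2))
      {z | Γ.src z.1 = Γ.src z.2} := by
    have h2 : ContMDiff ((𝓡 Γ.Arr.dim).prod (𝓡 Γ.Arr.dim)) ((𝓡 Γ.Arr.dim).prod (𝓡 Γ.Arr.dim)) ∞
        (fun z : Γ.Arr × Γ.Arr => (z.1, Γ.inv z.2)) :=
      contMDiff_fst.prodMk (ContMDiff.comp Γ.smooth_inv contMDiff_snd)
    exact ContMDiffOn.comp (f := fun z : Γ.Arr × Γ.Arr => (z.1, Γ.inv z.2)) Γ.smooth_mul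
      h2.contMDiffOn (fun z (hz : Γ.src z.1 = Γ.src z.2) => hz.trans (Γ.tgt_inv z.2).symm)
  have dr : SmoothOn₂ (fun z : Γ.Arr × Γ.Arr => Γ.mul (Γ.inv z.1) z.2)
      {z | Γ.tgt z.1 = Γ.tgt z.2} := by
    have h2 : ContMDiff ((𝓡 Γ.Arr.dim).prod (𝓡 Γ.Arr.dim)) ((𝓡 Γ.Arr.dim).prod (𝓡 Γ.Arr.dim)) ∞
        (fun z : Γ.Arr × Γ.Arr => (Γ.inv z.1, z.2)) :=
      (ContMDiff.comp Γ.smooth_inv contMDiff_fst).prodMk contMDiff_snd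
    exact ContMDiffOn.comp (f := fun z : Γ.Arr × Γ.Arr => (Γ.inv z.1, z.2)) Γ.smooth_mul
      h2.contMDiffOn (fun z (hz : Γ.tgt z.1 = Γ.tgt z.2) => (Γ.src_inv z.1).trans hz)
  exact ⟨⟨Γ.src_submersion, Γ.src_mul, fl, fun x y h => ⟨_, hsl x y h, hl x y h⟩,
      ⟨_, dl, fun x y h => ⟨hsl x y h, hl x y h⟩⟩⟩,
    ⟨Γ.tgt_submersion, Γ.tgt_mul, fr, fun x y h => ⟨_, hsr x y h, hr x y h⟩,
      ⟨_, dr, fun x y h => ⟨hsr x y h, hr x y h⟩⟩⟩⟩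

/-- Biprincipal `(Γ, Γ)`-bibundles. -/
def MoritaBibundle : Type (u + 1) := {S : Bibundle Γ Γ // S.IsBiprincipal}

/-- Isomorphism of biprincipal `(Γ, Γ)`-bibundles, as an equivalence relation. -/
def moritaSetoid : Setoid Γ.MoritaBibundle where
  r S T := S.1.Isomorphic T.1
  iseqv := ⟨fun S => .refl S.1, fun h => h.symm, fun h k => h.trans k⟩

/-- The set of isomorphism classes of biprincipal `(Γ, Γ)`-bibundles. -/
def Pic : Type (u + 1) := Quotient Γ.moritaSetoid

/-- The isomorphism class of a biprincipal `(Γ, Γ)`-bibundle. -/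
def Pic.mk (S : Γ.MoritaBibundle) : Γ.Pic := Quotient.mk Γ.moritaSetoid S

/-- The group structure on `Pic Γ` is the Picard group structure: its multiplication is the tensor
product of bibundles, and its unit is the class of `Γ` itself. There is at most one such group
structure, since the products are prescribed. -/
structure IsPicardGroup (grp : Group Γ.Pic) : Prop where
  one_eq : (1 : Γ.Pic) = Pic.mk Γ ⟨Γ.unitBibundle, Γ.unitBibundle_isBiprincipal⟩
  mul_eq_iff : ∀ S S' T : Γ.MoritaBibundle,
    Pic.mk Γ S * Pic.mk Γ S' = Pic.mk Γ T ↔ S.1.IsTensorProduct S'.1 T.1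

/-- `Γ` is transitive if any two points of the base are joined by an arrow. -/
def IsTransitive : Prop := ∀ x y : P, ∃ g : Γ.Arr, Γ.src g = x ∧ Γ.tgt g = y

/-- The isotropy group `Γ_x`: the arrows from `x` to `x`. -/
@[ext]
structure Isotropy (x : P) : Type u where
  val : Γ.Arr
  src_val : Γ.src val = x
  tgt_val : Γ.tgt val = x

/-- The isotropy group carries the subspace topology. -/
instance (x : P) : TopologicalSpace (Γ.Isotropy x) := .induced Isotropy.val inferInstance

instance (x : P) : Group (Γ.Isotropy x) where
  mul g h := ⟨Γ.mul g.val h.val, by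
    rw [Γ.src_mul _ _ (g.src_val.trans h.tgt_val.symm), h.src_val], by
    rw [Γ.tgt_mul _ _ (g.src_val.trans h.tgt_val.symm), g.tgt_val]⟩
  one := ⟨Γ.unit x, Γ.src_unit x, Γ.tgt_unit x⟩
  inv g := ⟨Γ.inv g.val, (Γ.src_inv _).trans g.tgt_val, (Γ.tgt_inv _).trans g.src_val⟩
  mul_assoc g h k := Isotropy.ext
    (Γ.mul_assoc _ _ _ (g.src_val.trans h.tgt_val.symm) (h.src_val.trans k.tgt_val.symm))
  one_mul g := Isotropy.ext
    ((congrArg (fun y => Γ.mul (Γ.unit y) g.val) g.tgt_val.symm).trans (Γ.unit_mul g.val))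
  mul_one g := Isotropy.ext
    ((congrArg (fun y => Γ.mul g.val (Γ.unit y)) g.src_val.symm).trans (Γ.mul_unit g.val))
  inv_mul_cancel g := Isotropy.ext
    ((Γ.inv_mul g.val).trans (congrArg Γ.unit g.src_val))

end LieGroupoid

/-! ### Lie groups -/

section LieGroups

variable {n : ℕ} (G : Type u) [TopologicalSpace G] [ChartedSpace (EuclideanSpace ℝ (Fin n)) G]
  [Group G] [LieGroup (𝓡 n) ∞ G]

/-- The underlying manifold of a Lie group. -/
def LieGroup.toSmoothMfd : SmoothMfd.{u} where
  carrier := G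
  dim := n

/-- A Lie group, regarded as a Lie groupoid over a point. -/
def LieGroup.toLieGroupoid : LieGroupoid point.{u} where
  Arr := LieGroup.toSmoothMfd (n := n) G
  src _ := default
  tgt _ := default
  unit _ := (1 : G)
  inv := fun g : G => (g⁻¹ : G)
  mul := fun g h : G => (g * h : G)
  src_unit _ := Subsingleton.elim _ _
  tgt_unit _ := Subsingleton.elim _ _
  src_inv _ := rfl
  tgt_inv _ := rfl
  src_mul _ _ _ := rfl
  tgt_mul _ _ _ := rfl
  mul_assoc g h k _ _ := mul_assoc (G := G) g h k
  unit_mul g := one_mul (M := G) g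
  mul_unit g := mul_one (M := G) g
  inv_mul g := inv_mul_cancel (G := G) g
  mul_inv g := mul_inv_cancel (G := G) g
  src_submersion :=
    haveI : Nonempty (LieGroup.toSmoothMfd (n := n) G) := ⟨(1 : G)⟩
    surjSubmersion_point _
  tgt_submersion :=
    haveI : Nonempty (LieGroup.toSmoothMfd (n := n) G) := ⟨(1 : G)⟩
    surjSubmersion_point _
  smooth_unit := contMDiff_const
  smooth_inv := contMDiff_inv (I := 𝓡 n) (n := ∞) (G := G)
  smooth_mul := (contMDiff_mul (𝓡 n) (G := G) ∞).contMDiffOn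

/-- The group `Aut(G)` of Lie group automorphisms of `G`. -/
def LieGroup.Aut : Subgroup (MulAut G) where
  carrier := {φ | ContMDiff (𝓡 n) (𝓡 n) ∞ φ ∧ ContMDiff (𝓡 n) (𝓡 n) ∞ φ.symm}
  mul_mem' h k := ⟨h.1.comp k.1, k.2.comp h.2⟩
  one_mem' := ⟨contMDiff_id, contMDiff_id⟩
  inv_mem' h := ⟨h.2, h.1⟩

/-- The subgroup `InnAut(G)` of inner automorphisms `h ↦ g h g⁻¹` (these are smooth). -/
def LieGroup.Inn : Subgroup (LieGroup.Aut (n := n) G) :=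
  (MulAut.conj (G := G)).range.subgroupOf (LieGroup.Aut (n := n) G)

instance LieGroup.Inn_normal : (LieGroup.Inn (n := n) G).Normal := by
  have : (MulAut.conj (G := G)).range.Normal := by
    constructor
    rintro _ ⟨g, rfl⟩ φ
    refine ⟨φ g, ?_⟩
    ext h
    simp [MulAut.conj_apply]
  exact this.subgroupOf _

/-- The group `Out(G) = Aut(G) / InnAut(G)` of outer automorphisms. -/
abbrev LieGroup.Out : Type u := LieGroup.Aut (n := n) G ⧸ LieGroup.Inn (n := n) G

end LieGroups

/-!
The Picard group of a Lie groupoid is its automorphism group in a category, whose morphisms are the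
isomorphism classes of biprincipal bibundles and whose composition is the tensor product. In this
category every morphism is invertible (`LieGpd`), so groupoids joined by a biprincipal bibundle have
isomorphic Picard groups (`Bibundle.IsBiprincipal.nonempty_picardGroup_mulEquiv`). The theorem
follows by exhibiting such bibundles.

* A principal `Γ`-bundle `E` with submersive moment is a biprincipal bibundle between its gauge
  groupoid and `Γ` (`IsGaugeGroupoid.exists_isBiprincipal`).
* For a transitive second countable groupoid, the source fibre at `x` is a biprincipal bibundle
  between `Γ` and the isotropy group at `x` (`LieGroupoid.IsSrcFibre.exists_isBiprincipal`). The
  point is that the target map is a submersion on the source fibre. If it had no smooth local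
  section at all, the maximal rank of its derivative would be less than the dimension of the base,
  and some nonempty open set would have nowhere dense image. Translation by arrows spreads this to
  all points, and by second countability the base would be a countable union of nowhere dense sets,
  against Baire's theorem (`LieGroupoid.IsSrcFibre.surjSubmersion_tgt`).
* For a Lie group `G`, a point `x₀` of a biprincipal bibundle defines an automorphism `φ` by
  `x₀ h = φ(h) x₀`, so every class is that of `G` with the right action twisted by some `φ`. The
  twist by `φ` is trivial exactly for inner `φ`, and hence `Pic(G) = Out(G)`
  (`LieGroup.nonempty_picardGroup_mulEquiv_out`).

Two devices keep the differential geometry short. Fibre products are never given a manifold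
structure: smoothness on them is smoothness on a subset of a product, and submersions are used only
through their smooth local sections (`SurjSubmersion.exists_section`, `surjSubmersion_of_section`).
Quotients and embedded submanifolds are constructed from local slices
(`IsLocalSlice.exists_liftedChart`, `exists_manifold_of_liftedCharts`). In particular
`(E ×_P F) / Γ` exists for a principal bundle `E` and a left `Γ`-manifold `F` with submersive moment
(`RightAction.IsPrincipal.exists_isQuotientOf`); this gives both the gauge groupoid and the tensor
product. All identities between tensor products (units, inverses, associativity) come from one
criterion: a balanced map into a right principal bibundle exhibits it as the tensor product
(`Bibundle.IsBalanced.isTensorProduct`).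
-/

open SmoothMfd Set Filter

/-! ### Normal form of a map with surjective derivative -/

section NormalForm

variable {E V : Type*} [NormedAddCommGroup E] [NormedSpace ℝ E] [FiniteDimensional ℝ E]
  [NormedAddCommGroup V] [NormedSpace ℝ V] [FiniteDimensional ℝ V]

/-- A surjective linear map is the first component of a linear isomorphism onto a product. -/
theorem ContinuousLinearMap.exists_equiv_prod_of_surjective (D : E →L[ℝ] V)
    (hD : Function.Surjective D) {k : ℕ} (hk : Module.finrank ℝ E = Module.finrank ℝ V + k) :
    ∃ (π : E →L[ℝ] EuclideanSpace ℝ (Fin k)) (L : E ≃L[ℝ] V × EuclideanSpace ℝ (Fin k)),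
      (L : E →L[ℝ] V × EuclideanSpace ℝ (Fin k)) = D.prod π := by
  have hker : Module.finrank ℝ (D : E →ₗ[ℝ] V).ker
      = Module.finrank ℝ (EuclideanSpace ℝ (Fin k)) := by
    have h1 := LinearMap.finrank_range_add_finrank_ker (D : E →ₗ[ℝ] V)
    rw [LinearMap.range_eq_top.2 hD, finrank_top] at h1
    rw [finrank_euclideanSpace_fin]
    omega
  let κ := LinearEquiv.ofFinrankEq _ _ hker
  obtain ⟨g, hg⟩ := LinearMap.exists_leftInverse_of_injective (D : E →ₗ[ℝ] V).ker.subtype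
    (Submodule.ker_subtype _)
  let π : E →ₗ[ℝ] EuclideanSpace ℝ (Fin k) := κ.toLinearMap ∘ₗ g
  have hinj : Function.Injective ((D : E →ₗ[ℝ] V).prod π) := by
    rw [injective_iff_map_eq_zero]
    intro x hx
    have h1 : D x = 0 := congrArg Prod.fst hx
    have h2 : κ (g x) = 0 := congrArg Prod.snd hx
    rw [LinearEquiv.map_eq_zero_iff] at h2
    have h3 := LinearMap.congr_fun hg ⟨x, h1⟩
    simp only [LinearMap.comp_apply, Submodule.subtype_apply, LinearMap.id_apply] at h3
    rw [h2] at h3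
    exact (congrArg Subtype.val h3).symm
  let L := LinearMap.linearEquivOfInjective ((D : E →ₗ[ℝ] V).prod π) hinj
    (by rw [Module.finrank_prod, finrank_euclideanSpace_fin, hk])
  exact ⟨π.toContinuousLinearMap, L.toContinuousLinearEquiv, rfl⟩

/-- A smooth map with surjective derivative at `a` is, near `a`, the first component of a
diffeomorphism onto an open subset of a product. -/
theorem ContDiffOn.exists_straightening {f : E → V} {U : Set E} (hU : IsOpen U)
    (hf : ContDiffOn ℝ ∞ f U) {a : E} (ha : a ∈ U) (hD : Function.Surjective (fderiv ℝ f a))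
    {k : ℕ} (hk : Module.finrank ℝ E = Module.finrank ℝ V + k) :
    ∃ e : OpenPartialHomeomorph E (V × EuclideanSpace ℝ (Fin k)), a ∈ e.source ∧ e.source ⊆ U ∧
      ContDiffOn ℝ ∞ e e.source ∧ ContDiffOn ℝ ∞ e.symm e.target ∧
      ∀ y ∈ e.source, (e y).1 = f y := by
  obtain ⟨π, L, hL⟩ := (fderiv ℝ f a).exists_equiv_prod_of_surjective hD hk
  let Ψ : E → V × EuclideanSpace ℝ (Fin k) := fun y => (f y, π y)
  have hΨ : ContDiffOn ℝ ∞ Ψ U := hf.prodMk π.contDiff.contDiffOn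
  have hΨa : ContDiffAt ℝ ∞ Ψ a := hΨ.contDiffAt (hU.mem_nhds ha)
  have hfa : HasFDerivAt f (fderiv ℝ f a) a :=
    ((hf.contDiffAt (hU.mem_nhds ha)).differentiableAt (by simp)).hasFDerivAt
  have hd : HasFDerivAt Ψ (L : E →L[ℝ] V × EuclideanSpace ℝ (Fin k)) a := by
    rw [hL]; exact hfa.prodMk π.hasFDerivAt
  let Φ := hΨa.toOpenPartialHomeomorph Ψ hd (by simp)
  have hcont : ContinuousOn (fderiv ℝ Ψ) U := hΨ.continuousOn_fderiv_of_isOpen hU (by simp)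
  let W : Set E := U ∩ fderiv ℝ Ψ ⁻¹' range ((↑) : (E ≃L[ℝ] V × EuclideanSpace ℝ (Fin k)) → _)
  have hW : IsOpen W := hcont.isOpen_inter_preimage hU ContinuousLinearEquiv.isOpen
  have haW : a ∈ W := ⟨ha, L, hd.fderiv.symm⟩
  refine ⟨Φ.restrOpen W hW, ⟨hΨa.mem_toOpenPartialHomeomorph_source hd (by simp), haW⟩,
    fun y hy => hy.2.1, hΨ.mono fun y hy => hy.2.1, ?_, fun y _ => rfl⟩
  intro z hz
  have hz' := (Φ.restrOpen W hW).map_target hz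
  obtain ⟨-, hzU, T, hT⟩ := hz'
  have hzd : DifferentiableAt ℝ Ψ (Φ.symm z) :=
    (hΨ.contDiffAt (hU.mem_nhds hzU)).differentiableAt (by simp)
  refine (OpenPartialHomeomorph.contDiffAt_symm (Φ.restrOpen W hW) hz (f₀' := T) ?_
    (hΨ.contDiffAt (hU.mem_nhds hzU))).contDiffWithinAt
  rw [hT]
  exact hzd.hasFDerivAt

end NormalForm

/-! ### Local sections of submersions -/

/-- A smooth map `f` from a manifold to a vector space that has a smooth local section through `x`
becomes a linear projection in a suitable chart at `x`. -/
theorem SmoothMfd.exists_straightening_chart {M : SmoothMfd.{u}} {V : Type*}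
    [NormedAddCommGroup V] [NormedSpace ℝ V] [FiniteDimensional ℝ V] {f : M → V} {x : M}
    {U : Set M} (hU : IsOpen U) (hx : x ∈ U) (hf : ContMDiffOn (𝓡 M.dim) 𝓘(ℝ, V) ∞ f U)
    {σ : V → M} (hσ : ContMDiffAt 𝓘(ℝ, V) (𝓡 M.dim) ∞ σ (f x)) (hσx : σ (f x) = x)
    (hfσ : ∀ᶠ v in 𝓝 (f x), f (σ v) = v) :
    Module.finrank ℝ V ≤ M.dim ∧ ∀ k, M.dim = Module.finrank ℝ V + k →
    ∃ L : EuclideanSpace ℝ (Fin M.dim) ≃L[ℝ] V × EuclideanSpace ℝ (Fin k),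
    ∃ e ∈ IsManifold.maximalAtlas (𝓡 M.dim) ∞ M,
      x ∈ e.source ∧ e.source ⊆ U ∧ ∀ y ∈ e.source, (L (e y)).1 = f y := by
  set c := chartAt (EuclideanSpace ℝ (Fin M.dim)) x with hc
  have hcx : x ∈ c.source := mem_chart_source _ x
  have hcm : c ∈ IsManifold.maximalAtlas (𝓡 M.dim) ∞ M := IsManifold.chart_mem_maximalAtlas x
  have hc1 := contMDiffOn_of_mem_maximalAtlas hcm
  have hc2 := contMDiffOn_symm_of_mem_maximalAtlas hcm
  let g : EuclideanSpace ℝ (Fin M.dim) → V := f ∘ c.symm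
  have hU' : IsOpen (c.target ∩ c.symm ⁻¹' U) := c.isOpen_inter_preimage_symm hU
  have hg : ContDiffOn ℝ ∞ g (c.target ∩ c.symm ⁻¹' U) :=
    (hf.comp (hc2.mono inter_subset_left) fun y hy => hy.2).contDiffOn
  have ha : c x ∈ c.target ∩ c.symm ⁻¹' U := ⟨c.map_source hcx, by simpa [c.left_inv hcx] using hx⟩
  have hcσ : ContDiffAt ℝ ∞ (c ∘ σ) (f x) := by
    refine ContMDiffAt.contDiffAt ?_
    refine ContMDiffAt.comp _ (?_ : ContMDiffAt (𝓡 M.dim) _ ∞ c (σ (f x))) hσ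
    rw [hσx]
    exact hc1.contMDiffAt (c.open_source.mem_nhds hcx)
  have hev : ∀ᶠ v in 𝓝 (f x), g ((c ∘ σ) v) = v := by
    have h1 : ∀ᶠ v in 𝓝 (f x), σ v ∈ c.source := by
      apply hσ.continuousAt
      rw [hσx]
      exact c.open_source.mem_nhds hcx
    filter_upwards [hfσ, h1] with v hv hv1
    simp [g, c.left_inv hv1, hv]
  have hga : DifferentiableAt ℝ g (c x) :=
    (hg.contDiffAt (hU'.mem_nhds ha)).differentiableAt (by simp)
  have hD : Function.Surjective (fderiv ℝ g (c x)) := by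
    have h2 : HasFDerivAt (c ∘ σ) (fderiv ℝ (c ∘ σ) (f x)) (f x) :=
      (hcσ.differentiableAt (by simp)).hasFDerivAt
    have h3 : HasFDerivAt g (fderiv ℝ g (c x)) ((c ∘ σ) (f x)) := by
      simp only [Function.comp_apply, hσx]
      exact hga.hasFDerivAt
    have h4 := (h3.comp (f x) h2).unique
      ((hasFDerivAt_id (f x)).congr_of_eventuallyEq (by
        filter_upwards [hev] with v hv
        exact hv))
    intro v
    exact ⟨fderiv ℝ (c ∘ σ) (f x) v, by simpa using DFunLike.congr_fun h4 v⟩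
  refine ⟨?_, fun k hk => ?_⟩
  · have := LinearMap.finrank_le_finrank_of_surjective (f := (fderiv ℝ g (c x)).toLinearMap) hD
    simpa using this
  obtain ⟨e, hae, heU, he1, he2, he⟩ := hg.exists_straightening hU' ha hD (k := k) (by simpa using hk)
  let L : EuclideanSpace ℝ (Fin M.dim) ≃L[ℝ] V × EuclideanSpace ℝ (Fin k) :=
    ContinuousLinearEquiv.ofFinrankEq (by simpa using hk)
  refine ⟨L, (c.trans e).transHomeomorph L.symm.toHomeomorph, ?_, ?_, ?_, ?_⟩
  · apply OpenPartialHomeomorph.mem_maximalAtlas_of_contMDiffOn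
    · refine (L.symm.contDiff.contMDiff.comp_contMDiffOn ?_)
      refine he1.contMDiffOn.comp (hc1.mono fun y hy => ?_) fun y hy => ?_
      · simp at hy; exact hy.1
      · simp at hy; exact hy.2
    · have h1 : ContMDiffOn (𝓡 M.dim) 𝓘(ℝ, V × EuclideanSpace ℝ (Fin k)) ∞ L
          ((c.trans e).transHomeomorph L.symm.toHomeomorph).target :=
        L.contDiff.contMDiff.contMDiffOn
      refine (hc2.comp (he2.contMDiffOn.comp h1 fun y hy => ?_) fun y hy => ?_)
      · simp at hy; exact hy.1
      · simp at hy; exact hy.2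
  · simp [hcx, hae]
  · intro y hy
    simp only [OpenPartialHomeomorph.transHomeomorph_source, OpenPartialHomeomorph.trans_source,
      mem_inter_iff, mem_preimage] at hy
    have := (heU hy.2).2
    simpa [c.left_inv hy.1] using this
  · intro y hy
    simp only [OpenPartialHomeomorph.transHomeomorph_source, OpenPartialHomeomorph.trans_source,
      mem_inter_iff, mem_preimage] at hy
    have := he _ hy.2
    simpa [g, c.left_inv hy.1] using this

namespace SmoothMfd

variable {M N : SmoothMfd.{u}}

/-- Charts in which a submersion is a linear projection. -/
theorem SurjSubmersion.exists_charts {f : M → N} (h : SurjSubmersion f) (x : M) :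
    M.dim = N.dim + (M.dim - N.dim) ∧
    ∃ L : EuclideanSpace ℝ (Fin M.dim) ≃L[ℝ]
      EuclideanSpace ℝ (Fin N.dim) × EuclideanSpace ℝ (Fin (M.dim - N.dim)),
    ∃ φ ∈ IsManifold.maximalAtlas (𝓡 M.dim) ∞ M, ∃ ψ ∈ IsManifold.maximalAtlas (𝓡 N.dim) ∞ N,
      x ∈ φ.source ∧ MapsTo f φ.source ψ.source ∧ ∀ y ∈ φ.source, (L (φ y)).1 = ψ (f y) := by
  obtain ⟨-, F, _, _, hF⟩ := h
  have hx := hF x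
  let L := hx.equiv
  have : FiniteDimensional ℝ (EuclideanSpace ℝ (Fin N.dim) × F) :=
    L.toLinearEquiv.finiteDimensional
  have : FiniteDimensional ℝ F :=
    Module.Finite.of_surjective (LinearMap.snd ℝ (EuclideanSpace ℝ (Fin N.dim)) F)
      LinearMap.snd_surjective
  have hr : M.dim = N.dim + Module.finrank ℝ F := by
    have := L.toLinearEquiv.finrank_eq
    simpa [Module.finrank_prod] using this
  let κ : F ≃L[ℝ] EuclideanSpace ℝ (Fin (M.dim - N.dim)) :=
    ContinuousLinearEquiv.ofFinrankEq (by rw [finrank_euclideanSpace_fin]; omega)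
  refine ⟨by omega, L.trans ((ContinuousLinearEquiv.refl ℝ _).prodCongr κ), hx.domChart,
    hx.domChart_mem_maximalAtlas, hx.codChart, hx.codChart_mem_maximalAtlas,
    hx.mem_domChart_source, hx.mapsto_domChart_source_codChart_source, fun y hy => ?_⟩
  have hy' : hx.domChart y ∈ (hx.domChart.extend (𝓡 M.dim)).target := by
    simpa using hx.domChart.map_source hy
  have := hx.writtenInCharts hy'
  simp only [Function.comp_apply, OpenPartialHomeomorph.extend_coe,
    OpenPartialHomeomorph.extend_coe_symm, modelWithCornersSelf_coe, modelWithCornersSelf_coe_symm,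
    id_eq, hx.domChart.left_inv hy] at this
  rw [this]
  rfl

/-- A submersion has a smooth local section through every point. -/
theorem SurjSubmersion.exists_section {f : M → N} (h : SurjSubmersion f) (x : M) :
    ∃ σ : N → M, σ (f x) = x ∧
      ∀ᶠ y in 𝓝 (f x), ContMDiffAt (𝓡 N.dim) (𝓡 M.dim) ∞ σ y ∧ f (σ y) = y := by
  obtain ⟨-, L, φ, hφ, ψ, hψ, hx, hm, hL⟩ := h.exists_charts x
  have hfx : f x ∈ ψ.source := hm hx
  let τ : EuclideanSpace ℝ (Fin N.dim) → EuclideanSpace ℝ (Fin M.dim) :=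
    fun v => L.symm (v, (L (φ x)).2)
  have hτ : ContDiff ℝ ∞ τ := L.symm.contDiff.comp (contDiff_id.prodMk contDiff_const)
  have hτx : τ (ψ (f x)) = φ x := by
    simp only [τ]
    rw [← hL x hx]
    exact L.symm_apply_apply (φ x)
  have hτψ : ContMDiffOn (𝓡 N.dim) (𝓡 M.dim) ∞ (τ ∘ ψ) ψ.source :=
    hτ.contMDiff.comp_contMDiffOn (contMDiffOn_of_mem_maximalAtlas hψ)
  refine ⟨fun y => φ.symm (τ (ψ y)), by simp [hτx, φ.left_inv hx], ?_⟩
  have hU : IsOpen (ψ.source ∩ (τ ∘ ψ) ⁻¹' φ.target) :=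
    hτψ.continuousOn.isOpen_inter_preimage ψ.open_source φ.open_target
  filter_upwards [hU.mem_nhds ⟨hfx, by simpa [hτx] using φ.map_source hx⟩] with y hy
  refine ⟨?_, ?_⟩
  · exact ((contMDiffOn_symm_of_mem_maximalAtlas hφ).comp (hτψ.mono inter_subset_left)
      fun y hy => hy.2).contMDiffAt (hU.mem_nhds hy)
  · have hs : φ.symm (τ (ψ y)) ∈ φ.source := φ.map_target hy.2
    refine ψ.injOn (hm hs) hy.1 ?_
    have hr : φ (φ.symm (τ (ψ y))) = τ (ψ y) := φ.right_inv hy.2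
    rw [← hL _ hs, hr]
    simp [τ]

/-- A smooth surjection with a smooth local section through every point is a submersion. -/
theorem surjSubmersion_of_section {f : M → N} (hf : Smooth f) (hs : Function.Surjective f)
    (h : ∀ x, ∃ σ : N → M, σ (f x) = x ∧
      ∀ᶠ y in 𝓝 (f x), ContMDiffAt (𝓡 N.dim) (𝓡 M.dim) ∞ σ y ∧ f (σ y) = y) :
    SurjSubmersion f := by
  refine ⟨hs, Manifold.IsSubmersionOfComplement.isSubmersion
    (F := EuclideanSpace ℝ (Fin (M.dim - N.dim))) fun x => ?_⟩
  obtain ⟨σ, hσx, hσ⟩ := h x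
  set ψ := chartAt (EuclideanSpace ℝ (Fin N.dim)) (f x) with hψd
  have hfx : f x ∈ ψ.source := mem_chart_source _ _
  have hψ : ψ ∈ IsManifold.maximalAtlas (𝓡 N.dim) ∞ N := IsManifold.chart_mem_maximalAtlas _
  have hψ1 := contMDiffOn_of_mem_maximalAtlas hψ
  have hψ2 := contMDiffOn_symm_of_mem_maximalAtlas hψ
  have hs1 : ContMDiffAt (𝓡 N.dim) (𝓡 N.dim) ∞ ψ.symm (ψ (f x)) :=
    hψ2.contMDiffAt (ψ.open_target.mem_nhds (ψ.map_source hfx))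
  obtain ⟨hle, H⟩ := exists_straightening_chart (M := M) (f := ψ ∘ f) (x := x)
    (U := f ⁻¹' ψ.source) (σ := σ ∘ ψ.symm)
    (ψ.open_source.preimage hf.continuous) hfx
    (hψ1.comp hf.contMDiffOn fun y hy => hy)
    (by
      refine ContMDiffAt.comp _ (?_ : ContMDiffAt (𝓡 N.dim) _ ∞ σ (ψ.symm (ψ (f x)))) hs1
      rw [ψ.left_inv hfx]
      exact hσ.self_of_nhds.1)
    (by simp [ψ.left_inv hfx, hσx])
    (by
      have h1 : ∀ᶠ v in 𝓝 (ψ (f x)), ψ.symm v ∈ {y | f (σ y) = y} := by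
        apply hs1.continuousAt
        rw [ψ.left_inv hfx]
        exact hσ.mono fun y hy => hy.2
      filter_upwards [h1, ψ.open_target.mem_nhds (ψ.map_source hfx)] with v hv hv1
      have hv2 : f (σ (ψ.symm v)) = ψ.symm v := hv
      simp [hv2, ψ.right_inv hv1])
  rw [finrank_euclideanSpace_fin] at hle H
  obtain ⟨L, e, he, hxe, heU, hL⟩ := H (M.dim - N.dim) (by omega)
  refine Manifold.IsSubmersionAtOfComplement.mk_of_charts L e ψ hxe hfx he hψ heU ?_
  intro v hv
  have hv' : v ∈ e.target := by simpa using hv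
  have := hL (e.symm v) (e.map_target hv')
  rw [e.right_inv hv'] at this
  simp [this]

end SmoothMfd

/-! ### Composition of maps that are smooth on subsets -/

section Compositions

variable {𝕏 : Type*} [NormedAddCommGroup 𝕏] [NormedSpace ℝ 𝕏] {H : Type*} [TopologicalSpace H]
  {I : ModelWithCorners ℝ 𝕏 H} {X : Type*} [TopologicalSpace X] [ChartedSpace H X]
  {M N K : SmoothMfd.{u}} {A : Set X} {a : X}

theorem ContMDiffOn.comp_within {E' H' Y E'' H'' Z : Type*} [NormedAddCommGroup E']
    [NormedSpace ℝ E'] [TopologicalSpace H'] {I' : ModelWithCorners ℝ E' H'} [TopologicalSpace Y]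
    [ChartedSpace H' Y] [NormedAddCommGroup E''] [NormedSpace ℝ E''] [TopologicalSpace H'']
    {I'' : ModelWithCorners ℝ E'' H''} [TopologicalSpace Z] [ChartedSpace H'' Z]
    {n : WithTop ℕ∞} {F : Y → Z} {D : Set Y} (hF : ContMDiffOn I' I'' n F D) {f : X → Y}
    (hf : ContMDiffWithinAt I I' n f A a) (ha : a ∈ A) (h : ∀ᶠ z in 𝓝[A] a, f z ∈ D) :
    ContMDiffWithinAt I I'' n (fun z => F (f z)) A a := by
  have h1 : A ∩ {z | f z ∈ D} ∈ 𝓝[A] a := inter_mem self_mem_nhdsWithin h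
  refine ContMDiffWithinAt.mono_of_mem_nhdsWithin (s := A ∩ {z | f z ∈ D}) ?_ h1
  exact ContMDiffWithinAt.comp (g := F) (f := f) (t := D) a (hF _ (h.self_of_nhdsWithin ha))
    (hf.mono inter_subset_left) fun z hz => hz.2

/-- The composite with a map that is smooth on a subset `D` of a product is smooth, if `D` contains
the image of a neighbourhood. -/
theorem SmoothMfd.SmoothOn₂.comp_within {F : M × N → K} {D : Set (M × N)} (hF : SmoothOn₂ F D)
    {f : X → M} {g : X → N} (hf : ContMDiffWithinAt I (𝓡 M.dim) ∞ f A a)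
    (hg : ContMDiffWithinAt I (𝓡 N.dim) ∞ g A a) (ha : a ∈ A)
    (h : ∀ᶠ z in 𝓝[A] a, (f z, g z) ∈ D) :
    ContMDiffWithinAt I (𝓡 K.dim) ∞ (fun z => F (f z, g z)) A a :=
  ContMDiffOn.comp_within (f := fun z => (f z, g z)) hF (hf.prodMk hg) ha h

theorem SmoothMfd.Smooth.comp_within {F : M → N} (hF : Smooth F) {f : X → M}
    (hf : ContMDiffWithinAt I (𝓡 M.dim) ∞ f A a) :
    ContMDiffWithinAt I (𝓡 N.dim) ∞ (fun z => F (f z)) A a :=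
  ContMDiffAt.comp_contMDiffWithinAt a (hF (f a)) hf

end Compositions

/-! ### Manifold structures defined by local parametrizations -/

section Plots

variable {𝕏 : Type*} [NormedAddCommGroup 𝕏] [NormedSpace ℝ 𝕏] {H : Type*} [TopologicalSpace H]
  (I : ModelWithCorners ℝ 𝕏 H) {X : Type*} [TopologicalSpace X] [ChartedSpace H X]
  {Q : Type*} [TopologicalSpace Q] {d : ℕ}

/-- A chart `e` of the quotient `Q` of `A ⊆ X` through `q : A → Q` that is compatible with the
smooth structure of `X`: read through `q` it is smooth, and its inverse lifts to a smooth map `φ`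
with values in `A`. -/
structure IsLiftedChart (q : X → Q) (A : Set X)
    (e : OpenPartialHomeomorph Q (EuclideanSpace ℝ (Fin d)))
    (φ : EuclideanSpace ℝ (Fin d) → X) : Prop where
  smooth : ContMDiffOn I (𝓡 d) ∞ (e ∘ q) (A ∩ q ⁻¹' e.source)
  smooth_lift : ContMDiffOn (𝓡 d) I ∞ φ e.target
  lift_mem : ∀ v ∈ e.target, φ v ∈ A
  apply_lift : ∀ v ∈ e.target, q (φ v) = e.symm v

variable {I}

/-- Lifted charts that cover the quotient `Q` of `A` form a smooth atlas, for which `A → Q` is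
smooth and has smooth local sections. -/
theorem exists_manifold_of_liftedCharts {q : X → Q} {A : Set X} (hq : ContinuousOn q A)
    (hs : ∀ z, ∃ a ∈ A, q a = z)
    (h : ∀ a ∈ A, ∃ (e : OpenPartialHomeomorph Q (EuclideanSpace ℝ (Fin d))) (φ : _ → X),
      IsLiftedChart I q A e φ ∧ q a ∈ e.source) :
    ∃ _ : ChartedSpace (EuclideanSpace ℝ (Fin d)) Q, IsManifold (𝓡 d) ∞ Q ∧
      ContMDiffOn I (𝓡 d) ∞ q A ∧
      ∀ (e : OpenPartialHomeomorph Q (EuclideanSpace ℝ (Fin d))) (φ : _ → X),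
        IsLiftedChart I q A e φ → e ∈ IsManifold.maximalAtlas (𝓡 d) ∞ Q ∧
          ContMDiffOn (𝓡 d) I ∞ (φ ∘ e) e.source := by
  have h' : ∀ z, ∃ e : OpenPartialHomeomorph Q (EuclideanSpace ℝ (Fin d)),
      (∃ φ : _ → X, IsLiftedChart I q A e φ) ∧ z ∈ e.source := by
    intro z
    obtain ⟨a, ha, rfl⟩ := hs z
    obtain ⟨e, φ, h1, h2⟩ := h a ha
    exact ⟨e, ⟨φ, h1⟩, h2⟩
  choose c hc hz using h'
  let C : ChartedSpace (EuclideanSpace ℝ (Fin d)) Q :=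
    { atlas := {e | ∃ φ : _ → X, IsLiftedChart I q A e φ}
      chartAt := c
      mem_chart_source := hz
      chart_mem_atlas := hc }
  have hmfd : IsManifold (𝓡 d) ∞ Q := by
    apply isManifold_of_contDiffOn
    rintro e e' ⟨φ, he⟩ ⟨φ', he'⟩
    have : ContMDiffOn (𝓡 d) (𝓡 d) ∞ ((e' ∘ q) ∘ φ) (e.symm ≫ₕ e').source := by
      refine he'.smooth.comp (he.smooth_lift.mono fun v hv => ?_) fun v hv => ?_
      · simp only [mfld_simps] at hv; exact hv.1
      · simp only [mfld_simps] at hv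
        exact ⟨he.lift_mem v hv.1, by simpa [he.apply_lift v hv.1] using hv.2⟩
    have := this.contDiffOn
    simp only [modelWithCornersSelf_coe, modelWithCornersSelf_coe_symm, range_id, inter_univ,
      preimage_id, Function.comp_id, Function.id_comp]
    refine this.congr fun v hv => ?_
    simp only [mfld_simps] at hv
    simp [he.apply_lift v hv.1]
  have hmax : ∀ (e : OpenPartialHomeomorph Q (EuclideanSpace ℝ (Fin d))) (φ : _ → X),
      IsLiftedChart I q A e φ → e ∈ IsManifold.maximalAtlas (𝓡 d) ∞ Q := fun e φ he =>
    IsManifold.subset_maximalAtlas (I := 𝓡 d) (n := ∞) (M := Q) ⟨φ, he⟩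
  refine ⟨C, hmfd, fun a ha => ?_, fun e φ he => ⟨hmax e φ he, ?_⟩⟩
  · obtain ⟨e, φ, he, hae⟩ := h a ha
    have h1 : A ∩ q ⁻¹' e.source ∈ 𝓝[A] a :=
      inter_mem self_mem_nhdsWithin (hq a ha (e.open_source.mem_nhds hae))
    refine ContMDiffWithinAt.mono_of_mem_nhdsWithin (s := A ∩ q ⁻¹' e.source) ?_ h1
    have h2 : ContMDiffOn I (𝓡 d) ∞ (e.symm ∘ (e ∘ q)) (A ∩ q ⁻¹' e.source) :=
      (contMDiffOn_symm_of_mem_maximalAtlas (hmax e φ he)).comp he.smooth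
        fun b hb => e.map_source hb.2
    refine (h2.congr fun b hb => ?_) a ⟨ha, hae⟩
    simp [e.left_inv hb.2]
  · exact he.smooth_lift.comp (contMDiffOn_of_mem_maximalAtlas (hmax e φ he))
      fun z hz => e.map_source hz

/-- A local slice `φ : V → W ⊆ A` for the fibres of `q` on a relatively open saturated subset `W`
of `A`: every class in `W` meets the slice exactly once, in the point with coordinates given by the
smooth invariant map `ψ`. -/
structure IsLocalSlice (I : ModelWithCorners ℝ 𝕏 H) {Q : Type*} (q : X → Q) (A W : Set X)
    (V : Set (EuclideanSpace ℝ (Fin d)))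
    (ψ : X → EuclideanSpace ℝ (Fin d)) (φ : EuclideanSpace ℝ (Fin d) → X) : Prop where
  subset : W ⊆ A
  isOpen : ∃ U, IsOpen U ∧ W = A ∩ U
  isOpen' : IsOpen V
  saturated : ∀ a ∈ A, ∀ b ∈ W, q a = q b → a ∈ W
  invariant : ∀ a ∈ W, ∀ b ∈ W, q a = q b → ψ a = ψ b
  smooth : ContMDiffOn I (𝓡 d) ∞ ψ W
  smooth' : ContMDiffOn (𝓡 d) I ∞ φ V
  mapsTo : MapsTo ψ W V
  mapsTo' : MapsTo φ V W
  right_inv : ∀ v ∈ V, ψ (φ v) = v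
  left_inv : ∀ a ∈ W, q (φ (ψ a)) = q a

/-- A local slice defines a lifted chart, if `Q` has the quotient topology of `A`. -/
theorem IsLocalSlice.exists_liftedChart {q : X → Q} {A W : Set X}
    {V : Set (EuclideanSpace ℝ (Fin d))} {ψ : X → EuclideanSpace ℝ (Fin d)}
    {φ : EuclideanSpace ℝ (Fin d) → X} (h : IsLocalSlice I q A W V ψ φ) (hq : ContinuousOn q A)
    (hopen : ∀ O : Set Q, (∃ U, IsOpen U ∧ A ∩ q ⁻¹' O = A ∩ U) → IsOpen O) :
    ∃ e : OpenPartialHomeomorph Q (EuclideanSpace ℝ (Fin d)), IsLiftedChart I q A e φ ∧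
      e.source = q '' W ∧ e.target = V ∧ ∀ a ∈ W, e (q a) = ψ a := by
  have hinj : InjOn (q ∘ φ) V := fun v hv w hw hvw => by
    rw [← h.right_inv v hv, ← h.right_inv w hw]
    exact h.invariant _ (h.mapsTo' hv) _ (h.mapsTo' hw) hvw
  have himg : (q ∘ φ) '' V = q '' W := by
    apply Subset.antisymm
    · rintro _ ⟨v, hv, rfl⟩
      exact ⟨φ v, h.mapsTo' hv, rfl⟩
    · rintro _ ⟨a, ha, rfl⟩
      exact ⟨ψ a, h.mapsTo ha, h.left_inv a ha⟩
  have hsat : A ∩ q ⁻¹' (q '' W) = W := by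
    apply Subset.antisymm
    · rintro a ⟨ha, b, hb, hab⟩
      exact h.saturated a ha b hb hab.symm
    · exact fun a ha => ⟨h.subset ha, a, ha, rfl⟩
  let e₀ := (hinj.toPartialEquiv (q ∘ φ) V).symm
  have hsrc : e₀.source = q '' W := himg
  have heψ : ∀ a ∈ W, e₀ (q a) = ψ a := by
    intro a ha
    rw [← h.left_inv a ha]
    exact (hinj.toPartialEquiv (q ∘ φ) V).left_inv (h.mapsTo ha)
  obtain ⟨U, hU, hWU⟩ := h.isOpen
  have hsopen : IsOpen (q '' W) := hopen _ ⟨U, hU, by rw [hsat, hWU]⟩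
  let e : OpenPartialHomeomorph Q (EuclideanSpace ℝ (Fin d)) :=
    { e₀ with
      open_source := hsrc ▸ hsopen
      open_target := h.isOpen'
      continuousOn_toFun := by
        rw [hsrc, continuousOn_open_iff hsopen]
        intro O hO
        apply hopen
        obtain ⟨U', hU', hOU'⟩ := (continuousOn_iff'.1 h.smooth.continuousOn) O hO
        refine ⟨U ∩ U', hU.inter hU', ?_⟩
        ext a
        constructor
        · rintro ⟨ha, ha1, ha2⟩
          have haW : a ∈ W := hsat ▸ ⟨ha, ha1⟩
          have : a ∈ ψ ⁻¹' O ∩ W := ⟨by simpa [heψ a haW] using ha2, haW⟩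
          rw [hOU'] at this
          exact ⟨ha, (hWU ▸ haW).2, this.1⟩
        · rintro ⟨ha, ha1, ha2⟩
          have haW : a ∈ W := hWU ▸ ⟨ha, ha1⟩
          have : a ∈ U' ∩ W := ⟨ha2, haW⟩
          rw [← hOU'] at this
          exact ⟨ha, ⟨a, haW, rfl⟩, by simpa [heψ a haW] using this.1⟩
      continuousOn_invFun := by
        change ContinuousOn (q ∘ φ) V
        exact hq.comp h.smooth'.continuousOn fun v hv => h.subset (h.mapsTo' hv) }
  refine ⟨e, ⟨?_, h.smooth', fun v hv => h.subset (h.mapsTo' hv), fun v _ => rfl⟩, hsrc, rfl, heψ⟩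
  have : A ∩ q ⁻¹' e.source = W := by rw [show e.source = q '' W from hsrc, hsat]
  rw [this]
  exact h.smooth.congr fun a ha => heψ a ha

end Plots

namespace SmoothMfd

variable {M N Q K : SmoothMfd.{u}}

/-- The quotient of `A ⊆ M × N` exists as a manifold if there is a local slice through every
point. -/
theorem exists_isQuotientOf {A : Set (M × N)} {r : M × N → M × N → Prop} {Q : Type u}
    (q : M × N → Q) (hs : ∀ z, ∃ a ∈ A, q a = z) (hr : ∀ a ∈ A, ∀ b ∈ A, q a = q b ↔ r a b) (d : ℕ)
    (h : ∀ a ∈ A, ∃ (W : Set (M × N)) (V : Set (EuclideanSpace ℝ (Fin d))) (ψ : _ → _) (φ : _ → _),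
      IsLocalSlice ((𝓡 M.dim).prod (𝓡 N.dim)) q A W V ψ φ ∧ a ∈ W ∧ φ (ψ a) = a) :
    ∃ (Q' : SmoothMfd.{u}) (q' : M × N → Q'), IsQuotientOf A r q' := by
  let _ : TopologicalSpace Q := .coinduced (fun a : A => q a) inferInstance
  have hiff : ∀ O : Set Q, IsOpen O ↔ ∃ U, IsOpen U ∧ A ∩ q ⁻¹' O = A ∩ U := by
    intro O
    rw [isOpen_coinduced, isOpen_induced_iff]
    refine exists_congr fun U => and_congr_right fun _ => ?_
    rw [← Subtype.preimage_coe_eq_preimage_coe_iff, eq_comm]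
    rfl
  have hq : ContinuousOn q A := by
    rw [continuousOn_iff']
    intro O hO
    obtain ⟨U, hU, hUO⟩ := (hiff O).1 hO
    exact ⟨U, hU, by rw [inter_comm, hUO, inter_comm]⟩
  obtain ⟨C, hC, hsm, hsec⟩ := exists_manifold_of_liftedCharts hq hs (I :=
      ((𝓡 M.dim).prod (𝓡 N.dim))) (d := d) (fun a ha => by
    obtain ⟨W, V, ψ, φ, hsl, haW, -⟩ := h a ha
    obtain ⟨e, he, hes, -⟩ := hsl.exists_liftedChart hq fun O => (hiff O).2
    exact ⟨e, φ, he, hes ▸ ⟨a, haW, rfl⟩⟩)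
  refine ⟨{ carrier := Q, dim := d }, q, hsm, hs, hr, fun a ha => ?_⟩
  obtain ⟨W, V, ψ, φ, hsl, haW, haφ⟩ := h a ha
  obtain ⟨e, he, hes, het, heψ⟩ := hsl.exists_liftedChart hq fun O => (hiff O).2
  have hae : q a ∈ e.source := hes ▸ ⟨a, haW, rfl⟩
  refine ⟨φ ∘ e, e.source, e.open_source.mem_nhds hae, (hsec e φ he).2, ?_, fun z hz => ?_⟩
  · simp [heψ a haW, haφ]
  · refine ⟨he.lift_mem _ (e.map_source hz), ?_⟩
    rw [Function.comp_apply, he.apply_lift _ (e.map_source hz), e.left_inv hz]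

namespace IsQuotientOf

variable {A : Set (M × N)} {r : M × N → M × N → Prop} {q : M × N → Q}

theorem exists_section' (h : IsQuotientOf A r q) {a : M × N} (ha : a ∈ A) :
    ∃ σ : Q → M × N, σ (q a) = a ∧ ∀ᶠ z in 𝓝 (q a),
      ContMDiffAt (𝓡 Q.dim) ((𝓡 M.dim).prod (𝓡 N.dim)) ∞ σ z ∧ σ z ∈ A ∧ q (σ z) = z := by
  obtain ⟨σ, U, hU, hσ, hσa, hs⟩ := h.exists_section a ha
  refine ⟨σ, hσa, ?_⟩
  filter_upwards [eventually_mem_nhds_iff.2 hU] with z hz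
  exact ⟨hσ.contMDiffAt hz, hs z (mem_of_mem_nhds hz)⟩

/-- Smooth functions on the quotient are the invariant smooth functions. -/
theorem exists_lift (h : IsQuotientOf A r q) {F : M × N → K} (hF : SmoothOn₂ F A)
    (hr : ∀ a ∈ A, ∀ b ∈ A, r a b → F a = F b) :
    ∃ f : Q → K, Smooth f ∧ ∀ a ∈ A, f (q a) = F a := by
  choose s hsA hsq using h.surj
  have hfq : ∀ a ∈ A, F (s (q a)) = F a := fun a ha =>
    hr _ (hsA _) _ ha ((h.eq_iff _ (hsA _) _ ha).1 (hsq _))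
  refine ⟨F ∘ s, fun z => ?_, hfq⟩
  obtain ⟨a, ha, rfl⟩ := h.surj z
  obtain ⟨σ, hσa, hσ⟩ := h.exists_section' ha
  have h1 : ∀ᶠ z in 𝓝 (q a), (σ z) ∈ A := hσ.mono fun z hz => hz.2.1
  have h2 : ContMDiffAt (𝓡 Q.dim) (𝓡 K.dim) ∞ (fun z => F (σ z)) (q a) := by
    rw [← contMDiffWithinAt_univ]
    exact ContMDiffOn.comp_within hF hσ.self_of_nhds.1.contMDiffWithinAt (mem_univ _)
      (by rw [nhdsWithin_univ]; exact h1)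
  refine h2.congr_of_eventuallyEq ?_
  filter_upwards [hσ] with z hz
  have := hfq _ hz.2.1
  rw [hz.2.2] at this
  exact this

end IsQuotientOf

end SmoothMfd

/-! ### Calculus in groupoids, actions and principal actions -/

namespace LieGroupoid

variable {P : SmoothMfd.{u}} (Γ : LieGroupoid P)

theorem eq_inv_of_mul_eq_unit {k g : Γ.Arr} (h : Γ.src k = Γ.tgt g)
    (hk : Γ.mul k g = Γ.unit (Γ.src g)) : k = Γ.inv g := by
  rw [← Γ.mul_unit k, h, ← Γ.mul_inv, ← Γ.mul_assoc _ _ _ h (Γ.tgt_inv g).symm, hk,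
    ← Γ.tgt_inv g, Γ.unit_mul]

theorem inv_inv (g : Γ.Arr) : Γ.inv (Γ.inv g) = g :=
  (Γ.eq_inv_of_mul_eq_unit (Γ.tgt_inv g).symm (by rw [Γ.mul_inv, Γ.src_inv])).symm

theorem inv_unit (x : P) : Γ.inv (Γ.unit x) = Γ.unit x := by
  refine (Γ.eq_inv_of_mul_eq_unit ?_ ?_).symm
  · rw [Γ.src_unit, Γ.tgt_unit]
  · have := Γ.mul_unit (Γ.unit x)
    rwa [Γ.src_unit] at this ⊢

theorem inv_mul_cancel_left {g h : Γ.Arr} (e : Γ.src g = Γ.tgt h) :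
    Γ.mul (Γ.inv g) (Γ.mul g h) = h := by
  rw [← Γ.mul_assoc _ _ _ (Γ.src_inv g) e, Γ.inv_mul, e, Γ.unit_mul]

theorem mul_inv_cancel_right {g h : Γ.Arr} (e : Γ.src g = Γ.tgt h) :
    Γ.mul (Γ.mul g h) (Γ.inv h) = g := by
  rw [Γ.mul_assoc _ _ _ e (Γ.tgt_inv h).symm, Γ.mul_inv, ← e, Γ.mul_unit]

theorem mul_inv_rev {g h : Γ.Arr} (e : Γ.src g = Γ.tgt h) :
    Γ.inv (Γ.mul g h) = Γ.mul (Γ.inv h) (Γ.inv g) := by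
  have e' : Γ.src (Γ.inv h) = Γ.tgt (Γ.inv g) := by rw [Γ.src_inv, Γ.tgt_inv, e]
  refine (Γ.eq_inv_of_mul_eq_unit ?_ ?_).symm
  · rw [Γ.src_mul _ _ e', Γ.src_inv, Γ.tgt_mul _ _ e]
  · rw [Γ.mul_assoc _ _ _ e' (by rw [Γ.src_inv, Γ.tgt_mul _ _ e]), Γ.inv_mul_cancel_left e,
      Γ.inv_mul, Γ.src_mul _ _ e]

end LieGroupoid

section Actions

variable {P : SmoothMfd.{u}} {Γ : LieGroupoid P} {S M : SmoothMfd.{u}}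

theorem RightAction.act_act_inv (a : RightAction Γ S) {x : S} {g : Γ.Arr}
    (h : a.moment x = Γ.tgt g) : a.act (a.act x g) (Γ.inv g) = x := by
  rw [← a.act_mul _ _ _ h (Γ.tgt_inv g).symm, Γ.mul_inv, ← h, a.act_unit]

theorem LeftAction.inv_act_act (a : LeftAction Γ S) {x : S} {g : Γ.Arr}
    (h : Γ.src g = a.moment x) : a.act (Γ.inv g) (a.act g x) = x := by
  rw [← a.mul_act _ _ _ (Γ.src_inv g) h, Γ.inv_mul, h, a.unit_act]

/-- A left action as a right action of the inverse arrows. -/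
abbrev LeftAction.op (a : LeftAction Γ S) : RightAction Γ S where
  moment := a.moment
  act x g := a.act (Γ.inv g) x
  smooth_moment := a.smooth_moment
  smooth_act := fun z hz => a.smooth_act.comp_within
    (f := fun z : S × Γ.Arr => Γ.inv z.2) (g := Prod.fst)
    (Smooth.comp_within Γ.smooth_inv contMDiffWithinAt_snd) contMDiffWithinAt_fst hz
    (eventually_mem_nhdsWithin.mono fun w hw => (Γ.src_inv w.2).trans (Eq.symm hw))
  moment_act x g h := by rw [a.moment_act _ _ (by rw [Γ.src_inv, h]), Γ.tgt_inv]
  act_unit x := by rw [Γ.inv_unit, a.unit_act]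
  act_mul x g h hx hg := by
    rw [Γ.mul_inv_rev hg, a.mul_act _ _ _ (by rw [Γ.src_inv, Γ.tgt_inv, hg])
      (by rw [Γ.src_inv, hx])]

/-- A right action as a left action of the inverse arrows. -/
abbrev RightAction.op (a : RightAction Γ S) : LeftAction Γ S where
  moment := a.moment
  act g x := a.act x (Γ.inv g)
  smooth_moment := a.smooth_moment
  smooth_act := fun z hz => a.smooth_act.comp_within
    (f := Prod.snd) (g := fun z : Γ.Arr × S => Γ.inv z.1) contMDiffWithinAt_snd
    (Smooth.comp_within Γ.smooth_inv contMDiffWithinAt_fst) hz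
    (eventually_mem_nhdsWithin.mono fun w hw => (Eq.symm hw).trans (Γ.tgt_inv w.1).symm)
  moment_act g x h := by rw [a.moment_act _ _ (by rw [Γ.tgt_inv, h]), Γ.src_inv]
  unit_act x := by rw [Γ.inv_unit, a.act_unit]
  mul_act g h x hg hx := by
    rw [Γ.mul_inv_rev hg, a.act_mul _ _ _ (by rw [Γ.tgt_inv, hx])
      (by rw [Γ.src_inv, Γ.tgt_inv, hg])]

theorem LeftAction.op_op (a : LeftAction Γ S) : a.op.op = a := by
  cases a
  simp only [RightAction.op, Γ.inv_inv]

theorem LeftAction.IsPrincipal.op {a : LeftAction Γ S} {p : S → M} (h : a.IsPrincipal p) :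
    a.op.IsPrincipal p where
  submersion := h.submersion
  invariant x g hx := h.invariant _ _ (by rw [Γ.src_inv]; exact hx.symm)
  free x g hx hg := by
    have := h.free _ _ (by rw [Γ.src_inv]; exact hx.symm) hg
    rw [← Γ.inv_inv g, this, Γ.inv_unit]
  transitive x y hxy := by
    obtain ⟨g, hg, hgx⟩ := h.transitive y x hxy.symm
    exact ⟨Γ.inv g, by rw [Γ.tgt_inv, hg], by simpa [LeftAction.op, Γ.inv_inv] using hgx⟩
  smooth_div := by
    obtain ⟨δ, hδ, h2⟩ := h.smooth_div
    refine ⟨fun z => δ z, hδ, fun x y hxy => ?_⟩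
    obtain ⟨h3, h4⟩ := h2 x y hxy
    have h5 : a.moment x = Γ.tgt (δ (x, y)) := by rw [← a.moment_act _ _ h3, h4]
    refine ⟨h5, ?_⟩
    have := a.inv_act_act h3
    rwa [h4] at this

theorem RightAction.IsPrincipal.op {a : RightAction Γ S} {p : S → M} (h : a.IsPrincipal p) :
    a.op.IsPrincipal p where
  submersion := h.submersion
  invariant g x hx := h.invariant _ _ (by rw [Γ.tgt_inv]; exact hx.symm)
  free g x hx hg := by
    have := h.free _ _ (by rw [Γ.tgt_inv]; exact hx.symm) hg
    rw [← Γ.inv_inv g, this, Γ.inv_unit]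
  transitive x y hxy := by
    obtain ⟨g, hg, hgx⟩ := h.transitive y x hxy.symm
    exact ⟨Γ.inv g, by rw [Γ.src_inv, ← hg], by simpa [RightAction.op, Γ.inv_inv] using hgx⟩
  smooth_div := by
    obtain ⟨δ, hδ, h2⟩ := h.smooth_div
    refine ⟨fun z => δ z, hδ, fun x y hxy => ?_⟩
    obtain ⟨h3, h4⟩ := h2 x y hxy
    have h5 : a.moment y = Γ.src (δ (x, y)) := by rw [← a.moment_act _ _ h3, h4]
    refine ⟨h5.symm, ?_⟩
    have := a.act_act_inv h3
    rwa [h4] at this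

theorem RightAction.cancel_of_free (a : RightAction Γ S)
    (hfree : ∀ x g, a.moment x = Γ.tgt g → a.act x g = x → g = Γ.unit (a.moment x))
    {x : S} {g k : Γ.Arr} (hg : a.moment x = Γ.tgt g) (hk : a.moment x = Γ.tgt k)
    (e : a.act x g = a.act x k) : g = k := by
  have hs : Γ.src g = Γ.src k := by rw [← a.moment_act _ _ hg, e, a.moment_act _ _ hk]
  have h0 : Γ.src g = Γ.tgt (Γ.inv k) := by rw [Γ.tgt_inv, hs]
  have h1 := hfree x (Γ.mul g (Γ.inv k)) (by rw [Γ.tgt_mul _ _ h0, hg])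
    (by rw [a.act_mul _ _ _ hg h0, e, a.act_act_inv hk])
  have h2 := Γ.mul_inv_cancel_right (g := Γ.mul g (Γ.inv k)) (h := k)
    (by rw [Γ.src_mul _ _ h0, Γ.src_inv])
  rw [h1, hk, Γ.unit_mul] at h2
  have h3 : Γ.mul (Γ.mul g (Γ.inv k)) k = g := by
    rw [Γ.mul_assoc _ _ _ h0 (Γ.src_inv k), Γ.inv_mul, ← hs, Γ.mul_unit]
  rw [h1, hk, Γ.unit_mul] at h3
  exact h3.symm

namespace RightAction.IsPrincipal

variable {a : RightAction Γ S} {p : S → M} (h : a.IsPrincipal p)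
include h

theorem cancel {x : S} {g k : Γ.Arr} (hg : a.moment x = Γ.tgt g) (hk : a.moment x = Γ.tgt k)
    (e : a.act x g = a.act x k) : g = k :=
  a.cancel_of_free h.free hg hk e

omit h in
/-- The division map `(x, x g) ↦ g` of a principal right action. -/
noncomputable def div (h : a.IsPrincipal p) : S × S → Γ.Arr := h.smooth_div.choose

theorem smooth_div' : SmoothOn₂ h.div {z | p z.1 = p z.2} := h.smooth_div.choose_spec.1

theorem tgt_div {x y : S} (e : p x = p y) : Γ.tgt (h.div (x, y)) = a.moment x :=
  (h.smooth_div.choose_spec.2 x y e).1.symm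

theorem act_div {x y : S} (e : p x = p y) : a.act x (h.div (x, y)) = y :=
  (h.smooth_div.choose_spec.2 x y e).2

theorem src_div {x y : S} (e : p x = p y) : Γ.src (h.div (x, y)) = a.moment y := by
  rw [← a.moment_act _ _ (h.tgt_div e).symm, h.act_div e]

theorem div_act {x : S} {g : Γ.Arr} (e : a.moment x = Γ.tgt g) : h.div (x, a.act x g) = g :=
  h.cancel (h.tgt_div (h.invariant _ _ e).symm).symm e (h.act_div (h.invariant _ _ e).symm)

theorem div_self (x : S) : h.div (x, x) = Γ.unit (a.moment x) := by
  have := h.div_act (x := x) (Γ.tgt_unit (a.moment x)).symm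
  rwa [a.act_unit] at this

theorem div_act_right {x y : S} {g : Γ.Arr} (e : p x = p y) (hg : a.moment y = Γ.tgt g) :
    h.div (x, a.act y g) = Γ.mul (h.div (x, y)) g := by
  have e' : Γ.src (h.div (x, y)) = Γ.tgt g := by rw [h.src_div e, hg]
  have := h.div_act (x := x) (g := Γ.mul (h.div (x, y)) g) (by rw [Γ.tgt_mul _ _ e', h.tgt_div e])
  rwa [a.act_mul _ _ _ (h.tgt_div e).symm e', h.act_div e] at this

end RightAction.IsPrincipal

namespace LeftAction.IsPrincipal

variable {a : LeftAction Γ S} {p : S → M} (h : a.IsPrincipal p)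
include h

theorem cancel {x : S} {g k : Γ.Arr} (hg : Γ.src g = a.moment x) (hk : Γ.src k = a.moment x)
    (e : a.act g x = a.act k x) : g = k := by
  have := h.op.cancel (x := x) (g := Γ.inv g) (k := Γ.inv k) (by rw [Γ.tgt_inv, hg])
    (by rw [Γ.tgt_inv, hk]) (by simpa [LeftAction.op, Γ.inv_inv] using e)
  rw [← Γ.inv_inv g, this, Γ.inv_inv]

omit h in
/-- The division map `(g x, x) ↦ g` of a principal left action. -/
noncomputable def div (h : a.IsPrincipal p) : S × S → Γ.Arr := h.smooth_div.choose

theorem smooth_div' : SmoothOn₂ h.div {z | p z.1 = p z.2} := h.smooth_div.choose_spec.1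

theorem src_div {x y : S} (e : p x = p y) : Γ.src (h.div (x, y)) = a.moment y :=
  (h.smooth_div.choose_spec.2 x y e).1

theorem div_act {x y : S} (e : p x = p y) : a.act (h.div (x, y)) y = x :=
  (h.smooth_div.choose_spec.2 x y e).2

theorem tgt_div {x y : S} (e : p x = p y) : Γ.tgt (h.div (x, y)) = a.moment x := by
  rw [← a.moment_act _ _ (h.src_div e), h.div_act e]

end LeftAction.IsPrincipal

end Actions

/-! ### Actions on quotients -/

/-- An action of `Γ` on `A` that preserves the relation `r` induces an action on the quotient. -/
theorem SmoothMfd.IsQuotientOf.exists_rightAction {M N Q P : SmoothMfd.{u}} {Γ : LieGroupoid P}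
    {A : Set (M × N)} {r : M × N → M × N → Prop} {q : M × N → Q} (h : IsQuotientOf A r q)
    {μ : M × N → P} (hμ : SmoothOn₂ μ A) (hμr : ∀ a ∈ A, ∀ b ∈ A, r a b → μ a = μ b)
    {α : M × N → Γ.Arr → M × N}
    (hα : ContMDiffOn (((𝓡 M.dim).prod (𝓡 N.dim)).prod (𝓡 Γ.Arr.dim)) ((𝓡 M.dim).prod (𝓡 N.dim)) ∞
      (fun z : (M × N) × Γ.Arr => α z.1 z.2) {z | z.1 ∈ A ∧ μ z.1 = Γ.tgt z.2})
    (hαA : ∀ a ∈ A, ∀ g, μ a = Γ.tgt g → α a g ∈ A)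
    (hαr : ∀ a ∈ A, ∀ b ∈ A, ∀ g, μ a = Γ.tgt g → r a b → r (α a g) (α b g))
    (hαμ : ∀ a ∈ A, ∀ g, μ a = Γ.tgt g → μ (α a g) = Γ.src g)
    (hunit : ∀ a ∈ A, α a (Γ.unit (μ a)) = a)
    (hmul : ∀ a ∈ A, ∀ g k, μ a = Γ.tgt g → Γ.src g = Γ.tgt k →
      α a (Γ.mul g k) = α (α a g) k) :
    ∃ b : RightAction Γ Q, (∀ a ∈ A, b.moment (q a) = μ a) ∧
      ∀ a ∈ A, ∀ g, μ a = Γ.tgt g → b.act (q a) g = q (α a g) := by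
  obtain ⟨J, hJ, hJq⟩ := h.exists_lift hμ hμr
  choose s hsA hsq using h.surj
  have key : ∀ a ∈ A, ∀ g, μ a = Γ.tgt g → q (α (s (q a)) g) = q (α a g) := by
    intro a ha g hg
    have h1 : r (s (q a)) a := (h.eq_iff _ (hsA _) _ ha).1 (hsq _)
    have h2 : μ (s (q a)) = Γ.tgt g := by rw [hμr _ (hsA _) _ ha h1, hg]
    exact (h.eq_iff _ (hαA _ (hsA _) _ h2) _ (hαA _ ha _ hg)).2 (hαr _ (hsA _) _ ha _ h2 h1)
  refine ⟨{
    moment := J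
    act := fun z g => q (α (s z) g)
    smooth_moment := hJ
    smooth_act := ?_
    moment_act := ?_
    act_unit := ?_
    act_mul := ?_ }, hJq, key⟩
  · rintro ⟨z₀, g₀⟩ hz₀
    obtain ⟨a, ha, rfl⟩ := h.surj z₀
    obtain ⟨σ, hσa, hσ⟩ := h.exists_section' ha
    have hev : ∀ᶠ w in 𝓝[{w : Q × Γ.Arr | J w.1 = Γ.tgt w.2}] (q a, g₀),
        (σ w.1 ∈ A ∧ q (σ w.1) = w.1) ∧ μ (σ w.1) = Γ.tgt w.2 := by
      have h1 : ∀ᶠ w in 𝓝[{w : Q × Γ.Arr | J w.1 = Γ.tgt w.2}] (q a, g₀),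
          σ w.1 ∈ A ∧ q (σ w.1) = w.1 :=
        (continuous_fst.continuousWithinAt (x := (q a, g₀))).eventually
          (hσ.mono fun z hz => hz.2 : ∀ᶠ z in 𝓝 (q a), σ z ∈ A ∧ q (σ z) = z)
      filter_upwards [h1, self_mem_nhdsWithin] with w hw hw'
      refine ⟨hw, ?_⟩
      rw [← hJq _ hw.1, hw.2]
      exact hw'
    have h3 : ContMDiffWithinAt ((𝓡 Q.dim).prod (𝓡 Γ.Arr.dim)) ((𝓡 M.dim).prod (𝓡 N.dim)) ∞
        (fun w : Q × Γ.Arr => σ w.1) {w : Q × Γ.Arr | J w.1 = Γ.tgt w.2} (q a, g₀) :=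
      hσ.self_of_nhds.1.comp_contMDiffWithinAt (q a, g₀) contMDiffWithinAt_fst
    have h4 := ContMDiffOn.comp_within (f := fun w : Q × Γ.Arr => (σ w.1, w.2)) hα
      (h3.prodMk contMDiffWithinAt_snd) hz₀ (hev.mono fun w hw => ⟨hw.1.1, hw.2⟩)
    have h5 := ContMDiffOn.comp_within h.smooth h4 hz₀
      (hev.mono fun w hw => hαA _ hw.1.1 _ hw.2)
    refine h5.congr_of_eventuallyEq ?_ ?_
    · filter_upwards [hev] with w hw
      rw [← key _ hw.1.1 _ hw.2, hw.1.2]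
    · have hw := hev.self_of_nhdsWithin hz₀
      change q (α (s (q a)) g₀) = _
      rw [← key _ hw.1.1 _ hw.2, hw.1.2]
  · intro z g hg
    obtain ⟨a, ha, rfl⟩ := h.surj z
    have hg' : μ a = Γ.tgt g := by rw [← hJq a ha, hg]
    rw [key a ha g hg', hJq _ (hαA a ha g hg'), hαμ a ha g hg']
  · intro z
    obtain ⟨a, ha, rfl⟩ := h.surj z
    rw [hJq a ha, key a ha _ (Γ.tgt_unit _).symm, hunit a ha]
  · intro z g k hg hk
    obtain ⟨a, ha, rfl⟩ := h.surj z
    have hg' : μ a = Γ.tgt g := by rw [← hJq a ha, hg]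
    rw [key a ha g hg', key a ha _ (by rw [Γ.tgt_mul _ _ hk, hg']), hmul a ha g k hg' hk,
      key _ (hαA a ha g hg') k (by rw [hαμ a ha g hg', hk])]

namespace Bibundle

variable {P₁ P₂ P₃ P₄ : SmoothMfd.{u}} {Γ₁ : LieGroupoid P₁} {Γ₂ : LieGroupoid P₂}
  {Γ₃ : LieGroupoid P₃} {Γ₄ : LieGroupoid P₄}

/-- The opposite bibundle, on which the groupoids act through inverse arrows. -/
abbrev op (S : Bibundle Γ₁ Γ₂) : Bibundle Γ₂ Γ₁ where
  space := S.space
  left := S.right.op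
  right := S.left.op
  right_moment_left g x h := S.left_moment_right _ _ (by rw [Γ₂.tgt_inv, h])
  left_moment_right x g h := S.right_moment_left _ _ (by rw [Γ₁.src_inv, ← h])
  comm g x k hg hk := (S.comm (Γ₁.inv k) x (Γ₂.inv g) (by rw [Γ₁.src_inv, ← hk])
    (by rw [Γ₂.tgt_inv, hg])).symm

theorem op_op_isomorphic (S : Bibundle Γ₁ Γ₂) : S.op.op.Isomorphic S :=
  ⟨Diffeomorph.refl _ _ _, fun _ => rfl, fun _ => rfl,
    fun g x _ => congrArg (S.left.act · x) (Γ₁.inv_inv g),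
    fun x h _ => congrArg (S.right.act x) (Γ₂.inv_inv h)⟩

theorem IsBiprincipal.op {S : Bibundle Γ₁ Γ₂} (h : S.IsBiprincipal) : S.op.IsBiprincipal :=
  ⟨h.2.op, h.1.op⟩

/-! ### Balanced maps and tensor products -/

/-- A balanced map `S ×_{P₂} S' → T`: a smooth map that is compatible with the outer actions and
moments, and with the two actions of the groupoid in the middle. -/
structure IsBalanced (S : Bibundle Γ₁ Γ₂) (S' : Bibundle Γ₂ Γ₃) (T : Bibundle Γ₁ Γ₃)
    (q : S.space × S'.space → T.space) : Prop where
  smooth : SmoothOn₂ q {z | S.right.moment z.1 = S'.left.moment z.2}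
  left_moment : ∀ x y, S.right.moment x = S'.left.moment y →
    T.left.moment (q (x, y)) = S.left.moment x
  right_moment : ∀ x y, S.right.moment x = S'.left.moment y →
    T.right.moment (q (x, y)) = S'.right.moment y
  left_act : ∀ x y g, S.right.moment x = S'.left.moment y → Γ₁.src g = S.left.moment x →
    T.left.act g (q (x, y)) = q (S.left.act g x, y)
  right_act : ∀ x y h, S.right.moment x = S'.left.moment y → S'.right.moment y = Γ₃.tgt h →
    T.right.act (q (x, y)) h = q (x, S'.right.act y h)
  balanced : ∀ x y g, S.right.moment x = Γ₂.tgt g → Γ₂.src g = S'.left.moment y →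
    q (S.right.act x g, y) = q (x, S'.left.act g y)

variable {S : Bibundle Γ₁ Γ₂} {S' : Bibundle Γ₂ Γ₃} {T : Bibundle Γ₁ Γ₃}

theorem IsTensorProduct.exists_balanced (h : S.IsTensorProduct S' T) :
    ∃ q, IsBalanced S S' T q ∧
      IsQuotientOf {z : S.space × S'.space | S.right.moment z.1 = S'.left.moment z.2}
      (fun z w => ∃ g, S.right.moment z.1 = Γ₂.tgt g ∧
        w = (S.right.act z.1 g, S'.left.act (Γ₂.inv g) z.2)) q := by
  obtain ⟨q, hq, h2⟩ := h
  refine ⟨q, ⟨hq.smooth, fun x y e => (h2 x y e).1, fun x y e => (h2 x y e).2.1,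
    fun x y g e hg => (h2 x y e).2.2.1 g hg, fun x y g e hg => (h2 x y e).2.2.2 g hg, ?_⟩, hq⟩
  intro x y g hg hy
  refine ((hq.eq_iff (x, S'.left.act g y) ?_ (S.right.act x g, y) ?_).2 ⟨g, hg, ?_⟩).symm
  · exact hg.trans (S'.left.moment_act _ _ hy).symm
  · exact (S.right.moment_act _ _ hg).trans hy
  · rw [S'.left.inv_act_act hy]

/-- For principal right actions, a balanced map into `T` exhibits `T` as the tensor product. -/
theorem IsBalanced.isTensorProduct (hS : S.right.IsPrincipal S.left.moment)
    (hS' : S'.right.IsPrincipal S'.left.moment) (hT : T.right.IsPrincipal T.left.moment)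
    {q : S.space × S'.space → T.space} (h : IsBalanced S S' T q) : S.IsTensorProduct S' T := by
  refine ⟨q, ⟨h.smooth, ?_, ?_, ?_⟩, fun x y e => ⟨h.left_moment x y e, h.right_moment x y e,
    fun g hg => h.left_act x y g e hg, fun g hg => h.right_act x y g e hg⟩⟩
  · intro t
    obtain ⟨x, hx⟩ := hS.submersion.1 (T.left.moment t)
    obtain ⟨y, hy⟩ := hS'.submersion.1 (S.right.moment x)
    obtain ⟨g, hg, hgt⟩ := hT.transitive (q (x, y)) t (by rw [h.left_moment x y hy.symm, hx])
    rw [h.right_moment _ _ hy.symm] at hg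
    refine ⟨(x, S'.right.act y g), ?_, ?_⟩
    · exact hy.symm.trans (S'.left_moment_right _ _ hg).symm
    · rw [← h.right_act x y g hy.symm hg, hgt]
  · rintro ⟨x, y⟩ hxy ⟨x', y'⟩ hxy'
    change S.right.moment x = S'.left.moment y at hxy
    change S.right.moment x' = S'.left.moment y' at hxy'
    constructor
    · intro e
      obtain ⟨g, hg, rfl⟩ := hS.transitive x x' (by
        rw [← h.left_moment x y hxy, ← h.left_moment x' y' hxy', e])
      rw [S.right.moment_act _ _ hg] at hxy'
      have hgy' : S'.left.moment (S'.left.act g y') = S.right.moment x := by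
        rw [S'.left.moment_act _ _ hxy', hg]
      rw [h.balanced x y' g hg hxy'] at e
      obtain ⟨k, hk, hky⟩ := hS'.transitive y (S'.left.act g y') (by rw [hgy', hxy])
      have hk' : T.right.moment (q (x, y)) = Γ₃.tgt k := by rw [h.right_moment _ _ hxy, hk]
      have hkt := hT.free (q (x, y)) k hk' (by rw [h.right_act _ _ _ hxy hk, hky, e])
      rw [hkt, h.right_moment _ _ hxy, S'.right.act_unit] at hky
      refine ⟨g, hg, ?_⟩
      rw [hky, S'.left.inv_act_act hxy']
    · rintro ⟨g, hg, hw⟩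
      obtain ⟨rfl, rfl⟩ := Prod.mk.inj hw
      have hgy : Γ₂.src (Γ₂.inv g) = S'.left.moment y := by rw [Γ₂.src_inv, ← hg, hxy]
      change S.right.moment x = Γ₂.tgt g at hg
      change q (x, y) = q (S.right.act x g, S'.left.act (Γ₂.inv g) y)
      rw [h.balanced x _ g hg (by rw [S'.left.moment_act _ _ hgy, Γ₂.tgt_inv])]
      have := S'.left.inv_act_act hgy
      rw [Γ₂.inv_inv] at this
      rw [this]
  · rintro ⟨x₀, y₀⟩ hxy
    change S.right.moment x₀ = S'.left.moment y₀ at hxy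
    obtain ⟨σ, hσ₀, hσ⟩ := hS.submersion.exists_section x₀
    obtain ⟨τ, hτ₀, hτ⟩ := hS'.submersion.exists_section y₀
    set t₀ := q (x₀, y₀) with ht₀
    have hJ₀ : T.left.moment t₀ = S.left.moment x₀ := h.left_moment _ _ hxy
    let f : T.space → S.space := fun t => σ (T.left.moment t)
    let k : T.space → S'.space := fun t => τ (S.right.moment (f t))
    have hf₀ : f t₀ = x₀ := by simp only [f, hJ₀, hσ₀]
    have hk₀ : k t₀ = y₀ := by simp only [k, hf₀, hxy, hτ₀]
    have hev1 : ∀ᶠ t in 𝓝 t₀, ContMDiffAt (𝓡 T.space.dim) (𝓡 S.space.dim) ∞ f t ∧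
        S.left.moment (f t) = T.left.moment t := by
      have := (T.left.smooth_moment.continuous.continuousAt (x := t₀)).eventually
        (by rw [hJ₀]; exact hσ)
      filter_upwards [this] with t ht
      exact ⟨ht.1.comp t (T.left.smooth_moment t), ht.2⟩
    have hev2 : ∀ᶠ t in 𝓝 t₀, ContMDiffAt (𝓡 T.space.dim) (𝓡 S'.space.dim) ∞ k t ∧
        S'.left.moment (k t) = S.right.moment (f t) := by
      have hc : ContinuousAt (fun t => S.right.moment (f t)) t₀ :=
        S.right.smooth_moment.continuous.continuousAt.comp hev1.self_of_nhds.1.continuousAt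
      have := hc.eventually (by simp only [hf₀, hxy]; exact hτ)
      filter_upwards [this, hev1] with t ht ht1
      exact ⟨ht.1.comp t ((S.right.smooth_moment (f t)).comp t ht1.1), ht.2⟩
    obtain ⟨U, hU, hUo, ht₀U⟩ := eventually_nhds_iff.1 (hev1.and hev2)
    have hq0 : ∀ t ∈ U, T.left.moment (q (f t, k t)) = T.left.moment t := fun t ht => by
      rw [h.left_moment _ _ (hU t ht).2.2.symm, (hU t ht).1.2]
    let δ : T.space → Γ₃.Arr := fun t => hT.div (q (f t, k t), t)
    have hδt : ∀ t ∈ U, S'.right.moment (k t) = Γ₃.tgt (δ t) := fun t ht => by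
      rw [hT.tgt_div (hq0 t ht), h.right_moment _ _ (hU t ht).2.2.symm]
    have hev : ∀ t ∈ U, ∀ᶠ s in 𝓝[U] t, s ∈ U := fun t ht => self_mem_nhdsWithin
    have hfs : ∀ t ∈ U, ContMDiffWithinAt (𝓡 T.space.dim) (𝓡 S.space.dim) ∞ f U t :=
      fun t ht => (hU t ht).1.1.contMDiffWithinAt
    have hks : ∀ t ∈ U, ContMDiffWithinAt (𝓡 T.space.dim) (𝓡 S'.space.dim) ∞ k U t :=
      fun t ht => (hU t ht).2.1.contMDiffWithinAt
    have hqs : ∀ t ∈ U, ContMDiffWithinAt (𝓡 T.space.dim) (𝓡 T.space.dim) ∞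
        (fun t => q (f t, k t)) U t := fun t ht =>
      h.smooth.comp_within (hfs t ht) (hks t ht) ht
        ((hev t ht).mono fun s hs => (hU s hs).2.2.symm)
    have hδs : ∀ t ∈ U, ContMDiffWithinAt (𝓡 T.space.dim) (𝓡 Γ₃.Arr.dim) ∞ δ U t := fun t ht =>
      hT.smooth_div'.comp_within (hqs t ht) contMDiffWithinAt_id ht ((hev t ht).mono hq0)
    refine ⟨fun t => (f t, S'.right.act (k t) (δ t)), U, hUo.mem_nhds ht₀U, fun t ht =>
      (hfs t ht).prodMk (S'.right.smooth_act.comp_within (hks t ht) (hδs t ht) ht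
        ((hev t ht).mono hδt)), ?_, fun t ht => ⟨?_, ?_⟩⟩
    · have : δ t₀ = Γ₃.unit (S'.right.moment y₀) := by
        simp only [δ, hf₀, hk₀]
        rw [← ht₀, hT.div_self, ht₀, h.right_moment _ _ hxy]
      change (f t₀, S'.right.act (k t₀) (δ t₀)) = _
      rw [this, hf₀, hk₀, S'.right.act_unit]
    · exact (hU t ht).2.2.symm.trans (S'.left_moment_right _ _ (hδt t ht)).symm
    · change q (f t, S'.right.act (k t) (δ t)) = t
      rw [← h.right_act _ _ _ (hU t ht).2.2.symm (hδt t ht), hT.act_div (hq0 t ht)]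

end Bibundle

/-! ### Associated bundles -/

/-- The quotient of `A` by an equivalence relation on `A`, as a map that is defined on all of `X`;
the hypothesis on `A` provides a value outside `A`. -/
theorem exists_surjection_of_equivalence {X : Type u} {A : Set X} (hA : A.Nonempty ∨ IsEmpty X)
    {r : X → X → Prop} (refl : ∀ a ∈ A, r a a) (symm : ∀ a ∈ A, ∀ b ∈ A, r a b → r b a)
    (trans : ∀ a ∈ A, ∀ b ∈ A, ∀ c ∈ A, r a b → r b c → r a c) :
    ∃ (Q : Type u) (q : X → Q), (∀ z, ∃ a ∈ A, q a = z) ∧ ∀ a ∈ A, ∀ b ∈ A, q a = q b ↔ r a b := by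
  classical
  let s : Setoid A :=
    { r := fun a b => r a b
      iseqv := ⟨fun a => refl a a.2, fun {a b} h => symm a a.2 b b.2 h,
        fun {a b c} h h' => trans a a.2 b b.2 c c.2 h h'⟩ }
  rcases hA with ⟨a₀, ha₀⟩ | hX
  · refine ⟨Quotient s, fun x => if h : x ∈ A then Quotient.mk s ⟨x, h⟩ else Quotient.mk s ⟨a₀, ha₀⟩,
      fun z => ?_, fun a ha b hb => ?_⟩
    · obtain ⟨⟨a, ha⟩, rfl⟩ := Quotient.exists_rep z
      exact ⟨a, ha, by simp [ha]⟩
    · simp only [ha, hb, dif_pos]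
      exact Quotient.eq
  · exact ⟨PEmpty, fun x => hX.elim x, fun z => z.elim, fun a => hX.elim a⟩

/-- The quotient `(E ×_P F) / Γ` of the fibre product of a principal bundle `E` with a left
`Γ`-manifold `F` whose moment is a submersion exists as a manifold: a local section of `E → B`
identifies it, over an open subset of `B`, with a fibre product of `B` and `F`. -/
theorem RightAction.IsPrincipal.exists_isQuotientOf {P B E F : SmoothMfd.{u}} {Γ : LieGroupoid P}
    {a : RightAction Γ E} {p : E → B} (ha : a.IsPrincipal p) (b : LeftAction Γ F)
    (hb : SurjSubmersion b.moment) :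
    ∃ (Q : SmoothMfd.{u}) (q : E × F → Q),
      IsQuotientOf {z : E × F | a.moment z.1 = b.moment z.2}
        (fun z w => ∃ g, a.moment z.1 = Γ.tgt g ∧ w = (a.act z.1 g, b.act (Γ.inv g) z.2)) q := by
  set A : Set (E × F) := {z : E × F | a.moment z.1 = b.moment z.2} with hAdef
  set r : E × F → E × F → Prop :=
    fun z w => ∃ g, a.moment z.1 = Γ.tgt g ∧ w = (a.act z.1 g, b.act (Γ.inv g) z.2) with hrdef
  obtain ⟨Q, q, hqs, hqr⟩ : ∃ (Q : Type u) (q : E × F → Q), (∀ z, ∃ a ∈ A, q a = z) ∧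
      ∀ a ∈ A, ∀ b ∈ A, q a = q b ↔ r a b := by
    apply exists_surjection_of_equivalence
    · by_cases hE : Nonempty E
      · obtain ⟨x⟩ := hE
        obtain ⟨y, hy⟩ := hb.1 (a.moment x)
        exact Or.inl ⟨(x, y), hy.symm⟩
      · exact Or.inr ⟨fun z => hE ⟨z.1⟩⟩
    · rintro ⟨x, y⟩ (hxy : a.moment x = b.moment y)
      exact ⟨Γ.unit (a.moment x), (Γ.tgt_unit _).symm, by
        simp only [a.act_unit, Γ.inv_unit]
        rw [hxy, b.unit_act]⟩
    · rintro ⟨x, y⟩ (hxy : a.moment x = b.moment y) w - ⟨g, (hg : a.moment x = _), rfl⟩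
      refine ⟨Γ.inv g, ?_, ?_⟩
      · simp only [a.moment_act _ _ hg, Γ.tgt_inv]
      · simp only [a.act_act_inv hg]
        rw [b.inv_act_act (by rw [Γ.src_inv, ← hg, hxy])]
    · rintro ⟨x, y⟩ (hxy : a.moment x = b.moment y) v - w - ⟨g, (hg : a.moment x = _), rfl⟩
        ⟨k, (hk : a.moment (a.act x g) = _), rfl⟩
      rw [a.moment_act _ _ hg] at hk
      refine ⟨Γ.mul g k, by rw [Γ.tgt_mul _ _ hk, hg], ?_⟩
      simp only [a.act_mul _ _ _ hg hk, Γ.mul_inv_rev hk]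
      rw [b.mul_act _ _ _ (by rw [Γ.src_inv, Γ.tgt_inv, hk]) (by rw [Γ.src_inv, ← hg, hxy])]
  refine SmoothMfd.exists_isQuotientOf q hqs hqr (B.dim + (F.dim - P.dim)) ?_
  rintro ⟨x₀, y₀⟩ hxy₀
  change a.moment x₀ = b.moment y₀ at hxy₀
  obtain ⟨σ, hσ₀, hσ⟩ := ha.submersion.exists_section x₀
  obtain ⟨-, L, cF, hcF, cP, hcP, hy₀, hm, hL⟩ := hb.exists_charts y₀
  set cB := chartAt (EuclideanSpace ℝ (Fin B.dim)) (p x₀) with hcBd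
  have hx₀ : p x₀ ∈ cB.source := mem_chart_source _ _
  have hcB : cB ∈ IsManifold.maximalAtlas (𝓡 B.dim) ∞ B := IsManifold.chart_mem_maximalAtlas _
  obtain ⟨U, hU', hU, hx₀U⟩ := eventually_nhds_iff.1 (hσ.and (cB.open_source.mem_nhds hx₀))
  have hpσ : ∀ u ∈ U, p (σ u) = u := fun u hu => (hU' u hu).1.2
  have hUc : U ⊆ cB.source := fun u hu => (hU' u hu).2
  have hσs : ContMDiffOn (𝓡 B.dim) (𝓡 E.dim) ∞ σ U :=
    fun u hu => (hU' u hu).1.1.contMDiffWithinAt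
  let κ : (EuclideanSpace ℝ (Fin B.dim) × EuclideanSpace ℝ (Fin (F.dim - P.dim))) ≃L[ℝ]
      EuclideanSpace ℝ (Fin (B.dim + (F.dim - P.dim))) :=
    ContinuousLinearEquiv.ofFinrankEq (by simp)
  -- The translate of `y` by the arrow that moves `x` to the section.
  let y' : E × F → F := fun z => b.act (ha.div (σ (p z.1), z.1)) z.2
  let ψ : E × F → EuclideanSpace ℝ (Fin (B.dim + (F.dim - P.dim))) :=
    fun z => κ (cB (p z.1), (L (cF (y' z))).2)
  let s : EuclideanSpace ℝ (Fin (B.dim + (F.dim - P.dim))) → E :=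
    fun v => σ (cB.symm (κ.symm v).1)
  let l : EuclideanSpace ℝ (Fin (B.dim + (F.dim - P.dim))) → EuclideanSpace ℝ (Fin F.dim) :=
    fun v => L.symm (cP (a.moment (s v)), (κ.symm v).2)
  let φ : EuclideanSpace ℝ (Fin (B.dim + (F.dim - P.dim))) → E × F := fun v => (s v, cF.symm (l v))
  let A₁ : Set (E × F) := {z | z ∈ A ∧ p z.1 ∈ U}
  let W : Set (E × F) := {z | z ∈ A₁ ∧ y' z ∈ cF.source}
  let V₀ := (fun v => (κ.symm v).1) ⁻¹' (cB.target ∩ cB.symm ⁻¹' U)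
  let V₁ := V₀ ∩ (fun v => a.moment (s v)) ⁻¹' cP.source
  let V := V₁ ∩ l ⁻¹' cF.target
  have hdiv : ∀ z ∈ A₁, Γ.src (ha.div (σ (p z.1), z.1)) = b.moment z.2 := fun z hz => by
    rw [ha.src_div (hpσ _ hz.2)]
    exact hz.1
  have hJy' : ∀ z ∈ A₁, b.moment (y' z) = a.moment (σ (p z.1)) := fun z hz => by
    rw [b.moment_act _ _ (hdiv z hz), ha.tgt_div (hpσ _ hz.2)]
  have hy's : ContMDiffOn ((𝓡 E.dim).prod (𝓡 F.dim)) (𝓡 F.dim) ∞ y' A₁ := by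
    intro z hz
    have h1 : ContMDiffWithinAt ((𝓡 E.dim).prod (𝓡 F.dim)) (𝓡 E.dim) ∞
        (fun z : E × F => σ (p z.1)) A₁ z :=
      ContMDiffOn.comp_within (f := fun z : E × F => p z.1) hσs
        (ha.submersion.smooth.comp_within contMDiffWithinAt_fst) hz
        (eventually_mem_nhdsWithin.mono fun w hw => hw.2)
    exact b.smooth_act.comp_within (ha.smooth_div'.comp_within h1 contMDiffWithinAt_fst hz
      (eventually_mem_nhdsWithin.mono fun w hw => hpσ _ hw.2)) contMDiffWithinAt_snd hz
      (eventually_mem_nhdsWithin.mono hdiv)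
  have hinv : ∀ z ∈ A₁, ∀ w ∈ A, r z w → p w.1 = p z.1 ∧ y' w = y' z := by
    rintro ⟨x, y⟩ hz w - ⟨g, (hg : a.moment x = _), rfl⟩
    have h1 := hdiv _ hz
    have hxy : a.moment x = b.moment y := hz.1
    have hpx : p (a.act x g) = p x := ha.invariant x g hg
    refine ⟨hpx, ?_⟩
    simp only [y', hpx]
    rw [ha.div_act_right (hpσ _ hz.2) hg,
      b.mul_act _ _ _ (by rw [h1]; exact hxy.symm.trans hg)
        (by rw [b.moment_act _ _ (by rw [Γ.src_inv, ← hg, hxy]), Γ.tgt_inv])]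
    have := b.inv_act_act (x := y) (g := Γ.inv g) (by rw [Γ.src_inv, ← hg, hxy])
    rw [Γ.inv_inv] at this
    rw [this]
  have hφψ : ∀ z ∈ W, s (ψ z) = σ (p z.1) ∧ l (ψ z) = cF (y' z) := by
    intro z hz
    have h1 : s (ψ z) = σ (p z.1) := by
      simp only [s, ψ, κ.symm_apply_apply, cB.left_inv (hUc hz.1.2)]
    refine ⟨h1, ?_⟩
    simp only [l, h1]
    rw [← hJy' z hz.1, ← hL _ hz.2]
    simp only [ψ, κ.symm_apply_apply, Prod.mk.eta, L.symm_apply_apply]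
  have hφ : ∀ v ∈ V, φ v ∈ W ∧ p (s v) = cB.symm (κ.symm v).1 ∧ y' (φ v) = cF.symm (l v) := by
    intro v hv
    have hpv : p (s v) = cB.symm (κ.symm v).1 := hpσ _ hv.1.1.2
    have hY : cF.symm (l v) ∈ cF.source := cF.map_target hv.2
    have hJ : a.moment (s v) = b.moment (cF.symm (l v)) := by
      refine cP.injOn hv.1.2 (hm hY) ?_
      rw [← hL _ hY, cF.right_inv hv.2]
      simp only [l, L.apply_symm_apply]
    have hyv : y' (φ v) = cF.symm (l v) := by
      have h2 : σ (p (s v)) = s v := by rw [hpv]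
      simp only [y', φ, h2, ha.div_self, hJ, b.unit_act]
    refine ⟨⟨⟨hJ, ?_⟩, ?_⟩, hpv, hyv⟩
    · change p (s v) ∈ U
      rw [hpv]
      exact hv.1.1.2
    · rw [hyv]
      exact hY
  have hA₁W : ∃ O, IsOpen O ∧ W = A ∩ O := by
    obtain ⟨O, hO, hOW⟩ := (continuousOn_iff'.1 hy's.continuousOn) _ cF.open_source
    refine ⟨O ∩ (fun z : E × F => p z.1) ⁻¹' U,
      hO.inter (hU.preimage (ha.submersion.smooth.continuous.comp continuous_fst)), ?_⟩
    ext z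
    constructor
    · intro hz
      have : z ∈ y' ⁻¹' cF.source ∩ A₁ := ⟨hz.2, hz.1⟩
      rw [hOW] at this
      exact ⟨hz.1.1, this.1, hz.1.2⟩
    · rintro ⟨h1, h2, h3⟩
      have : z ∈ O ∩ A₁ := ⟨h2, h1, h3⟩
      rw [← hOW] at this
      exact ⟨this.2, this.1⟩
  have hψs : ContMDiffOn ((𝓡 E.dim).prod (𝓡 F.dim)) (𝓡 (B.dim + (F.dim - P.dim))) ∞ ψ W := by
    intro z hz
    have h1 : ContMDiffWithinAt ((𝓡 E.dim).prod (𝓡 F.dim)) (𝓡 B.dim) ∞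
        (fun z : E × F => cB (p z.1)) W z :=
      ContMDiffOn.comp_within (f := fun z : E × F => p z.1) (contMDiffOn_of_mem_maximalAtlas hcB)
        (ha.submersion.smooth.comp_within contMDiffWithinAt_fst) hz
        (eventually_mem_nhdsWithin.mono fun w hw => hUc hw.1.2)
    have h2 : ContMDiffWithinAt ((𝓡 E.dim).prod (𝓡 F.dim)) (𝓡 F.dim) ∞
        (fun z : E × F => cF (y' z)) W z :=
      ContMDiffOn.comp_within (contMDiffOn_of_mem_maximalAtlas hcF)
        ((hy's z hz.1).mono fun w hw => hw.1) hz (eventually_mem_nhdsWithin.mono fun w hw => hw.2)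
    have h3 : ContMDiff (𝓡 F.dim) 𝓘(ℝ, EuclideanSpace ℝ (Fin (F.dim - P.dim))) ∞
        (fun v => (L v).2) := (contDiff_snd.comp L.contDiff).contMDiff
    have h4 := (κ.contDiff (n := ∞)).contMDiff.contMDiffAt.comp_contMDiffWithinAt z
      (h1.prodMk_space (h3.contMDiffAt.comp_contMDiffWithinAt z h2))
    exact h4
  have hV₀ : IsOpen V₀ := (cB.isOpen_inter_preimage_symm hU).preimage
    (continuous_fst.comp κ.symm.continuous)
  have hss : ContMDiffOn (𝓡 (B.dim + (F.dim - P.dim))) (𝓡 E.dim) ∞ s V₀ := by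
    intro v hv
    have h1 : ContMDiff (𝓡 (B.dim + (F.dim - P.dim))) (𝓡 B.dim) ∞ (fun v => (κ.symm v).1) :=
      (contDiff_fst.comp κ.symm.contDiff).contMDiff
    exact ContMDiffOn.comp_within hσs (ContMDiffOn.comp_within
      (contMDiffOn_symm_of_mem_maximalAtlas hcB) h1.contMDiffAt.contMDiffWithinAt hv
      (eventually_mem_nhdsWithin.mono fun w hw => hw.1)) hv
      (eventually_mem_nhdsWithin.mono fun w hw => hw.2)
  have hJs : ContMDiffOn (𝓡 (B.dim + (F.dim - P.dim))) (𝓡 P.dim) ∞ (fun v => a.moment (s v)) V₀ :=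
    fun v hv => a.smooth_moment.comp_within (hss v hv)
  have hV₁ : IsOpen V₁ := hJs.continuousOn.isOpen_inter_preimage hV₀ cP.open_source
  have hls : ContMDiffOn (𝓡 (B.dim + (F.dim - P.dim))) (𝓡 F.dim) ∞ l V₁ := by
    intro v hv
    have h1 : ContMDiffWithinAt (𝓡 (B.dim + (F.dim - P.dim))) (𝓡 P.dim) ∞
        (fun v => cP (a.moment (s v))) V₁ v :=
      ContMDiffOn.comp_within (contMDiffOn_of_mem_maximalAtlas hcP)
        ((hJs v hv.1).mono fun w hw => hw.1) hv (eventually_mem_nhdsWithin.mono fun w hw => hw.2)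
    have h2 : ContMDiff (𝓡 (B.dim + (F.dim - P.dim)))
        𝓘(ℝ, EuclideanSpace ℝ (Fin (F.dim - P.dim))) ∞ (fun v => (κ.symm v).2) :=
      (contDiff_snd.comp κ.symm.contDiff).contMDiff
    exact (L.symm.contDiff (n := ∞)).contMDiff.contMDiffAt.comp_contMDiffWithinAt v
      (h1.prodMk_space h2.contMDiffAt.contMDiffWithinAt)
  have hV : IsOpen V := hls.continuousOn.isOpen_inter_preimage hV₁ cF.open_target
  have hφs : ContMDiffOn (𝓡 (B.dim + (F.dim - P.dim))) ((𝓡 E.dim).prod (𝓡 F.dim)) ∞ φ V :=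
    fun v hv => ((hss v hv.1.1).mono fun w hw => hw.1.1).prodMk
      (ContMDiffOn.comp_within (contMDiffOn_symm_of_mem_maximalAtlas hcF)
        ((hls v hv.1).mono fun w hw => hw.1) hv (eventually_mem_nhdsWithin.mono fun w hw => hw.2))
  have hy'₀ : y' (x₀, y₀) = y₀ := by
    simp only [y', hσ₀, ha.div_self, hxy₀, b.unit_act]
  have hzW : (x₀, y₀) ∈ W := ⟨⟨hxy₀, hx₀U⟩, by rw [hy'₀]; exact hy₀⟩
  refine ⟨W, V, ψ, φ, ⟨fun z hz => hz.1.1, hA₁W, hV, ?_, ?_, hψs, hφs, ?_, fun v hv => (hφ v hv).1,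
    ?_, ?_⟩, hzW, ?_⟩
  · intro z hz w hw hzw
    obtain ⟨h1, h2⟩ := hinv w hw.1 z hz ((hqr _ hw.1.1 _ hz).1 hzw.symm)
    exact ⟨⟨hz, h1 ▸ hw.1.2⟩, h2 ▸ hw.2⟩
  · intro z hz w hw hzw
    obtain ⟨h1, h2⟩ := hinv w hw.1 z hz.1.1 ((hqr _ hw.1.1 _ hz.1.1).1 hzw.symm)
    simp only [ψ, h1, h2]
  · intro z hz
    obtain ⟨h1, h2⟩ := hφψ z hz
    have h3 : (κ.symm (ψ z)).1 = cB (p z.1) := by simp only [ψ, κ.symm_apply_apply]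
    refine ⟨⟨⟨?_, ?_⟩, ?_⟩, ?_⟩
    · change (κ.symm (ψ z)).1 ∈ cB.target
      rw [h3]
      exact cB.map_source (hUc hz.1.2)
    · change cB.symm (κ.symm (ψ z)).1 ∈ U
      rw [h3, cB.left_inv (hUc hz.1.2)]
      exact hz.1.2
    · rw [mem_preimage, h1, ← hJy' z hz.1]
      exact hm hz.2
    · rw [mem_preimage, h2]
      exact cF.map_source hz.2
  · intro v hv
    obtain ⟨-, h2, h3⟩ := hφ v hv
    have h4 : ψ (φ v) = κ (cB (p (s v)), (L (cF (y' (φ v)))).2) := rfl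
    rw [h4, h2, h3, cB.right_inv hv.1.1.1, cF.right_inv hv.2]
    simp only [l, L.apply_symm_apply, Prod.mk.eta, κ.apply_symm_apply]
  · intro z hz
    obtain ⟨h1, h2⟩ := hφψ z hz
    have h3 : φ (ψ z) = (σ (p z.1), y' z) := by
      simp only [φ, h1, h2, cF.left_inv hz.2]
    rw [h3]
    refine (hqr _ (hJy' z hz.1).symm _ hz.1.1).2 ⟨ha.div (σ (p z.1), z.1), ?_, ?_⟩
    · exact (ha.tgt_div (hpσ _ hz.1.2)).symm
    · simp only [ha.act_div (hpσ _ hz.1.2), y']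
      rw [b.inv_act_act (hdiv z hz.1)]
  · obtain ⟨h1, h2⟩ := hφψ _ hzW
    simp only [φ, h1, h2, hσ₀, hy'₀, cF.left_inv hy₀]

/-! ### Existence, uniqueness and associativity of tensor products -/

namespace Bibundle

variable {P₁ P₂ P₃ P₄ : SmoothMfd.{u}} {Γ₁ : LieGroupoid P₁} {Γ₂ : LieGroupoid P₂}
  {Γ₃ : LieGroupoid P₃} {Γ₄ : LieGroupoid P₄}
  {S : Bibundle Γ₁ Γ₂} {S' : Bibundle Γ₂ Γ₃} {T : Bibundle Γ₁ Γ₃}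

/-- The right action on a tensor product of right principal bibundles is principal. -/
theorem IsTensorProduct.right_isPrincipal (hS : S.right.IsPrincipal S.left.moment)
    (hS' : S'.right.IsPrincipal S'.left.moment) (h : S.IsTensorProduct S' T) :
    T.right.IsPrincipal T.left.moment := by
  obtain ⟨q, h, hq⟩ := h.exists_balanced
  set A : Set (S.space × S'.space) := {z | S.right.moment z.1 = S'.left.moment z.2} with hA
  have hfree : ∀ t g, T.right.moment t = Γ₃.tgt g → T.right.act t g = t →
      g = Γ₃.unit (T.right.moment t) := by
    intro t g hg hgt
    obtain ⟨⟨x, y⟩, (hxy : S.right.moment x = S'.left.moment y), rfl⟩ := hq.surj t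
    rw [h.right_moment x y hxy] at hg ⊢
    rw [h.right_act x y g hxy hg] at hgt
    obtain ⟨k, hk, hkk⟩ := (hq.eq_iff _ hxy _
      (show (x, S'.right.act y g) ∈ A from hxy.trans (S'.left_moment_right _ _ hg).symm)).1 hgt.symm
    obtain ⟨hx, hy⟩ := Prod.mk.inj hkk
    have hku := hS.free x k hk hx.symm
    have hky : S'.left.act (Γ₂.inv k) y = y := by
      rw [hku, Γ₂.inv_unit, hxy, S'.left.unit_act]
    exact hS'.free y g hg (hy.trans hky)
  -- The division map of `T` in terms of representatives.
  let D : S.space × S'.space → S.space × S'.space → Γ₃.Arr := fun z w =>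
    hS'.div (z.2, S'.left.act (hS.div (z.1, w.1)) w.2)
  have hD1 : ∀ z ∈ A, ∀ w ∈ A, S.left.moment z.1 = S.left.moment w.1 →
      Γ₂.src (hS.div (z.1, w.1)) = S'.left.moment w.2 := fun z hz w hw e => by
    rw [hS.src_div e]; exact hw
  have hD2 : ∀ z ∈ A, ∀ w ∈ A, S.left.moment z.1 = S.left.moment w.1 →
      S'.left.moment z.2 = S'.left.moment (S'.left.act (hS.div (z.1, w.1)) w.2) :=
    fun z hz w hw e => by
      rw [S'.left.moment_act _ _ (hD1 z hz w hw e), hS.tgt_div e]; exact Eq.symm hz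
  have hD : ∀ z ∈ A, ∀ w ∈ A, S.left.moment z.1 = S.left.moment w.1 →
      T.right.moment (q z) = Γ₃.tgt (D z w) ∧ T.right.act (q z) (D z w) = q w := by
    rintro ⟨x, y⟩ hxy ⟨x', y'⟩ hxy' e
    have h1 := hD1 _ hxy _ hxy' e
    have h2 := hD2 _ hxy _ hxy' e
    have h3 : S'.right.moment y = Γ₃.tgt (D (x, y) (x', y')) := (hS'.tgt_div h2).symm
    refine ⟨by rw [h.right_moment _ _ hxy, h3], ?_⟩
    rw [h.right_act _ _ _ hxy h3]
    have h4 : S'.right.act y (D (x, y) (x', y')) = S'.left.act (hS.div (x, x')) y' :=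
      hS'.act_div h2
    rw [h4, ← h.balanced _ _ _ (hS.tgt_div e).symm h1, hS.act_div e]
  have hmom : ∀ z ∈ A, T.left.moment (q z) = S.left.moment z.1 := fun z hz =>
    h.left_moment z.1 z.2 hz
  choose s hsA hsq using hq.surj
  refine ⟨surjSubmersion_of_section T.left.smooth_moment ?_ ?_, fun t g hg =>
    T.left_moment_right t g hg, hfree, ?_, ?_⟩
  · intro u
    obtain ⟨x, hx⟩ := hS.submersion.1 u
    obtain ⟨y, hy⟩ := hS'.submersion.1 (S.right.moment x)
    exact ⟨q (x, y), (h.left_moment x y hy.symm).trans hx⟩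
  · intro t
    obtain ⟨⟨x₀, y₀⟩, (hxy : S.right.moment x₀ = S'.left.moment y₀), rfl⟩ := hq.surj t
    obtain ⟨σ, hσ₀, hσ⟩ := hS.submersion.exists_section x₀
    obtain ⟨τ, hτ₀, hτ⟩ := hS'.submersion.exists_section y₀
    rw [h.left_moment x₀ y₀ hxy]
    set u₀ := S.left.moment x₀
    let k : P₁ → S'.space := fun u => τ (S.right.moment (σ u))
    have hev2 : ∀ᶠ u in 𝓝 u₀, ContMDiffAt (𝓡 P₁.dim) (𝓡 S'.space.dim) ∞ k u ∧
        S'.left.moment (k u) = S.right.moment (σ u) := by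
      have hc : ContinuousAt (fun u => S.right.moment (σ u)) u₀ :=
        S.right.smooth_moment.continuous.continuousAt.comp hσ.self_of_nhds.1.continuousAt
      have := hc.eventually (by simp only [hσ₀, hxy]; exact hτ)
      filter_upwards [this, hσ] with u hu hu1
      exact ⟨hu.1.comp u ((S.right.smooth_moment (σ u)).comp u hu1.1), hu.2⟩
    obtain ⟨U, hU, hUo, hu₀⟩ := eventually_nhds_iff.1 (hσ.and hev2)
    refine ⟨fun u => q (σ u, k u), by simp only [k, hσ₀, hxy, hτ₀], ?_⟩
    filter_upwards [hUo.mem_nhds hu₀] with u hu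
    refine ⟨?_, ?_⟩
    · exact (h.smooth.comp_within (hU u hu).1.1.contMDiffWithinAt
        (hU u hu).2.1.contMDiffWithinAt hu (eventually_mem_nhdsWithin.mono fun v hv =>
          (hU v hv).2.2.symm)).contMDiffAt (hUo.mem_nhds hu)
    · rw [h.left_moment _ _ (hU u hu).2.2.symm, (hU u hu).1.2]
  · intro t t' e
    rw [← hsq t, ← hsq t', hmom _ (hsA _), hmom _ (hsA _)] at e
    have := hD _ (hsA t) _ (hsA t') e
    rw [hsq, hsq] at this
    exact ⟨_, this⟩
  · have hDs : ∀ t t', T.left.moment t = T.left.moment t' →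
        S.left.moment (s t).1 = S.left.moment (s t').1 := fun t t' e => by
      rw [← hmom _ (hsA _), ← hmom _ (hsA _), hsq, hsq, e]
    refine ⟨fun z => D (s z.1) (s z.2), ?_, fun t t' e => ?_⟩
    · rintro ⟨t₀, t₀'⟩ ht₀
      obtain ⟨σ, hσ₀, hσ⟩ := hq.exists_section' (hsA t₀)
      obtain ⟨τ, hτ₀, hτ⟩ := hq.exists_section' (hsA t₀')
      rw [hsq] at hσ₀ hσ hτ₀ hτ
      set Z : Set (T.space × T.space) := {z | T.left.moment z.1 = T.left.moment z.2}
      have hev : ∀ᶠ w in 𝓝[Z] (t₀, t₀'), (σ w.1 ∈ A ∧ q (σ w.1) = w.1) ∧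
          (τ w.2 ∈ A ∧ q (τ w.2) = w.2) ∧
          S.left.moment (σ w.1).1 = S.left.moment (τ w.2).1 := by
        have h1 := (continuous_fst.continuousWithinAt (s := Z) (x := (t₀, t₀'))).eventually
          (hσ.mono fun z hz => hz.2 : ∀ᶠ z in 𝓝 t₀, σ z ∈ A ∧ q (σ z) = z)
        have h2 := (continuous_snd.continuousWithinAt (s := Z) (x := (t₀, t₀'))).eventually
          (hτ.mono fun z hz => hz.2 : ∀ᶠ z in 𝓝 t₀', τ z ∈ A ∧ q (τ z) = z)
        filter_upwards [h1, h2, self_mem_nhdsWithin] with w hw1 hw2 hw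
        refine ⟨hw1, hw2, ?_⟩
        rw [← hmom _ hw1.1, ← hmom _ hw2.1, hw1.2, hw2.2]
        exact hw
      have hσs : ContMDiffWithinAt ((𝓡 T.space.dim).prod (𝓡 T.space.dim))
          ((𝓡 S.space.dim).prod (𝓡 S'.space.dim)) ∞ (fun w : T.space × T.space => σ w.1) Z
          (t₀, t₀') := hσ.self_of_nhds.1.comp_contMDiffWithinAt (t₀, t₀') contMDiffWithinAt_fst
      have hτs : ContMDiffWithinAt ((𝓡 T.space.dim).prod (𝓡 T.space.dim))
          ((𝓡 S.space.dim).prod (𝓡 S'.space.dim)) ∞ (fun w : T.space × T.space => τ w.2) Z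
          (t₀, t₀') := hτ.self_of_nhds.1.comp_contMDiffWithinAt (t₀, t₀') contMDiffWithinAt_snd
      have k1 := hS.smooth_div'.comp_within hσs.fst hτs.fst ht₀ (hev.mono fun w hw => hw.2.2)
      have k2 := S'.left.smooth_act.comp_within k1 hτs.snd ht₀
        (hev.mono fun w hw => hD1 _ hw.1.1 _ hw.2.1.1 hw.2.2)
      have k3 := hS'.smooth_div'.comp_within hσs.snd k2 ht₀
        (hev.mono fun w hw => hD2 _ hw.1.1 _ hw.2.1.1 hw.2.2)
      have heq : ∀ᶠ w in 𝓝[Z] (t₀, t₀'), D (s w.1) (s w.2) = D (σ w.1) (τ w.2) := by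
        filter_upwards [hev, self_mem_nhdsWithin] with w hw hwZ
        have e1 := hD _ (hsA w.1) _ (hsA w.2) (hDs _ _ hwZ)
        have e2 := hD _ hw.1.1 _ hw.2.1.1 hw.2.2
        rw [hsq, hsq] at e1
        rw [hw.1.2, hw.2.1.2] at e2
        exact T.right.cancel_of_free hfree e1.1 e2.1 (e1.2.trans e2.2.symm)
      exact k3.congr_of_eventuallyEq heq (heq.self_of_nhdsWithin ht₀)
    · have := hD _ (hsA t) _ (hsA t') (hDs t t' e)
      rwa [hsq, hsq] at this

/-- The tensor product of the opposite bibundles is the opposite of the tensor product. This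
transfers statements on right actions to left actions. -/
theorem IsTensorProduct.op (h : S.IsTensorProduct S' T) : S'.op.IsTensorProduct S.op T.op := by
  obtain ⟨q, h, hq⟩ := h.exists_balanced
  refine ⟨fun z => q (z.2, z.1), ⟨?_, ?_, ?_, ?_⟩, fun y x e => ⟨?_, ?_, fun g hg => ?_,
    fun g hg => ?_⟩⟩
  · intro z hz
    exact h.smooth.comp_within contMDiffWithinAt_snd contMDiffWithinAt_fst hz
      (eventually_mem_nhdsWithin.mono fun w hw => Eq.symm hw)
  · intro t
    obtain ⟨⟨x, y⟩, hxy, rfl⟩ := hq.surj t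
    exact ⟨(y, x), Eq.symm hxy, rfl⟩
  · rintro ⟨y, x⟩ hxy ⟨y', x'⟩ hxy'
    refine (hq.eq_iff (x, y) (Eq.symm hxy) (x', y') (Eq.symm hxy')).trans ?_
    change S'.left.moment y = S.right.moment x at hxy
    constructor
    · rintro ⟨g, hg, e⟩
      obtain ⟨rfl, rfl⟩ := Prod.mk.inj e
      exact ⟨g, hxy.trans hg, Prod.ext rfl (congrArg (S.right.act x) (Γ₂.inv_inv g).symm)⟩
    · rintro ⟨g, hg, e⟩
      obtain ⟨rfl, rfl⟩ := Prod.mk.inj e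
      exact ⟨g, hxy.symm.trans hg, Prod.ext (congrArg (S.right.act x) (Γ₂.inv_inv g)) rfl⟩
  · rintro ⟨y, x⟩ hxy
    obtain ⟨σ, U, hU, hσ, hσa, hσU⟩ := hq.exists_section (x, y) (Eq.symm hxy)
    exact ⟨fun t => ((σ t).2, (σ t).1), U, hU, fun t ht => ((hσ t ht).snd).prodMk (hσ t ht).fst,
      by simp [hσa], fun t ht => ⟨Eq.symm (hσU t ht).1, (hσU t ht).2⟩⟩
  · exact h.right_moment x y (Eq.symm e)
  · exact h.left_moment x y (Eq.symm e)
  · exact h.right_act x y _ (Eq.symm e) (by rw [Γ₃.tgt_inv, hg])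
  · exact h.left_act x y _ (Eq.symm e) (by rw [Γ₁.src_inv, ← hg])

theorem IsTensorProduct.isBiprincipal (hS : S.IsBiprincipal) (hS' : S'.IsBiprincipal)
    (h : S.IsTensorProduct S' T) : T.IsBiprincipal := by
  refine ⟨?_, h.right_isPrincipal hS.2 hS'.2⟩
  have h1 : T.left.op.op.IsPrincipal T.right.moment :=
    (h.op.right_isPrincipal hS'.1.op hS.1.op).op
  rwa [T.left.op_op] at h1

/-- The tensor product of biprincipal bibundles exists. -/
theorem exists_isTensorProduct (hS : S.IsBiprincipal) (hS' : S'.IsBiprincipal) :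
    ∃ T : Bibundle Γ₁ Γ₃, S.IsTensorProduct S' T := by
  obtain ⟨Q, q, hq⟩ := hS.2.exists_isQuotientOf S'.left hS'.2.submersion
  obtain ⟨l, hlm, hla⟩ := hq.exists_rightAction (Γ := Γ₁) (μ := fun z => S.left.moment z.1)
    (α := fun z g => (S.left.act (Γ₁.inv g) z.1, z.2))
    (fun z hz => S.left.smooth_moment.comp_within contMDiffWithinAt_fst)
    (by
      rintro ⟨x, y⟩ - _ - ⟨g, hg, rfl⟩
      exact (S.left_moment_right _ _ hg).symm)
    (fun z hz => (S.left.smooth_act.comp_within (f := fun w : (S.space × S'.space) × Γ₁.Arr => Γ₁.inv w.2)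
      (g := fun w : (S.space × S'.space) × Γ₁.Arr => w.1.1)
      (Smooth.comp_within Γ₁.smooth_inv contMDiffWithinAt_snd)
      (contMDiffWithinAt_fst.comp z contMDiffWithinAt_fst (mapsTo_univ _ _)) hz
      (eventually_mem_nhdsWithin.mono fun w hw => by
        change Γ₁.src (Γ₁.inv w.2) = _; rw [Γ₁.src_inv]; exact hw.2.symm)).prodMk
      (contMDiffWithinAt_snd.comp z contMDiffWithinAt_fst (mapsTo_univ _ _)))
    (by
      rintro ⟨x, y⟩ (hxy : S.right.moment x = S'.left.moment y) g (hg : S.left.moment x = _)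
      exact (S.right_moment_left _ _ (by rw [Γ₁.src_inv, hg])).trans hxy)
    (by
      rintro ⟨x, y⟩ (hxy : S.right.moment x = S'.left.moment y) _ - g
        (hg : S.left.moment x = _) ⟨k, (hk : S.right.moment x = _), rfl⟩
      have hg' : Γ₁.src (Γ₁.inv g) = S.left.moment x := by rw [Γ₁.src_inv, hg]
      exact ⟨k, (S.right_moment_left _ _ hg').trans hk,
        Prod.ext (S.comm _ _ _ hg' hk).symm rfl⟩)
    (by
      rintro ⟨x, y⟩ - g (hg : S.left.moment x = _)
      exact (S.left.moment_act _ _ (by rw [Γ₁.src_inv, hg])).trans (Γ₁.tgt_inv g))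
    (fun z _ => Prod.ext (S.left.op.act_unit z.1) rfl)
    (fun z _ g k hg hk => Prod.ext (S.left.op.act_mul z.1 g k hg hk) rfl)
  obtain ⟨r, hrm, hra⟩ := hq.exists_rightAction (Γ := Γ₃) (μ := fun z => S'.right.moment z.2)
    (α := fun z g => (z.1, S'.right.act z.2 g))
    (fun z hz => S'.right.smooth_moment.comp_within contMDiffWithinAt_snd)
    (by
      rintro ⟨x, y⟩ (hxy : S.right.moment x = S'.left.moment y) _ -
        ⟨g, (hg : S.right.moment x = _), rfl⟩
      exact (S'.right_moment_left _ _ (by rw [Γ₂.src_inv, ← hg, hxy])).symm)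
    (fun z hz => (contMDiffWithinAt_fst.comp z contMDiffWithinAt_fst (mapsTo_univ _ _)).prodMk
      (S'.right.smooth_act.comp_within
      (f := fun w : (S.space × S'.space) × Γ₃.Arr => w.1.2) (g := Prod.snd)
      (contMDiffWithinAt_snd.comp z contMDiffWithinAt_fst (mapsTo_univ _ _))
      contMDiffWithinAt_snd hz (eventually_mem_nhdsWithin.mono fun w hw => hw.2)))
    (by
      rintro ⟨x, y⟩ (hxy : S.right.moment x = S'.left.moment y) g (hg : S'.right.moment y = _)
      exact hxy.trans (S'.left_moment_right _ _ hg).symm)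
    (by
      rintro ⟨x, y⟩ (hxy : S.right.moment x = S'.left.moment y) _ - g
        (hg : S'.right.moment y = _) ⟨k, (hk : S.right.moment x = _), rfl⟩
      exact ⟨k, hk, Prod.ext rfl (S'.comm _ _ _ (by rw [Γ₂.src_inv, ← hk, hxy]) hg)⟩)
    (by
      rintro ⟨x, y⟩ - g (hg : S'.right.moment y = _)
      exact S'.right.moment_act _ _ hg)
    (fun z _ => Prod.ext rfl (S'.right.act_unit z.2))
    (fun z _ g k hg hk => Prod.ext rfl (S'.right.act_mul z.2 g k hg hk))
  have hlact : ∀ x y, S.right.moment x = S'.left.moment y → ∀ g, Γ₁.src g = S.left.moment x →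
      l.op.act g (q (x, y)) = q (S.left.act g x, y) := by
    intro x y hxy g hg
    have := hla (x, y) hxy (Γ₁.inv g) (by rw [Γ₁.tgt_inv, hg])
    simp only [Γ₁.inv_inv] at this
    exact this
  refine ⟨{ space := Q, left := l.op, right := r, right_moment_left := ?_,
            left_moment_right := ?_, comm := ?_ }, q, hq, fun x y e =>
      ⟨hlm (x, y) e, hrm (x, y) e, hlact x y e, fun g hg => hra (x, y) e g hg⟩⟩
  · intro g z hg
    obtain ⟨⟨x, y⟩, (hxy : S.right.moment x = S'.left.moment y), rfl⟩ := hq.surj z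
    have hg' : Γ₁.src g = S.left.moment x := hg.trans (hlm (x, y) hxy)
    rw [hlact x y hxy g hg', hrm (x, y) hxy,
      hrm (S.left.act g x, y) ((S.right_moment_left _ _ hg').trans hxy)]
  · intro z g hg
    obtain ⟨⟨x, y⟩, (hxy : S.right.moment x = S'.left.moment y), rfl⟩ := hq.surj z
    have hg' : S'.right.moment y = Γ₃.tgt g := (hrm (x, y) hxy).symm.trans hg
    rw [hra (x, y) hxy g hg']
    exact (hlm _ (hxy.trans (S'.left_moment_right _ _ hg').symm)).trans (hlm (x, y) hxy).symm
  · intro g z k hg hk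
    obtain ⟨⟨x, y⟩, (hxy : S.right.moment x = S'.left.moment y), rfl⟩ := hq.surj z
    have hg' : Γ₁.src g = S.left.moment x := hg.trans (hlm (x, y) hxy)
    have hk' : S'.right.moment y = Γ₃.tgt k := (hrm (x, y) hxy).symm.trans hk
    rw [hlact x y hxy g hg', hra (x, y) hxy k hk',
      hra (S.left.act g x, y) ((S.right_moment_left _ _ hg').trans hxy) k hk',
      hlact x (S'.right.act y k) (hxy.trans (S'.left_moment_right _ _ hk').symm) g hg']

/-- The tensor product is unique up to isomorphism. -/
theorem IsTensorProduct.isomorphic {T' : Bibundle Γ₁ Γ₃} (h : S.IsTensorProduct S' T)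
    (h' : S.IsTensorProduct S' T') : T.Isomorphic T' := by
  obtain ⟨q, h, hq⟩ := h.exists_balanced
  obtain ⟨q', h', hq'⟩ := h'.exists_balanced
  obtain ⟨f, hf, hfq⟩ := hq.exists_lift h'.smooth fun a ha b hb e => (hq'.eq_iff a ha b hb).2 e
  obtain ⟨k, hk, hkq⟩ := hq'.exists_lift h.smooth fun a ha b hb e => (hq.eq_iff a ha b hb).2 e
  have hkf : ∀ t, k (f t) = t := fun t => by
    obtain ⟨a, ha, rfl⟩ := hq.surj t
    rw [hfq a ha, hkq a ha]
  have hfk : ∀ t, f (k t) = t := fun t => by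
    obtain ⟨a, ha, rfl⟩ := hq'.surj t
    rw [hkq a ha, hfq a ha]
  refine ⟨⟨⟨f, k, hkf, hfk⟩, hf, hk⟩, ?_, ?_, ?_, ?_⟩
  · intro t
    obtain ⟨⟨x, y⟩, e, rfl⟩ := hq.surj t
    exact (congrArg T'.left.moment (hfq _ e)).trans
      ((h'.left_moment x y e).trans (h.left_moment x y e).symm)
  · intro t
    obtain ⟨⟨x, y⟩, e, rfl⟩ := hq.surj t
    exact (congrArg T'.right.moment (hfq _ e)).trans
      ((h'.right_moment x y e).trans (h.right_moment x y e).symm)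
  · intro g t hg
    obtain ⟨⟨x, y⟩, e, rfl⟩ := hq.surj t
    rw [h.left_moment x y e] at hg
    change f _ = T'.left.act g (f _)
    rw [h.left_act x y g e hg, hfq _ e, h'.left_act x y g e hg]
    exact hfq _ ((S.right_moment_left _ _ hg).trans e)
  · intro t g hg
    obtain ⟨⟨x, y⟩, e, rfl⟩ := hq.surj t
    rw [h.right_moment x y e] at hg
    change f _ = T'.right.act (f _) g
    rw [h.right_act x y g e hg, hfq _ e, h'.right_act x y g e hg]
    exact hfq _ (Eq.trans e (S'.left_moment_right _ _ hg).symm)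

/-- Balanced maps can be composed with isomorphisms. -/
theorem IsBalanced.exists_congr {S₁ : Bibundle Γ₁ Γ₂} {S₁' : Bibundle Γ₂ Γ₃}
    {T₁ : Bibundle Γ₁ Γ₃} {q : S.space × S'.space → T.space} (h : IsBalanced S S' T q)
    (hS : S₁.Isomorphic S) (hS' : S₁'.Isomorphic S') (hT : T.Isomorphic T₁) :
    ∃ q₁, IsBalanced S₁ S₁' T₁ q₁ := by
  obtain ⟨f, f1, f2, f3, f4⟩ := hS
  obtain ⟨k, k1, k2, k3, k4⟩ := hS'
  obtain ⟨e, e1, e2, e3, e4⟩ := hT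
  have hm : ∀ x y, S₁.right.moment x = S₁'.left.moment y →
      S.right.moment (f x) = S'.left.moment (k y) := fun x y hxy => by rw [f2, k1, hxy]
  refine ⟨fun z => e (q (f z.1, k z.2)), ⟨fun z hz => ?_, fun x y hxy => ?_, fun x y hxy => ?_,
    fun x y g hxy hg => ?_, fun x y g hxy hg => ?_, fun x y g hg hy => ?_⟩⟩
  · exact Smooth.comp_within (F := e) e.contMDiff_toFun (h.smooth.comp_within
      (Smooth.comp_within (F := f) f.contMDiff_toFun contMDiffWithinAt_fst)
      (Smooth.comp_within (F := k) k.contMDiff_toFun contMDiffWithinAt_snd) hz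
      (eventually_mem_nhdsWithin.mono fun w hw => hm _ _ hw))
  · rw [e1, h.left_moment _ _ (hm x y hxy), f1]
  · rw [e2, h.right_moment _ _ (hm x y hxy), k2]
  · have hg' : Γ₁.src g = S.left.moment (f x) := by rw [f1, hg]
    rw [← e3 _ _ (by rw [h.left_moment _ _ (hm x y hxy), hg']), h.left_act _ _ _ (hm x y hxy) hg',
      f3 _ _ hg]
  · have hg' : S'.right.moment (k y) = Γ₃.tgt g := by rw [k2, hg]
    rw [← e4 _ _ (by rw [h.right_moment _ _ (hm x y hxy), hg']),
      h.right_act _ _ _ (hm x y hxy) hg', k4 _ _ hg]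
  · rw [f4 _ _ hg, k3 _ _ hy, h.balanced _ _ _ (by rw [f2, hg]) (by rw [k1, hy])]

theorem IsTensorProduct.congr {S₁ : Bibundle Γ₁ Γ₂} {S₁' : Bibundle Γ₂ Γ₃}
    {T₁ : Bibundle Γ₁ Γ₃} (h : S.IsTensorProduct S' T) (hS : S₁.Isomorphic S)
    (hS' : S₁'.Isomorphic S') (hT : T.Isomorphic T₁) (pS : S₁.IsBiprincipal)
    (pS' : S₁'.IsBiprincipal) (pT : T₁.IsBiprincipal) : S₁.IsTensorProduct S₁' T₁ := by
  obtain ⟨q, h, -⟩ := h.exists_balanced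
  obtain ⟨q₁, h₁⟩ := h.exists_congr hS hS' hT
  exact h₁.isTensorProduct pS.2 pS'.2 pT.2

theorem unit_isTensorProduct (hS : S.IsBiprincipal) : Γ₁.unitBibundle.IsTensorProduct S S := by
  refine IsBalanced.isTensorProduct (q := fun z : Γ₁.Arr × S.space => S.left.act z.1 z.2)
    Γ₁.unitBibundle_isBiprincipal.2 hS.2 hS.2
    ⟨S.left.smooth_act, S.left.moment_act, S.right_moment_left, ?_, fun g x k hg hk =>
      S.comm g x k hg hk, ?_⟩
  · intro x y g hxy hg
    exact (S.left.mul_act g x y hg hxy).symm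
  · intro x y g hg hy
    exact S.left.mul_act x g y hg hy

theorem isTensorProduct_unit (hS : S.IsBiprincipal) : S.IsTensorProduct Γ₂.unitBibundle S := by
  refine IsBalanced.isTensorProduct (q := fun z : S.space × Γ₂.Arr => S.right.act z.1 z.2)
    hS.2 Γ₂.unitBibundle_isBiprincipal.2 hS.2
    ⟨S.right.smooth_act, S.left_moment_right, S.right.moment_act, ?_, ?_, ?_⟩
  · intro x k g hxk hg
    exact (S.comm g x k hg hxk).symm
  · intro x k g hxk hg
    exact (S.right.act_mul x k g hxk hg).symm
  · intro x y g hg hy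
    exact (S.right.act_mul x g y hg hy).symm

/-- The opposite bibundle is an inverse: the division map `S ×_{P₂} S → Γ₁` is balanced. -/
theorem isTensorProduct_op (hS : S.IsBiprincipal) : S.IsTensorProduct S.op Γ₁.unitBibundle := by
  have hd := hS.1
  refine IsBalanced.isTensorProduct (q := hd.div) hS.2 hS.op.2
    Γ₁.unitBibundle_isBiprincipal.2
    ⟨hd.smooth_div', fun x y e => hd.tgt_div e, fun x y e => hd.src_div e, ?_, ?_, ?_⟩
  · intro x y g (e : S.right.moment x = S.right.moment y) hg
    have e1 : Γ₁.src g = Γ₁.tgt (hd.div (x, y)) := by rw [hd.tgt_div e, hg]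
    have e2 : S.right.moment (S.left.act g x) = S.right.moment y := by
      rw [S.right_moment_left _ _ hg, e]
    refine hd.cancel (x := y) ?_ (hd.src_div e2) ?_
    · exact (Γ₁.src_mul _ _ e1).trans (hd.src_div e)
    · refine Eq.trans ?_ (hd.div_act e2).symm
      exact (S.left.mul_act _ _ _ e1 (hd.src_div e)).trans
        (congrArg (S.left.act g) (hd.div_act e))
  · intro x y g (e : S.right.moment x = S.right.moment y) (hg : S.left.moment y = Γ₁.tgt g)
    have hg' : Γ₁.src (Γ₁.inv g) = S.left.moment y := by rw [Γ₁.src_inv, hg]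
    have e1 : Γ₁.src (hd.div (x, y)) = Γ₁.tgt g := by rw [hd.src_div e, hg]
    have e2 : S.right.moment x = S.right.moment (S.left.act (Γ₁.inv g) y) := by
      rw [S.right_moment_left _ _ hg', e]
    have e3 : Γ₁.src g = S.left.moment (S.left.act (Γ₁.inv g) y) := by
      rw [S.left.moment_act _ _ hg', Γ₁.tgt_inv]
    refine hd.cancel (x := S.left.act (Γ₁.inv g) y) ?_ (hd.src_div e2) ?_
    · exact (Γ₁.src_mul _ _ e1).trans e3
    · refine ((S.left.mul_act _ _ _ e1 e3).trans ?_).trans (hd.div_act e2).symm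
      have := S.left.inv_act_act hg'
      rw [Γ₁.inv_inv] at this
      rw [this, hd.div_act e]
  · intro x y g hg (hy : Γ₂.src g = S.right.moment y)
    have hy' : S.right.moment y = Γ₂.tgt (Γ₂.inv g) := by rw [Γ₂.tgt_inv, hy]
    have e1 : S.right.moment (S.right.act x g) = S.right.moment y := by
      rw [S.right.moment_act _ _ hg, hy]
    have e2 : S.right.moment x = S.right.moment (S.right.act y (Γ₂.inv g)) := by
      rw [S.right.moment_act _ _ hy', Γ₂.src_inv, hg]
    have e3 := hd.src_div e2
    rw [S.left_moment_right _ _ hy'] at e3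
    refine hd.cancel (x := y) (hd.src_div e1) e3 ?_
    refine (hd.div_act e1).trans ?_
    have e4 := S.comm (hd.div (x, S.right.act y (Γ₂.inv g))) (S.right.act y (Γ₂.inv g)) g
      (hd.src_div e2) (by rw [← e2, hg])
    rw [hd.div_act e2] at e4
    rw [e4]
    have e5 := S.right.act_act_inv hy'
    rw [Γ₂.inv_inv] at e5
    rw [e5]

/-- Associativity of the tensor product. -/
theorem IsTensorProduct.assoc {S'' : Bibundle Γ₃ Γ₄} {T₂ : Bibundle Γ₂ Γ₄} {U : Bibundle Γ₁ Γ₄}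
    (hS : S.IsBiprincipal) (hT₂ : T₂.IsBiprincipal) (hU : U.IsBiprincipal)
    (h₁ : S.IsTensorProduct S' T) (h₂ : T.IsTensorProduct S'' U)
    (h₃ : S'.IsTensorProduct S'' T₂) : S.IsTensorProduct T₂ U := by
  obtain ⟨q₁, h₁, -⟩ := h₁.exists_balanced
  obtain ⟨q₂, h₂, -⟩ := h₂.exists_balanced
  obtain ⟨q₃, h₃, hq₃⟩ := h₃.exists_balanced
  set A : Set (S'.space × S''.space) := {z | S'.right.moment z.1 = S''.left.moment z.2}
  choose s hsA hsq using hq₃.surj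
  let F : S.space → S'.space × S''.space → U.space := fun x w => q₂ (q₁ (x, w.1), w.2)
  have hc : ∀ x y z, S.right.moment x = S'.left.moment y → S'.right.moment y = S''.left.moment z →
      T.right.moment (q₁ (x, y)) = S''.left.moment z := fun x y z hxy hyz => by
    rw [h₁.right_moment _ _ hxy, hyz]
  have hF : ∀ x, ∀ w ∈ A, S.right.moment x = S'.left.moment w.1 → F x (s (q₃ w)) = F x w := by
    intro x w hw hx
    obtain ⟨g, (hg : S'.right.moment w.1 = _), e⟩ := (hq₃.eq_iff _ hw _ (hsA _)).1 (hsq _).symm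
    have hw' : S'.right.moment w.1 = S''.left.moment w.2 := hw
    have hg' : Γ₃.src (Γ₃.inv g) = S''.left.moment w.2 := by rw [Γ₃.src_inv, ← hg, hw']
    simp only [F, e]
    rw [← h₁.right_act _ _ _ hx hg, h₂.balanced _ _ _ (by rw [h₁.right_moment _ _ hx, hg])
      (by rw [S''.left.moment_act _ _ hg', Γ₃.tgt_inv])]
    have := S''.left.inv_act_act hg'
    rw [Γ₃.inv_inv] at this
    rw [this]
  -- The balanced map `(x, [(y, z)]) ↦ [([(x, y)], z)]`.
  let q : S.space × T₂.space → U.space := fun v => F v.1 (s v.2)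
  have hq : ∀ x y z, S.right.moment x = S'.left.moment y → S'.right.moment y = S''.left.moment z →
      q (x, q₃ (y, z)) = q₂ (q₁ (x, y), z) := fun x y z hxy hyz => hF x (y, z) hyz hxy
  refine IsBalanced.isTensorProduct (q := q) hS.2 hT₂.2 hU.2 ⟨?_, ?_, ?_, ?_, ?_, ?_⟩
  · rintro ⟨x₀, w₀⟩ hxw
    set Z : Set (S.space × T₂.space) := {z | S.right.moment z.1 = T₂.left.moment z.2}
    obtain ⟨σ, hσ₀, hσ⟩ := hq₃.exists_section' (hsA w₀)
    rw [hsq] at hσ₀ hσ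
    have hev : ∀ᶠ v in 𝓝[Z] (x₀, w₀), (σ v.2 ∈ A ∧ q₃ (σ v.2) = v.2) ∧
        S.right.moment v.1 = S'.left.moment (σ v.2).1 := by
      have h2 := (continuous_snd.continuousWithinAt (s := Z) (x := (x₀, w₀))).eventually
          (hσ.mono fun z hz => hz.2 : ∀ᶠ z in 𝓝 w₀, σ z ∈ A ∧ q₃ (σ z) = z)
      filter_upwards [h2, self_mem_nhdsWithin] with v hv hvZ
      refine ⟨hv, ?_⟩
      rw [← h₃.left_moment (σ v.2).1 (σ v.2).2 hv.1]
      exact Eq.trans hvZ (congrArg T₂.left.moment hv.2.symm)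
    have hσs : ContMDiffWithinAt ((𝓡 S.space.dim).prod (𝓡 T₂.space.dim))
        ((𝓡 S'.space.dim).prod (𝓡 S''.space.dim)) ∞ (fun v : S.space × T₂.space => σ v.2) Z
        (x₀, w₀) := hσ.self_of_nhds.1.comp_contMDiffWithinAt (x₀, w₀) contMDiffWithinAt_snd
    have k1 := h₁.smooth.comp_within
      (f := fun v : S.space × T₂.space => v.1) contMDiffWithinAt_fst hσs.fst hxw
      (hev.mono fun v hv => hv.2)
    have k2 := h₂.smooth.comp_within k1 hσs.snd hxw (hev.mono fun v hv => hc _ _ _ hv.2 hv.1.1)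
    have heq : ∀ᶠ v in 𝓝[Z] (x₀, w₀), q v = q₂ (q₁ (v.1, (σ v.2).1), (σ v.2).2) := by
      filter_upwards [hev] with v hv
      have := hF v.1 _ hv.1.1 hv.2
      rw [hv.1.2] at this
      exact this
    exact k2.congr_of_eventuallyEq heq (heq.self_of_nhdsWithin hxw)
  · intro x w e
    obtain ⟨⟨y, z⟩, hyz, rfl⟩ := hq₃.surj w
    rw [h₃.left_moment y z hyz] at e
    rw [hq x y z e hyz, h₂.left_moment _ _ (hc _ _ _ e hyz), h₁.left_moment _ _ e]
  · intro x w e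
    obtain ⟨⟨y, z⟩, hyz, rfl⟩ := hq₃.surj w
    rw [h₃.left_moment y z hyz] at e
    rw [hq x y z e hyz, h₂.right_moment _ _ (hc _ _ _ e hyz), h₃.right_moment y z hyz]
  · intro x w g e hg
    obtain ⟨⟨y, z⟩, hyz, rfl⟩ := hq₃.surj w
    rw [h₃.left_moment y z hyz] at e
    rw [hq x y z e hyz, hq (S.left.act g x) y z ((S.right_moment_left _ _ hg).trans e) hyz,
      h₂.left_act _ _ _ (hc _ _ _ e hyz) (by rw [h₁.left_moment _ _ e, hg]),
      h₁.left_act _ _ _ e hg]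
  · intro x w g e hg
    obtain ⟨⟨y, z⟩, hyz, rfl⟩ := hq₃.surj w
    rw [h₃.left_moment y z hyz] at e
    rw [h₃.right_moment y z hyz] at hg
    rw [hq x y z e hyz, h₃.right_act y z g hyz hg,
      hq x y _ e (Eq.trans hyz (S''.left_moment_right _ _ hg).symm),
      h₂.right_act _ _ _ (hc _ _ _ e hyz) hg]
  · intro x w g hg hw
    obtain ⟨⟨y, z⟩, hyz, rfl⟩ := hq₃.surj w
    rw [h₃.left_moment y z hyz] at hw
    rw [h₃.left_act y z g hyz hw, hq _ y z (by rw [S.right.moment_act _ _ hg, hw]) hyz,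
      hq x _ z (by rw [S'.left.moment_act _ _ hw, hg]) ((S'.right_moment_left _ _ hw).trans hyz),
      h₁.balanced _ _ _ hg hw]

end Bibundle

/-! ### The groupoid of Lie groupoids and Morita bibundles -/

/-- Lie groupoids over arbitrary manifolds, as objects of the category of Morita bibundles. -/
structure LieGpd : Type (u + 1) where
  {base : SmoothMfd.{u}}
  gpd : LieGroupoid base

namespace LieGpd

/-- Isomorphism of biprincipal bibundles. -/
def homSetoid (X Y : LieGpd.{u}) : Setoid {S : Bibundle X.gpd Y.gpd // S.IsBiprincipal} where
  r S T := S.1.Isomorphic T.1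
  iseqv := ⟨fun S => .refl S.1, fun h => h.symm, fun h k => h.trans k⟩

/-- Isomorphism classes of biprincipal bibundles. -/
def Hom (X Y : LieGpd.{u}) : Type (u + 1) := Quotient (homSetoid X Y)

variable {X Y Z : LieGpd.{u}}

/-- The isomorphism class of a biprincipal bibundle. -/
def Hom.mk (S : Bibundle X.gpd Y.gpd) (hS : S.IsBiprincipal) : Hom X Y :=
  Quotient.mk (homSetoid X Y) ⟨S, hS⟩

theorem Hom.exists_rep (f : Hom X Y) : ∃ S hS, Hom.mk S hS = f := by
  obtain ⟨⟨S, hS⟩, rfl⟩ := Quotient.exists_rep f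
  exact ⟨S, hS, rfl⟩

theorem Hom.mk_eq_mk {S T : Bibundle X.gpd Y.gpd} {hS : S.IsBiprincipal} {hT : T.IsBiprincipal} :
    Hom.mk S hS = Hom.mk T hT ↔ S.Isomorphic T :=
  Quotient.eq (r := homSetoid X Y)

/-- The class of the tensor product. -/
noncomputable def Hom.tensor (f : Hom X Y) (g : Hom Y Z) : Hom X Z :=
  Quotient.map₂ (sc := homSetoid X Z)
    (fun S S' => ⟨(Bibundle.exists_isTensorProduct S.2 S'.2).choose,
      (Bibundle.exists_isTensorProduct S.2 S'.2).choose_spec.isBiprincipal S.2 S'.2⟩)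
    (fun S T hST S' T' hST' => by
      have h1 := (Bibundle.exists_isTensorProduct S.2 S'.2).choose_spec
      have h2 := (Bibundle.exists_isTensorProduct T.2 T'.2).choose_spec
      exact (h1.congr (Bibundle.Isomorphic.symm hST) (Bibundle.Isomorphic.symm hST') (.refl _)
        T.2 T'.2 (h1.isBiprincipal S.2 S'.2)).isomorphic h2) f g

theorem Hom.mk_tensor_mk_eq_iff {S : Bibundle X.gpd Y.gpd} {S' : Bibundle Y.gpd Z.gpd}
    {T : Bibundle X.gpd Z.gpd} {hS : S.IsBiprincipal} {hS' : S'.IsBiprincipal}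
    {hT : T.IsBiprincipal} :
    (Hom.mk S hS).tensor (Hom.mk S' hS') = Hom.mk T hT ↔ S.IsTensorProduct S' T := by
  have h := (Bibundle.exists_isTensorProduct hS hS').choose_spec
  refine (Hom.mk_eq_mk (hS := h.isBiprincipal hS hS') (hT := hT)).trans
    ⟨fun e => h.congr (.refl _) (.refl _) e hS hS' hT, fun e => h.isomorphic e⟩

/-- The class of the opposite bibundle. -/
def Hom.inv (f : Hom X Y) : Hom Y X :=
  Quotient.map (sb := homSetoid Y X) (fun S => ⟨S.1.op, S.2.op⟩) (by
    rintro S T ⟨f, h1, h2, h3, h4⟩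
    refine ⟨f, h2, h1, fun g x hg => h4 _ _ ?_, fun x g hg => h3 _ _ ?_⟩
    · rw [Y.gpd.tgt_inv, hg]
    · rw [X.gpd.src_inv, ← hg]) f

/-- Lie groupoids form a groupoid, whose morphisms are the isomorphism classes of biprincipal
bibundles, composed by the tensor product. -/
noncomputable instance : CategoryTheory.Groupoid LieGpd.{u} where
  Hom := Hom
  id X := Hom.mk X.gpd.unitBibundle X.gpd.unitBibundle_isBiprincipal
  comp f g := f.tensor g
  id_comp f := by
    obtain ⟨S, hS, rfl⟩ := f.exists_rep
    exact Hom.mk_tensor_mk_eq_iff.2 (Bibundle.unit_isTensorProduct hS)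
  comp_id f := by
    obtain ⟨S, hS, rfl⟩ := f.exists_rep
    exact Hom.mk_tensor_mk_eq_iff.2 (Bibundle.isTensorProduct_unit hS)
  assoc f g h := by
    obtain ⟨S, hS, rfl⟩ := f.exists_rep
    obtain ⟨S', hS', rfl⟩ := g.exists_rep
    obtain ⟨S'', hS'', rfl⟩ := h.exists_rep
    obtain ⟨T, hT, e⟩ := ((Hom.mk S hS).tensor (Hom.mk S' hS')).exists_rep
    obtain ⟨T', hT', e'⟩ := ((Hom.mk S' hS').tensor (Hom.mk S'' hS'')).exists_rep
    obtain ⟨U, hU, e''⟩ := ((Hom.mk T hT).tensor (Hom.mk S'' hS'')).exists_rep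
    rw [← e, ← e', ← e'', eq_comm]
    exact Hom.mk_tensor_mk_eq_iff.2 (Bibundle.IsTensorProduct.assoc hS hT' hU
      (Hom.mk_tensor_mk_eq_iff.1 e.symm) (Hom.mk_tensor_mk_eq_iff.1 e''.symm)
      (Hom.mk_tensor_mk_eq_iff.1 e'.symm))
  inv f := f.inv
  comp_inv f := by
    obtain ⟨S, hS, rfl⟩ := f.exists_rep
    exact Hom.mk_tensor_mk_eq_iff.2 (Bibundle.isTensorProduct_op hS)
  inv_comp f := by
    obtain ⟨S, hS, rfl⟩ := f.exists_rep
    refine Hom.mk_tensor_mk_eq_iff.2 ?_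
    exact (Bibundle.isTensorProduct_op hS.op).congr (.refl _) S.op_op_isomorphic.symm (.refl _)
      hS.op hS (LieGroupoid.unitBibundle_isBiprincipal _)

end LieGpd

namespace LieGroupoid

variable {P : SmoothMfd.{u}} (Γ : LieGroupoid P)

/-- The Picard group is the automorphism group of `Γ` in the category of Morita bibundles. -/
@[reducible]
noncomputable def picardGroup : Group Γ.Pic :=
  CategoryTheory.Groupoid.vertexGroup (C := LieGpd.{u}) ⟨Γ⟩

theorem isPicardGroup_picardGroup : Γ.IsPicardGroup Γ.picardGroup where
  one_eq := rfl
  mul_eq_iff S S' T := LieGpd.Hom.mk_tensor_mk_eq_iff (X := ⟨Γ⟩) (Y := ⟨Γ⟩) (Z := ⟨Γ⟩)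
    (hS := S.2) (hS' := S'.2) (hT := T.2)

end LieGroupoid

/-- Morita equivalent Lie groupoids have isomorphic Picard groups. -/
theorem Bibundle.IsBiprincipal.nonempty_picardGroup_mulEquiv {P₁ P₂ : SmoothMfd.{u}}
    {Γ₁ : LieGroupoid P₁} {Γ₂ : LieGroupoid P₂} {S : Bibundle Γ₁ Γ₂} (hS : S.IsBiprincipal) :
    Nonempty (@MulEquiv Γ₁.Pic Γ₂.Pic Γ₁.picardGroup.toMul Γ₂.picardGroup.toMul) :=
  ⟨CategoryTheory.Groupoid.vertexGroupIsomOfMap (C := LieGpd.{u}) (c := ⟨Γ₁⟩) (d := ⟨Γ₂⟩)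
    (LieGpd.Hom.mk S hS)⟩

/-! ### Gauge groupoids -/

section Gauge

variable {P B E Q : SmoothMfd.{u}} {Γ : LieGroupoid P} {a : RightAction Γ E} {p : E → B}

/-- `q` exhibits `Q` as the quotient `(E ×_P E) / Γ` by the diagonal action. -/
def IsGaugeQuotient (a : RightAction Γ E) (q : E × E → Q) : Prop :=
  IsQuotientOf {z : E × E | a.moment z.1 = a.moment z.2}
    (fun z w => ∃ g, a.moment z.1 = Γ.tgt g ∧ w = (a.act z.1 g, a.act z.2 g)) q

namespace IsGaugeQuotient

variable {q : E × E → Q} (hq : IsGaugeQuotient a q)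
include hq

theorem act_act {x y : E} {g : Γ.Arr} (e : a.moment x = a.moment y) (hg : a.moment x = Γ.tgt g) :
    q (a.act x g, a.act y g) = q (x, y) := by
  refine ((hq.eq_iff (x, y) e _ ?_).2 ⟨g, hg, rfl⟩).symm
  change a.moment _ = a.moment _
  rw [a.moment_act _ _ hg, a.moment_act _ _ (e ▸ hg)]

theorem exists_eq {x y x' y' : E} (e : a.moment x = a.moment y) (e' : a.moment x' = a.moment y')
    (h : q (x, y) = q (x', y')) :
    ∃ g, a.moment x = Γ.tgt g ∧ x' = a.act x g ∧ y' = a.act y g := by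
  obtain ⟨g, hg, h2⟩ := (hq.eq_iff (x, y) e (x', y') e').1 h
  exact ⟨g, hg, (Prod.mk.inj h2).1, (Prod.mk.inj h2).2⟩

/-- An arrow has a representative with prescribed second component. -/
theorem exists_rep_right (ha : a.IsPrincipal p) (c : Q) {e : E}
    (h : ∀ x y, a.moment x = a.moment y → q (x, y) = c → p y = p e) :
    ∃ x, a.moment x = a.moment e ∧ q (x, e) = c := by
  obtain ⟨⟨x, y⟩, (hxy : a.moment x = a.moment y), rfl⟩ := hq.surj c
  obtain ⟨g, hg, rfl⟩ := ha.transitive y e (h x y hxy rfl)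
  refine ⟨a.act x g, ?_, hq.act_act hxy (hxy.trans hg)⟩
  rw [a.moment_act _ _ hg, a.moment_act _ _ (hxy.trans hg)]

/-- Products in the gauge groupoid are well defined. -/
theorem mul_unique (ha : a.IsPrincipal p) {x y z x' y' z' : E} (e₁ : a.moment x = a.moment y)
    (e₂ : a.moment y = a.moment z) (e₁' : a.moment x' = a.moment y')
    (e₂' : a.moment y' = a.moment z') (h₁ : q (x, y) = q (x', y')) (h₂ : q (y, z) = q (y', z')) :
    q (x, z) = q (x', z') := by
  obtain ⟨g, hg, rfl, rfl⟩ := hq.exists_eq e₁ e₁' h₁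
  obtain ⟨k, hk, hy, rfl⟩ := hq.exists_eq e₂ e₂' h₂
  obtain rfl := ha.cancel (e₁ ▸ hg) hk hy
  exact (hq.act_act (e₁.trans e₂) hg).symm

end IsGaugeQuotient

theorem RightAction.IsPrincipal.exists_isGaugeQuotient (ha : a.IsPrincipal p)
    (hJ : SurjSubmersion a.moment) : ∃ (Q : SmoothMfd.{u}) (q : E × E → Q), IsGaugeQuotient a q := by
  obtain ⟨Q, q, hq⟩ := ha.exists_isQuotientOf a.op hJ
  simp only [Γ.inv_inv] at hq
  exact ⟨Q, q, hq⟩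

/-- The gauge groupoid of a principal bundle with submersive moment exists. -/
theorem exists_isGaugeGroupoid (ha : a.IsPrincipal p) (hJ : SurjSubmersion a.moment) :
    ∃ 𝒢 : LieGroupoid B, IsGaugeGroupoid a p 𝒢 := by
  obtain ⟨Q, q, hq⟩ := ha.exists_isGaugeQuotient hJ
  have hq' : IsQuotientOf _ _ q := hq
  set A : Set (E × E) := {z : E × E | a.moment z.1 = a.moment z.2} with hA
  have hp := ha.submersion.smooth
  obtain ⟨tgt, htgt, ht⟩ := hq'.exists_lift (K := B) (F := fun z => p z.1)
    (fun z hz => hp.comp_within contMDiffWithinAt_fst)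
    (by rintro z hz _ - ⟨g, hg, rfl⟩; exact (ha.invariant _ _ hg).symm)
  obtain ⟨src, hsrc, hs⟩ := hq'.exists_lift (K := B) (F := fun z => p z.2)
    (fun z hz => hp.comp_within contMDiffWithinAt_snd)
    (by
      rintro z hz _ - ⟨g, hg, rfl⟩
      exact (ha.invariant _ _ ((Eq.symm hz).trans hg)).symm)
  obtain ⟨inv, hinv, hi⟩ := hq'.exists_lift (K := Q) (F := fun z => q (z.2, z.1))
    (fun z hz => hq'.smooth.comp_within contMDiffWithinAt_snd contMDiffWithinAt_fst hz
      (eventually_mem_nhdsWithin.mono fun w hw => Eq.symm hw))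
    (by
      rintro z hz _ - ⟨g, hg, rfl⟩
      exact (hq.act_act (Eq.symm hz) ((Eq.symm hz).trans hg)).symm)
  have ht' : ∀ {x y}, a.moment x = a.moment y → tgt (q (x, y)) = p x := fun {x y} e => ht (x, y) e
  have hs' : ∀ {x y}, a.moment x = a.moment y → src (q (x, y)) = p y := fun {x y} e => hs (x, y) e
  have hi' : ∀ {x y}, a.moment x = a.moment y → inv (q (x, y)) = q (y, x) := fun {x y} e =>
    hi (x, y) e
  have hdiag : ∀ {x y}, p x = p y → q (x, x) = q (y, y) := by
    intro x y e
    obtain ⟨g, hg, rfl⟩ := ha.transitive x y e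
    exact (hq.act_act rfl hg).symm
  choose s hps using ha.submersion.1
  choose r hrA hrq using hq'.surj
  -- The product formula in terms of representatives.
  let M : E × E → E × E → Q := fun z w => q (z.1, a.act w.2 (ha.div (w.1, z.2)))
  have hM0 : ∀ z ∈ A, ∀ w ∈ A, p z.2 = p w.1 → a.moment w.2 = Γ.tgt (ha.div (w.1, z.2)) ∧
      a.moment z.2 = a.moment (a.act w.2 (ha.div (w.1, z.2))) := by
    intro z hz w hw e
    have h1 : a.moment w.2 = Γ.tgt (ha.div (w.1, z.2)) := by
      rw [ha.tgt_div e.symm]; exact Eq.symm hw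
    refine ⟨h1, ?_⟩
    rw [a.moment_act _ _ h1, ha.src_div e.symm]
  have hM : ∀ z ∈ A, ∀ w ∈ A, ∀ x y v, a.moment x = a.moment y → a.moment y = a.moment v →
      q z = q (x, y) → q w = q (y, v) → M z w = q (x, v) := by
    intro z hz w hw x y v hxy hyv e1 e2
    have e : p z.2 = p w.1 := by rw [← hs z hz, ← ht w hw, e1, e2, hs' hxy, ht' hyv]
    obtain ⟨h1, h2⟩ := hM0 z hz w hw e
    refine hq.mul_unique ha (y := z.2) (y' := y) hz h2 hxy hyv e1 ?_
    rw [← e2]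
    have h3 := hq.act_act (x := w.1) (y := w.2) hw (Eq.trans hw h1)
    rw [ha.act_div e.symm] at h3
    exact h3
  have hrep : ∀ c d, src c = tgt d → ∃ x y z, a.moment x = a.moment y ∧ a.moment y = a.moment z ∧
      q (x, y) = c ∧ q (y, z) = d := by
    intro c d e
    obtain ⟨⟨y, z⟩, hyz, rfl⟩ := hq'.surj d
    obtain ⟨x, hx, rfl⟩ := hq.exists_rep_right ha c (e := y) (fun x' y' e' h => by
      rw [← hs' e', h, e, ht' hyz])
    exact ⟨x, y, z, hx, hyz, rfl, rfl⟩
  have hmul : ∀ {x y z}, a.moment x = a.moment y → a.moment y = a.moment z →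
      M (r (q (x, y))) (r (q (y, z))) = q (x, z) := fun {x y z} e1 e2 =>
    hM _ (hrA _) _ (hrA _) x y z e1 e2 (hrq _) (hrq _)
  have htsub : SurjSubmersion tgt := by
    refine surjSubmersion_of_section htgt (fun b => ⟨q (s b, s b), by rw [ht' rfl, hps]⟩) ?_
    intro c
    obtain ⟨⟨x₀, y₀⟩, (hxy : a.moment x₀ = a.moment y₀), rfl⟩ := hq'.surj c
    obtain ⟨σ, hσ₀, hσ⟩ := ha.submersion.exists_section x₀
    obtain ⟨τ, hτ₀, hτ⟩ := hJ.exists_section y₀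
    rw [ht' hxy]
    have hev : ∀ᶠ u in 𝓝 (p x₀), ContMDiffAt (𝓡 B.dim) (𝓡 E.dim) ∞
        (fun u => τ (a.moment (σ u))) u ∧ a.moment (τ (a.moment (σ u))) = a.moment (σ u) := by
      have hc : ContinuousAt (fun u => a.moment (σ u)) (p x₀) :=
        a.smooth_moment.continuous.continuousAt.comp hσ.self_of_nhds.1.continuousAt
      have := hc.eventually (by simp only [hσ₀, hxy]; exact hτ)
      filter_upwards [this, hσ] with u hu hu1
      exact ⟨hu.1.comp u ((a.smooth_moment (σ u)).comp u hu1.1), hu.2⟩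
    obtain ⟨U, hU, hUo, hu₀⟩ := eventually_nhds_iff.1 (hσ.and hev)
    refine ⟨fun u => q (σ u, τ (a.moment (σ u))), by simp only [hσ₀, hxy, hτ₀], ?_⟩
    filter_upwards [hUo.mem_nhds hu₀] with u hu
    refine ⟨(hq'.smooth.comp_within (hU u hu).1.1.contMDiffWithinAt
        (hU u hu).2.1.contMDiffWithinAt hu (eventually_mem_nhdsWithin.mono fun v hv =>
          (hU v hv).2.2.symm)).contMDiffAt (hUo.mem_nhds hu), ?_⟩
    rw [ht' (hU u hu).2.2.symm, (hU u hu).1.2]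
  have hst : ∀ c, src (inv c) = tgt c := by
    intro c
    obtain ⟨⟨x, y⟩, hxy, rfl⟩ := hq'.surj c
    rw [hi' hxy, hs' (Eq.symm hxy), ht' hxy]
  have hts : ∀ c, tgt (inv c) = src c := by
    intro c
    obtain ⟨⟨x, y⟩, hxy, rfl⟩ := hq'.surj c
    rw [hi' hxy, ht' (Eq.symm hxy), hs' hxy]
  have hii : ∀ c, inv (inv c) = c := by
    intro c
    obtain ⟨⟨x, y⟩, hxy, rfl⟩ := hq'.surj c
    rw [hi' hxy, hi' (Eq.symm hxy)]
  have hssub : SurjSubmersion src := by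
    refine surjSubmersion_of_section hsrc (fun b => ⟨q (s b, s b), by rw [hs' rfl, hps]⟩) ?_
    intro c
    obtain ⟨σ, hσ₀, hσ⟩ := htsub.exists_section (inv c)
    rw [hts] at hσ₀ hσ
    refine ⟨fun u => inv (σ u), (congrArg inv hσ₀).trans (hii c), ?_⟩
    filter_upwards [hσ] with u hu
    exact ⟨(hinv (σ u)).comp u hu.1, by rw [hst, hu.2]⟩
  let 𝒢 : LieGroupoid B :=
    { Arr := Q
      src := src
      tgt := tgt
      unit := fun b => q (s b, s b)
      inv := inv
      mul := fun c d => M (r c) (r d)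
      src_unit := fun b => by rw [hs' rfl, hps]
      tgt_unit := fun b => by rw [ht' rfl, hps]
      src_inv := hst
      tgt_inv := hts
      src_mul := fun c d e => by
        obtain ⟨x, y, z, h1, h2, rfl, rfl⟩ := hrep c d e
        rw [hmul h1 h2, hs' (h1.trans h2), hs' h2]
      tgt_mul := fun c d e => by
        obtain ⟨x, y, z, h1, h2, rfl, rfl⟩ := hrep c d e
        rw [hmul h1 h2, ht' (h1.trans h2), ht' h1]
      mul_assoc := fun c d f e1 e2 => by
        obtain ⟨y, z, w, h2, h3, rfl, rfl⟩ := hrep d f e2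
        obtain ⟨x, h1, rfl⟩ := hq.exists_rep_right ha c (e := y) (fun x' y' e' h => by
          rw [← hs' e', h, e1, ht' h2])
        rw [hmul h1 h2, hmul h2 h3, hmul (h1.trans h2) h3, hmul h1 (h2.trans h3)]
      unit_mul := fun c => by
        obtain ⟨⟨x, y⟩, hxy, rfl⟩ := hq'.surj c
        rw [hdiag (x := s (tgt (q (x, y)))) (y := x) (by rw [hps, ht' hxy]), hmul rfl hxy]
      mul_unit := fun c => by
        obtain ⟨⟨x, y⟩, hxy, rfl⟩ := hq'.surj c
        rw [hdiag (x := s (src (q (x, y)))) (y := y) (by rw [hps, hs' hxy]), hmul hxy rfl]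
      inv_mul := fun c => by
        obtain ⟨⟨x, y⟩, hxy, rfl⟩ := hq'.surj c
        rw [hi' hxy, hmul (Eq.symm hxy) hxy]
        exact hdiag (by rw [hps, hs' hxy])
      mul_inv := fun c => by
        obtain ⟨⟨x, y⟩, hxy, rfl⟩ := hq'.surj c
        rw [hi' hxy, hmul hxy (Eq.symm hxy)]
        exact hdiag (by rw [hps, ht' hxy])
      src_submersion := hssub
      tgt_submersion := htsub
      smooth_unit := by
        intro b
        obtain ⟨σ, hσ₀, hσ⟩ := ha.submersion.exists_section (s b)
        rw [hps] at hσ₀ hσ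
        have h1 : ContMDiffWithinAt (𝓡 B.dim) (𝓡 Q.dim) ∞ (fun u => q (σ u, σ u)) univ b :=
          hq'.smooth.comp_within hσ.self_of_nhds.1.contMDiffWithinAt
            hσ.self_of_nhds.1.contMDiffWithinAt (mem_univ _) (Eventually.of_forall fun _ => rfl)
        refine h1.contMDiffAt univ_mem |>.congr_of_eventuallyEq ?_
        filter_upwards [hσ] with u hu
        exact hdiag (by rw [hps, hu.2])
      smooth_inv := hinv
      smooth_mul := by
        rintro ⟨c₀, d₀⟩ hcd
        obtain ⟨σ, hσ₀, hσ⟩ := hq'.exists_section' (hrA c₀)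
        obtain ⟨τ, hτ₀, hτ⟩ := hq'.exists_section' (hrA d₀)
        rw [hrq] at hσ₀ hσ hτ₀ hτ
        set Z : Set (Q × Q) := {v | src v.1 = tgt v.2}
        have hev : ∀ᶠ w in 𝓝[Z] (c₀, d₀), (σ w.1 ∈ A ∧ q (σ w.1) = w.1) ∧
            (τ w.2 ∈ A ∧ q (τ w.2) = w.2) ∧ p (σ w.1).2 = p (τ w.2).1 := by
          have h1 := (continuous_fst.continuousWithinAt (s := Z) (x := (c₀, d₀))).eventually
            (hσ.mono fun z hz => hz.2 : ∀ᶠ z in 𝓝 c₀, σ z ∈ A ∧ q (σ z) = z)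
          have h2 := (continuous_snd.continuousWithinAt (s := Z) (x := (c₀, d₀))).eventually
            (hτ.mono fun z hz => hz.2 : ∀ᶠ z in 𝓝 d₀, τ z ∈ A ∧ q (τ z) = z)
          filter_upwards [h1, h2, self_mem_nhdsWithin] with w hw1 hw2 hw
          refine ⟨hw1, hw2, ?_⟩
          rw [← hs _ hw1.1, ← ht _ hw2.1, hw1.2, hw2.2]
          exact hw
        have hσs : ContMDiffWithinAt ((𝓡 Q.dim).prod (𝓡 Q.dim)) ((𝓡 E.dim).prod (𝓡 E.dim)) ∞
            (fun w : Q × Q => σ w.1) Z (c₀, d₀) :=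
          hσ.self_of_nhds.1.comp_contMDiffWithinAt (c₀, d₀) contMDiffWithinAt_fst
        have hτs : ContMDiffWithinAt ((𝓡 Q.dim).prod (𝓡 Q.dim)) ((𝓡 E.dim).prod (𝓡 E.dim)) ∞
            (fun w : Q × Q => τ w.2) Z (c₀, d₀) :=
          hτ.self_of_nhds.1.comp_contMDiffWithinAt (c₀, d₀) contMDiffWithinAt_snd
        have k1 := ha.smooth_div'.comp_within hτs.fst hσs.snd hcd
          (hev.mono fun w hw => hw.2.2.symm)
        have k2 := a.smooth_act.comp_within hτs.snd k1 hcd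
          (hev.mono fun w hw => (hM0 _ hw.1.1 _ hw.2.1.1 hw.2.2).1)
        have k3 := hq'.smooth.comp_within hσs.fst k2 hcd
          (hev.mono fun w hw => Eq.trans hw.1.1 (hM0 _ hw.1.1 _ hw.2.1.1 hw.2.2).2)
        have heq : ∀ᶠ w in 𝓝[Z] (c₀, d₀), M (r w.1) (r w.2) = M (σ w.1) (τ w.2) := by
          filter_upwards [hev, self_mem_nhdsWithin] with w hw hwZ
          obtain ⟨x, y, z, h1, h2, e1, e2⟩ := hrep _ _ hwZ
          rw [hM _ hw.1.1 _ hw.2.1.1 x y z h1 h2 (by rw [hw.1.2, e1]) (by rw [hw.2.1.2, e2]),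
            ← e1, ← e2, hmul h1 h2]
        exact k3.congr_of_eventuallyEq heq (heq.self_of_nhdsWithin hcd) }
  exact ⟨𝒢, q, hq, fun x y e => ⟨ht' e, hs' e⟩, fun x y z e1 e2 => hmul e1 e2⟩

/-- A principal bundle is a biprincipal bibundle between its gauge groupoid, which acts by
`[(x, y)] y = x`, and its structure groupoid. -/
theorem IsGaugeGroupoid.exists_isBiprincipal {𝒢 : LieGroupoid B} (h : IsGaugeGroupoid a p 𝒢)
    (ha : a.IsPrincipal p) (hJ : SurjSubmersion a.moment) :
    ∃ S : Bibundle 𝒢 Γ, S.IsBiprincipal := by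
  obtain ⟨q, hq, hts, hmul⟩ := h
  have hg : IsGaugeQuotient a q := hq
  have ht' : ∀ {x y}, a.moment x = a.moment y → 𝒢.tgt (q (x, y)) = p x := fun {x y} e =>
    (hts x y e).1
  have hs' : ∀ {x y}, a.moment x = a.moment y → 𝒢.src (q (x, y)) = p y := fun {x y} e =>
    (hts x y e).2
  set A : Set (E × E) := {z : E × E | a.moment z.1 = a.moment z.2} with hA
  choose r hrA hrq using hq.surj
  have hrep : ∀ c e, 𝒢.src c = p e → ∃ x, a.moment x = a.moment e ∧ q (x, e) = c := fun c e he =>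
    hg.exists_rep_right ha c (fun x y hxy hc => by rw [← hs' hxy, hc, he])
  let F : E × E → E → E := fun z e => a.act z.1 (ha.div (z.2, e))
  have hF0 : ∀ z ∈ A, ∀ e, p z.2 = p e → a.moment z.1 = Γ.tgt (ha.div (z.2, e)) := by
    intro z hz e he
    rw [ha.tgt_div he]
    exact hz
  have hF : ∀ z ∈ A, ∀ x e, a.moment x = a.moment e → q z = q (x, e) → F z e = x := by
    rintro ⟨x', y'⟩ hz x e hxe h
    obtain ⟨g, hg, rfl, rfl⟩ := hg.exists_eq hz hxe h
    have hz' : a.moment x' = a.moment y' := hz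
    simp only [F]
    rw [ha.div_act (hz' ▸ hg)]
  have hact : ∀ {x e}, a.moment x = a.moment e → F (r (q (x, e))) e = x := fun {x e} hxe =>
    hF _ (hrA _) x e hxe (hrq _)
  have hunit : ∀ x, q (x, x) = 𝒢.unit (p x) := by
    intro x
    have h1 := 𝒢.inv_mul_cancel_left (g := q (x, x)) (h := q (x, x)) (by rw [hs' rfl, ht' rfl])
    rw [hmul x x x rfl rfl, 𝒢.inv_mul, hs' rfl] at h1
    exact h1.symm
  let l : LeftAction 𝒢 E :=
    { moment := p
      act := fun c e => F (r c) e
      smooth_moment := ha.submersion.smooth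
      smooth_act := by
        rintro ⟨c₀, e₀⟩ hce
        obtain ⟨σ, hσ₀, hσ⟩ := hq.exists_section' (hrA c₀)
        rw [hrq] at hσ₀ hσ
        set Z : Set (𝒢.Arr × E) := {v | 𝒢.src v.1 = p v.2}
        have hev : ∀ᶠ w in 𝓝[Z] (c₀, e₀), (σ w.1 ∈ A ∧ q (σ w.1) = w.1) ∧
            p (σ w.1).2 = p w.2 := by
          have h1 := (continuous_fst.continuousWithinAt (s := Z) (x := (c₀, e₀))).eventually
            (hσ.mono fun z hz => hz.2 : ∀ᶠ z in 𝓝 c₀, σ z ∈ A ∧ q (σ z) = z)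
          filter_upwards [h1, self_mem_nhdsWithin] with w hw1 hw
          refine ⟨hw1, ?_⟩
          rw [← hs' (x := (σ w.1).1) hw1.1, Prod.mk.eta, hw1.2]
          exact hw
        have hσs : ContMDiffWithinAt ((𝓡 𝒢.Arr.dim).prod (𝓡 E.dim))
            ((𝓡 E.dim).prod (𝓡 E.dim)) ∞ (fun w : 𝒢.Arr × E => σ w.1) Z (c₀, e₀) :=
          hσ.self_of_nhds.1.comp_contMDiffWithinAt (c₀, e₀) contMDiffWithinAt_fst
        have k1 := ha.smooth_div'.comp_within hσs.snd
          (g := fun w : 𝒢.Arr × E => w.2) contMDiffWithinAt_snd hce (hev.mono fun w hw => hw.2)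
        have k2 := a.smooth_act.comp_within hσs.fst k1 hce
          (hev.mono fun w hw => hF0 _ hw.1.1 _ hw.2)
        have heq : ∀ᶠ w in 𝓝[Z] (c₀, e₀), F (r w.1) w.2 = F (σ w.1) w.2 := by
          filter_upwards [hev, self_mem_nhdsWithin] with w hw hwZ
          obtain ⟨x, hx, e1⟩ := hrep _ _ hwZ
          rw [hF _ hw.1.1 x w.2 hx (by rw [hw.1.2, e1]), ← e1, hact hx]
        exact k2.congr_of_eventuallyEq heq (heq.self_of_nhdsWithin hce)
      moment_act := by
        intro c e h
        obtain ⟨x, hx, rfl⟩ := hrep c e h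
        rw [hact hx, ht' hx]
      unit_act := fun e => by rw [← hunit, hact rfl]
      mul_act := by
        intro c d e h1 h2
        obtain ⟨y, hy, rfl⟩ := hrep d e h2
        obtain ⟨x, hx, rfl⟩ := hrep c y (by rw [h1, ht' hy])
        rw [hmul x y e hx hy, hact (hx.trans hy), hact hy, hact hx] }
  have hact' : ∀ {x e}, a.moment x = a.moment e → l.act (q (x, e)) e = x := hact
  refine ⟨{ space := E, left := l, right := a, right_moment_left := ?_,
            left_moment_right := ha.invariant, comm := ?_ },
    ⟨hJ, ?_, ?_, fun x y e => ⟨q (x, y), hs' e, hact' e⟩, q, hq.smooth, fun x y e =>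
      ⟨hs' e, hact' e⟩⟩, ha⟩
  · intro c e h
    obtain ⟨x, hx, rfl⟩ := hrep c e h
    rw [hact' hx, hx]
  · intro c e k h hk
    obtain ⟨x, hx, rfl⟩ := hrep c e h
    have hk' : a.moment x = Γ.tgt k := hx.trans hk
    rw [hact' hx, ← hg.act_act hx hk', hact']
    rw [a.moment_act _ _ hk', a.moment_act _ _ hk]
  · intro c e h
    obtain ⟨x, hx, rfl⟩ := hrep c e h
    change a.moment (l.act _ _) = _
    rw [hact' hx, hx]
  · intro c e h h2
    obtain ⟨x, hx, rfl⟩ := hrep c e h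
    change l.act _ _ = _ at h2
    rw [hact' hx] at h2
    rw [h2]
    exact hunit e

end Gauge

/-! ### The Picard group of a Lie group -/

namespace LieGroup

variable {n : ℕ} {G : Type u} [TopologicalSpace G] [ChartedSpace (EuclideanSpace ℝ (Fin n)) G]
  [Group G] [LieGroup (𝓡 n) ∞ G]

/-- The bibundle `G_φ` of an automorphism `φ` of a Lie group `G`: the manifold `G`, on which `G`
acts from the left by multiplication and from the right by `x · h = x φ(h)`. -/
def twist (φ : Aut (n := n) G) :
    Bibundle (toLieGroupoid (n := n) G) (toLieGroupoid (n := n) G) where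
  space := toSmoothMfd (n := n) G
  left := (toLieGroupoid (n := n) G).unitBibundle.left
  right :=
    { moment := fun _ => default
      act := fun x h : G => (x * φ.1 h : G)
      smooth_moment := contMDiff_const
      smooth_act := ((contMDiff_mul (𝓡 n) (G := G) ∞).comp
        (contMDiff_fst.prodMk (φ.2.1.comp contMDiff_snd))).contMDiffOn
      moment_act := fun _ _ _ => rfl
      act_unit := fun x : G => by
        change x * φ.1 1 = x
        rw [map_one, mul_one]
      act_mul := fun (x g h : G) _ _ => by
        change x * φ.1 (g * h) = x * φ.1 g * φ.1 h
        rw [map_mul, mul_assoc] }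
  right_moment_left _ _ _ := rfl
  left_moment_right _ _ _ := rfl
  comm := fun (g x h : G) _ _ => mul_assoc g x (φ.1 h)

theorem twist_isBiprincipal (φ : Aut (n := n) G) : (twist φ).IsBiprincipal := by
  refine ⟨(toLieGroupoid (n := n) G).unitBibundle_isBiprincipal.1,
    (toLieGroupoid (n := n) G).tgt_submersion, fun _ _ _ => rfl, fun (x g : G) _ h => ?_,
    fun (x y : G) _ => ⟨(φ.1.symm (x⁻¹ * y) : G), rfl, ?_⟩,
    fun z : G × G => (φ.1.symm (z.1⁻¹ * z.2) : G), ?_, fun (x y : G) _ => ⟨rfl, ?_⟩⟩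
  · change x * φ.1 g = x at h
    rw [mul_eq_left, map_eq_one_iff φ.1 φ.1.injective] at h
    exact h
  · change x * φ.1 (φ.1.symm (x⁻¹ * y)) = y
    rw [MulEquiv.apply_symm_apply, mul_inv_cancel_left]
  · have h : ContMDiff ((𝓡 n).prod (𝓡 n)) (𝓡 n) ∞ (fun z : G × G => z.1⁻¹ * z.2) :=
      contMDiff_fst.inv.mul contMDiff_snd
    exact (φ.2.2.comp h).contMDiffOn
  · change x * φ.1 (φ.1.symm (x⁻¹ * y)) = y
    rw [MulEquiv.apply_symm_apply, mul_inv_cancel_left]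

/-- The tensor product `G_φ * G_ψ` is `G_{φ ψ}`, through the map `(x, y) ↦ x φ(y)`. -/
theorem twist_isTensorProduct (φ ψ : Aut (n := n) G) :
    (twist φ).IsTensorProduct (twist ψ) (twist (φ * ψ)) := by
  refine Bibundle.IsBalanced.isTensorProduct (q := fun z : G × G => (z.1 * φ.1 z.2 : G))
    (twist_isBiprincipal φ).2 (twist_isBiprincipal ψ).2 (twist_isBiprincipal _).2
    ⟨?_, fun _ _ _ => rfl, fun _ _ _ => rfl, fun (x y g : G) _ _ => ?_, fun (x y h : G) _ _ => ?_,
      fun (x y g : G) _ _ => ?_⟩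
  · have h : ContMDiff ((𝓡 n).prod (𝓡 n)) (𝓡 n) ∞ (fun z : G × G => z.1 * φ.1 z.2) :=
      contMDiff_fst.mul (φ.2.1.comp contMDiff_snd)
    exact h.contMDiffOn
  · exact (mul_assoc g x (φ.1 y)).symm
  · change x * φ.1 y * φ.1 (ψ.1 h) = x * φ.1 (y * ψ.1 h)
    rw [map_mul, mul_assoc]
  · change x * φ.1 g * φ.1 y = x * φ.1 (g * y)
    rw [map_mul, mul_assoc]

/-- An isomorphism `G_φ ≅ G` is the right multiplication by some `c`, and then `φ` is the
conjugation by `c`. -/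
theorem twist_isomorphic_unit_iff (φ : Aut (n := n) G) :
    (twist φ).Isomorphic (toLieGroupoid (n := n) G).unitBibundle ↔ φ ∈ Inn (n := n) G := by
  constructor
  · rintro ⟨f, -, -, hl, hr⟩
    let f' : G → G := f
    let c : G := f' 1
    refine Subgroup.mem_subgroupOf.2 ⟨c, MulEquiv.ext fun h => ?_⟩
    have h1 : f' (φ.1 h * 1) = φ.1 h * c := hl (φ.1 h : G) (1 : G) rfl
    have h2 : f' (1 * φ.1 h) = c * h := hr (1 : G) (h : G) rfl
    rw [mul_one] at h1
    rw [one_mul, h1] at h2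
    rw [MulAut.conj_apply]
    exact (eq_mul_inv_of_mul_eq h2).symm
  · intro hφ
    obtain ⟨c, hc⟩ := Subgroup.mem_subgroupOf.1 hφ
    have hc' : ∀ h : G, φ.1 h = c * h * c⁻¹ := fun h => by
      rw [← MulAut.conj_apply, hc]
    let f : Diffeomorph (𝓡 n) (𝓡 n) G G ∞ :=
      { toEquiv := Equiv.mulRight c
        contMDiff_toFun := contMDiff_mul_right
        contMDiff_invFun := contMDiff_mul_right }
    refine ⟨f, fun _ => rfl, fun _ => rfl, fun (g x : G) _ => mul_assoc g x c,
      fun (x h : G) _ => ?_⟩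
    change x * φ.1 h * c = x * c * h
    rw [hc']
    group

/-- Every biprincipal bibundle of a Lie group `G` is isomorphic to some `G_φ`: for a point `x₀` of
it, `φ` is given by `x₀ h = φ(h) x₀`. -/
theorem exists_twist_isomorphic
    (S : Bibundle (toLieGroupoid (n := n) G) (toLieGroupoid (n := n) G)) (hS : S.IsBiprincipal) :
    ∃ φ : Aut (n := n) G, (twist φ).Isomorphic S := by
  obtain ⟨hl, hr⟩ := hS
  obtain ⟨x₀, -⟩ := hl.submersion.1 default
  have hm : ∀ x y : S.space, S.right.moment x = S.right.moment y :=
    fun _ _ => Subsingleton.elim (α := point.{u}) _ _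
  have hm' : ∀ x y : S.space, S.left.moment x = S.left.moment y :=
    fun _ _ => Subsingleton.elim (α := point.{u}) _ _
  have ht : ∀ (x : S.space) (g : G), S.right.moment x = default :=
    fun _ _ => Subsingleton.elim (α := point.{u}) _ _
  have hs : ∀ (g : G) (x : S.space), default = S.left.moment x :=
    fun _ _ => Subsingleton.elim (α := point.{u}) _ _
  let d : S.space → G := fun y => hl.div (y, x₀)
  let d' : S.space → G := fun y => hr.div (x₀, y)
  have hd : ∀ y, S.left.act (d y) x₀ = y := fun y => hl.div_act (hm y x₀)
  have hd' : ∀ y, S.right.act x₀ (d' y) = y := fun y => hr.act_div (hm' x₀ y)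
  have cl : ∀ g k : G, S.left.act g x₀ = S.left.act k x₀ → g = k :=
    fun g k => hl.cancel (hs g x₀) (hs k x₀)
  have cr : ∀ g k : G, S.right.act x₀ g = S.right.act x₀ k → g = k :=
    fun g k => hr.cancel (ht x₀ g) (ht x₀ k)
  have hcomm : ∀ (g : G) (x : S.space) (h : G),
      S.right.act (S.left.act g x) h = S.left.act g (S.right.act x h) :=
    fun g x h => S.comm g x h (hs g x) (ht x h)
  have hml : ∀ (g h : G) (x : S.space), S.left.act (g * h : G) x = S.left.act g (S.left.act h x) :=
    fun g h x => S.left.mul_act g h x rfl (hs h x)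
  have hmr : ∀ (x : S.space) (g h : G),
      S.right.act x (g * h : G) = S.right.act (S.right.act x g) h :=
    fun x g h => S.right.act_mul x g h (ht x g) rfl
  have sd : ContMDiff (𝓡 S.space.dim) (𝓡 n) ∞ d := fun y =>
    (hl.smooth_div'.comp_within (A := univ) (f := id) (g := fun _ => x₀) contMDiffWithinAt_id
      contMDiffWithinAt_const (mem_univ y) (.of_forall fun y => hm y x₀)).contMDiffAt univ_mem
  have sd' : ContMDiff (𝓡 S.space.dim) (𝓡 n) ∞ d' := fun y =>
    (hr.smooth_div'.comp_within (A := univ) (f := fun _ => x₀) (g := id) contMDiffWithinAt_const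
      contMDiffWithinAt_id (mem_univ y) (.of_forall fun y => hm' x₀ y)).contMDiffAt univ_mem
  have sl : ContMDiff (𝓡 n) (𝓡 S.space.dim) ∞ (fun g : G => S.left.act g x₀) := fun g =>
    (S.left.smooth_act.comp_within (X := (toLieGroupoid (n := n) G).Arr) (A := univ) (f := id) (g := fun _ => x₀)
      contMDiffWithinAt_id
      contMDiffWithinAt_const (mem_univ g) (.of_forall fun g => hs g x₀)).contMDiffAt univ_mem
  have sr : ContMDiff (𝓡 n) (𝓡 S.space.dim) ∞ (fun g : G => S.right.act x₀ g) := fun g =>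
    (S.right.smooth_act.comp_within (X := (toLieGroupoid (n := n) G).Arr) (A := univ) (f := fun _ => x₀) (g := id)
      contMDiffWithinAt_const
      contMDiffWithinAt_id (mem_univ g) (.of_forall fun g => ht x₀ g)).contMDiffAt univ_mem
  let φ : MulAut G :=
    { toFun := fun h => d (S.right.act x₀ h)
      invFun := fun g => d' (S.left.act g x₀)
      left_inv := fun h => cr _ _ (by rw [hd', hd])
      right_inv := fun g => cl _ _ (by rw [hd, hd'])
      map_mul' := fun g h => cl _ _ (by rw [hd, hml, hmr, hd, ← hcomm, hd]) }
  have hφ : ∀ h : G, S.left.act (φ h) x₀ = S.right.act x₀ h := fun h => hd _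
  let f : Diffeomorph (𝓡 n) (𝓡 S.space.dim) G S.space ∞ :=
    { toFun := fun g => S.left.act g x₀
      invFun := d
      left_inv := fun g => cl _ _ (hd _)
      right_inv := hd
      contMDiff_toFun := sl
      contMDiff_invFun := sd }
  refine ⟨⟨φ, sd.comp sr, sd'.comp sl⟩, f, fun _ => Subsingleton.elim (α := point.{u}) _ _,
    fun _ => Subsingleton.elim (α := point.{u}) _ _, fun (g x : G) _ => hml g x x₀,
    fun (x h : G) _ => ?_⟩
  change S.left.act (x * φ h : G) x₀ = S.right.act (S.left.act x x₀) h
  rw [hml, hφ, hcomm]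

attribute [local instance] LieGroupoid.picardGroup

/-- The class of `G_φ` in the Picard group. -/
noncomputable def toPic : Aut (n := n) G →* (toLieGroupoid (n := n) G).Pic :=
  MonoidHom.mk' (fun φ => LieGroupoid.Pic.mk _ ⟨twist φ, twist_isBiprincipal φ⟩) fun φ ψ =>
    (((LieGroupoid.isPicardGroup_picardGroup _).mul_eq_iff _ _ _).2
      (twist_isTensorProduct φ ψ)).symm

theorem ker_toPic : (toPic (n := n) (G := G)).ker = Inn (n := n) G := by
  ext φ
  rw [MonoidHom.mem_ker, ← twist_isomorphic_unit_iff,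
    (LieGroupoid.isPicardGroup_picardGroup _).one_eq]
  exact Quotient.eq (r := LieGroupoid.moritaSetoid _)

theorem toPic_surjective : Function.Surjective (toPic (n := n) (G := G)) := by
  intro z
  obtain ⟨⟨S, hS⟩, rfl⟩ := Quotient.exists_rep z
  obtain ⟨φ, hφ⟩ := exists_twist_isomorphic S hS
  exact ⟨φ, Quotient.sound (s := LieGroupoid.moritaSetoid _) hφ⟩

/-- The Picard group of a Lie group is its group of outer automorphisms. -/
theorem nonempty_picardGroup_mulEquiv_out :
    Nonempty ((toLieGroupoid (n := n) G).Pic ≃* Out (n := n) G) :=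
  ⟨((QuotientGroup.quotientMulEquivOfEq ker_toPic.symm).trans
    (QuotientGroup.quotientKerEquivOfSurjective _ toPic_surjective)).symm⟩

end LieGroup

/-! ### Embedded submanifolds -/

/-- A map into a smoothly embedded manifold is smooth on a set if it is smooth as a map into the
ambient manifold. -/
theorem Manifold.IsSmoothEmbedding.contMDiffWithinAt_of_comp {k : ℕ} {X : Type*}
    [TopologicalSpace X] [ChartedSpace (EuclideanSpace ℝ (Fin k)) X] [IsManifold (𝓡 k) ∞ X]
    {M : SmoothMfd.{u}} {ι : X → M} (hι : Manifold.IsSmoothEmbedding (𝓡 k) (𝓡 M.dim) ∞ ι)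
    {𝕏 H Z : Type*} [NormedAddCommGroup 𝕏] [NormedSpace ℝ 𝕏] [TopologicalSpace H]
    {I : ModelWithCorners ℝ 𝕏 H} [TopologicalSpace Z] [ChartedSpace H Z] {φ : Z → X} {s : Set Z}
    {z : Z} (h : ContMDiffWithinAt I (𝓡 M.dim) ∞ (fun z => ι (φ z)) s z) :
    ContMDiffWithinAt I (𝓡 k) ∞ φ s z := by
  have hc : ContinuousWithinAt φ s z :=
    hι.isEmbedding.isInducing.continuousWithinAt_iff.2 h.continuousWithinAt
  have hx := hι.isImmersion.isImmersionAt (φ z)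
  have hd := contMDiffOn_symm_of_mem_maximalAtlas hx.domChart_mem_maximalAtlas
  have hcod := contMDiffOn_of_mem_maximalAtlas hx.codChart_mem_maximalAtlas
  have hsrc : ∀ y ∈ hx.domChart.source, ι y ∈ hx.codChart.source := fun y hy =>
    hx.source_subset_preimage_source hy
  have heq : ∀ y ∈ hx.domChart.source,
      (hx.equiv.symm (hx.codChart (ι y))).1 = hx.domChart y := by
    intro y hy
    have hy' : hx.domChart y ∈ (hx.domChart.extend (𝓡 k)).target := by
      simpa using hx.domChart.map_source hy
    have := hx.writtenInCharts hy'
    simp only [Function.comp_apply, OpenPartialHomeomorph.extend_coe,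
      OpenPartialHomeomorph.extend_coe_symm, modelWithCornersSelf_coe,
      modelWithCornersSelf_coe_symm, id_eq, hx.domChart.left_inv hy] at this
    rw [this, ContinuousLinearEquiv.symm_apply_apply]
  have hL : ContMDiff (𝓡 M.dim) (𝓡 k) ∞
      (fun v : EuclideanSpace ℝ (Fin M.dim) => (hx.equiv.symm v).1) :=
    (contDiff_fst.comp hx.equiv.symm.contDiff).contMDiff
  have h1 : ContMDiffWithinAt I (𝓡 M.dim) ∞ (fun z => hx.codChart (ι (φ z))) s z :=
    ContMDiffAt.comp_contMDiffWithinAt z (g := hx.codChart) (f := fun z => ι (φ z))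
      (hcod.contMDiffAt (hx.codChart.open_source.mem_nhds (hsrc _ hx.mem_domChart_source))) h
  have h2 : ContMDiffWithinAt I (𝓡 k) ∞
      (fun z => (hx.equiv.symm (hx.codChart (ι (φ z)))).1) s z :=
    ContMDiffAt.comp_contMDiffWithinAt z (g := fun v => (hx.equiv.symm v).1) (hL _) h1
  have h3 : ContMDiffWithinAt I (𝓡 k) ∞
      (fun z => hx.domChart.symm (hx.equiv.symm (hx.codChart (ι (φ z)))).1) s z := by
    refine ContMDiffAt.comp_contMDiffWithinAt z (g := hx.domChart.symm) ?_ h2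
    rw [heq _ hx.mem_domChart_source]
    exact hd.contMDiffAt
      (hx.domChart.open_target.mem_nhds (hx.domChart.map_source hx.mem_domChart_source))
  refine h3.congr_of_eventuallyEq ?_ ?_
  · filter_upwards [hc (hx.domChart.open_source.mem_nhds hx.mem_domChart_source)] with w hw
    rw [heq _ hw, hx.domChart.left_inv hw]
  · rw [heq _ hx.mem_domChart_source, hx.domChart.left_inv hx.mem_domChart_source]

/-- A subspace of a manifold `M` is an embedded submanifold if it is near each of its points the
zero set of a smooth map to `V` that has a smooth local section through the point. -/
theorem SmoothMfd.exists_isSmoothEmbedding {M : SmoothMfd.{u}} {X : Type*} [TopologicalSpace X]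
    [Nonempty X] {ι : X → M} (hι : Topology.IsEmbedding ι) {V : Type*} [NormedAddCommGroup V]
    [NormedSpace ℝ V] [FiniteDimensional ℝ V]
    (h : ∀ x, ∃ U : Set M, IsOpen U ∧ ι x ∈ U ∧ ∃ f : M → V,
      ContMDiffOn (𝓡 M.dim) 𝓘(ℝ, V) ∞ f U ∧ (∀ y ∈ U, y ∈ range ι ↔ f y = 0) ∧
      ∃ σ : V → M, ContMDiffAt 𝓘(ℝ, V) (𝓡 M.dim) ∞ σ 0 ∧ σ 0 = ι x ∧ ∀ᶠ v in 𝓝 0, f (σ v) = v) :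
    ∃ (k : ℕ) (_ : ChartedSpace (EuclideanSpace ℝ (Fin k)) X), IsManifold (𝓡 k) ∞ X ∧
      Manifold.IsSmoothEmbedding (𝓡 k) (𝓡 M.dim) ∞ ι := by
  let k := M.dim - Module.finrank ℝ V
  -- `X` is the quotient of `range ι` through a left inverse `q` of `ι`, whose fibres are points.
  let q : M → X := Function.invFun ι
  have hqι : ∀ x, q (ι x) = x := Function.leftInverse_invFun hι.injective
  have hιq : ∀ y ∈ range ι, ι (q y) = y := by
    rintro _ ⟨x, rfl⟩
    rw [hqι]
  have hq : ContinuousOn q (range ι) := by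
    rw [hι.isInducing.continuousOn_iff]
    exact continuousOn_id.congr hιq
  have hopen : ∀ O : Set X, (∃ U, IsOpen U ∧ range ι ∩ q ⁻¹' O = range ι ∩ U) → IsOpen O := by
    rintro O ⟨U, hU, hOU⟩
    convert hU.preimage hι.continuous using 1
    ext x
    have : ι x ∈ range ι ∩ q ⁻¹' O ↔ ι x ∈ range ι ∩ U := by rw [hOU]
    simpa [hqι] using this
  have key : ∀ x, ∃ L : EuclideanSpace ℝ (Fin M.dim) ≃L[ℝ] V × EuclideanSpace ℝ (Fin k),
      ∃ c ∈ IsManifold.maximalAtlas (𝓡 M.dim) ∞ M, ι x ∈ c.source ∧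
      (∀ y ∈ c.source, y ∈ range ι ↔ (L (c y)).1 = 0) ∧
      ∃ e : OpenPartialHomeomorph X (EuclideanSpace ℝ (Fin k)), x ∈ e.source ∧
        IsLiftedChart (𝓡 M.dim) q (range ι) e (fun w => c.symm (L.symm (0, w))) ∧
        ∀ w ∈ e.target, L.symm (0, w) ∈ c.target := by
    intro x
    obtain ⟨U, hU, hxU, f, hf, hfU, σ, hσ, hσx, hfσ⟩ := h x
    have hfx : f (ι x) = 0 := (hfU _ hxU).1 ⟨x, rfl⟩
    obtain ⟨hle, H⟩ := exists_straightening_chart hU hxU hf (σ := σ) (by rwa [hfx])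
      (by rwa [hfx]) (by rwa [hfx])
    obtain ⟨L, c, hc, hxc, hcU, hL⟩ := H k (by omega)
    have hc1 := contMDiffOn_of_mem_maximalAtlas hc
    have hc2 := contMDiffOn_symm_of_mem_maximalAtlas hc
    have hr : ∀ y ∈ c.source, y ∈ range ι ↔ (L (c y)).1 = 0 := fun y hy => by
      rw [hL y hy, hfU y (hcU hy)]
    let φ : EuclideanSpace ℝ (Fin k) → M := fun w => c.symm (L.symm (0, w))
    let ψ : M → EuclideanSpace ℝ (Fin k) := fun y => (L (c y)).2
    have hL0 : ContDiff ℝ ∞ fun w : EuclideanSpace ℝ (Fin k) => L.symm ((0 : V), w) :=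
      L.symm.contDiff.comp (contDiff_const.prodMk contDiff_id)
    have hφr : ∀ w, L.symm (0, w) ∈ c.target → φ w ∈ range ι := fun w hw => by
      rw [hr _ (c.map_target hw), c.right_inv hw, L.apply_symm_apply]
    have hψ : ∀ y ∈ range ι ∩ c.source, L.symm (0, ψ y) = c y := by
      rintro y ⟨hy, hyc⟩
      rw [L.symm_apply_eq, ← (hr y hyc).1 hy]
    have hinj : ∀ a ∈ range ι, ∀ b ∈ range ι, q a = q b → a = b := fun a ha b hb hab => by
      rw [← hιq a ha, hab, hιq b hb]
    have hs : IsLocalSlice (𝓡 M.dim) q (range ι) (range ι ∩ c.source)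
        {w | L.symm (0, w) ∈ c.target} ψ φ :=
      { subset := inter_subset_left
        isOpen := ⟨_, c.open_source, rfl⟩
        isOpen' := c.open_target.preimage hL0.continuous
        saturated := fun a ha b hb hab => by rwa [hinj a ha b hb.1 hab]
        invariant := fun a ha b hb hab => by rw [hinj a ha.1 b hb.1 hab]
        smooth := (contDiff_snd.comp L.contDiff).contMDiff.comp_contMDiffOn
          (hc1.mono inter_subset_right)
        smooth' := hc2.comp hL0.contMDiff.contMDiffOn fun w hw => hw
        mapsTo := fun y hy => by
          change L.symm (0, ψ y) ∈ c.target
          rw [hψ y hy]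
          exact c.map_source hy.2
        mapsTo' := fun w hw => ⟨hφr w hw, c.map_target hw⟩
        right_inv := fun w hw => by
          change (L (c (c.symm _))).2 = w
          rw [c.right_inv hw, L.apply_symm_apply]
        left_inv := fun y hy => by
          change q (c.symm (L.symm (0, ψ y))) = _
          rw [hψ y hy, c.left_inv hy.2] }
    obtain ⟨e, he, hes, het, -⟩ := hs.exists_liftedChart hq hopen
    refine ⟨L, c, hc, hxc, hr, e, ?_, he, fun w hw => ?_⟩
    · rw [hes]
      exact ⟨ι x, ⟨⟨x, rfl⟩, hxc⟩, hqι x⟩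
    · rw [het] at hw
      exact hw
  obtain ⟨C, hC, hqs, hchart⟩ := exists_manifold_of_liftedCharts (I := 𝓡 M.dim) (d := k) hq
    (fun x => ⟨ι x, ⟨x, rfl⟩, hqι x⟩) (by
      rintro _ ⟨x, rfl⟩
      obtain ⟨L, c, -, -, -, e, hxe, he, -⟩ := key x
      exact ⟨e, _, he, by rwa [hqι]⟩)
  refine ⟨k, C, hC, Manifold.IsImmersionOfComplement.isImmersion (F := V) fun x => ?_, hι⟩
  obtain ⟨L, c, hc, hxc, hr, e, hxe, he, het⟩ := key x
  have hιe : ∀ w ∈ e.target, ι (e.symm w) = c.symm (L.symm (0, w)) := fun w hw => by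
    rw [← he.apply_lift w hw, hιq _ (he.lift_mem w hw)]
  refine Manifold.IsImmersionAtOfComplement.mk_of_charts
    ((ContinuousLinearEquiv.prodComm ℝ _ _).trans L.symm) e c hxe hxc (hchart e _ he).1 hc ?_ ?_
  · intro y hy
    have := hιe _ (e.map_source hy)
    rw [e.left_inv hy] at this
    rw [mem_preimage, this]
    exact c.map_target (het _ (e.map_source hy))
  · intro w hw
    have hw' : w ∈ e.target := by simpa using hw
    simp [hιe w hw', c.right_inv (het w hw')]

/-! ### Smooth maps without submersive points -/

/-- A smooth map either has surjective derivative at some point, or it maps some nonempty open set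
into a compact set with dense complement: near a point where the rank of the derivative is maximal,
the image is the image of a ball in a space whose dimension is that rank. -/
theorem ContDiffOn.exists_surjective_fderiv_or_image_subset {E V : Type*} [NormedAddCommGroup E]
    [NormedSpace ℝ E] [FiniteDimensional ℝ E] [NormedAddCommGroup V] [NormedSpace ℝ V]
    [FiniteDimensional ℝ V] {g : E → V} {U : Set E} (hU : IsOpen U) (hne : U.Nonempty)
    (hg : ContDiffOn ℝ ∞ g U) :
    (∃ a ∈ U, Function.Surjective (fderiv ℝ g a)) ∨
      ∃ N ⊆ U, IsOpen N ∧ N.Nonempty ∧ ∃ K, IsCompact K ∧ Dense Kᶜ ∧ MapsTo g N K := by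
  by_cases hsurj : ∃ a ∈ U, Function.Surjective (fderiv ℝ g a)
  · exact .inl hsurj
  right
  push Not at hsurj
  let r : E → ℕ := fun a => Module.finrank ℝ (fderiv ℝ g a).range
  obtain ⟨a, haU, ha⟩ : ∃ a ∈ U, ∀ b ∈ U, r b ≤ r a := by
    have hb : BddAbove (r '' U) := ⟨Module.finrank ℝ V, by
      rintro _ ⟨b, -, rfl⟩
      exact Submodule.finrank_le _⟩
    obtain ⟨a, ha, ha'⟩ := Nat.sSup_mem (hne.image r) hb
    exact ⟨a, ha, fun b hbU => by rw [ha']; exact le_csSup hb ⟨b, hbU, rfl⟩⟩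
  -- The composite of `g` with a projection onto the range of its derivative at `a` is a submersion
  -- near `a`, so it is a projection in suitable coordinates.
  set R := (fderiv ℝ g a).range with hR
  have hlt : Module.finrank ℝ R < Module.finrank ℝ V := by
    refine Submodule.finrank_lt fun h => hsurj a haU ?_
    exact LinearMap.range_eq_top.1 h
  obtain ⟨π₀, hπ₀⟩ := R.subtype.exists_leftInverse_of_injective R.ker_subtype
  let π : V →L[ℝ] R := LinearMap.toContinuousLinearMap π₀
  have hπ : ∀ u : R, π u = u := fun u => LinearMap.congr_fun hπ₀ u
  have hπg : ContDiffOn ℝ ∞ (π ∘ g) U := π.contDiff.comp_contDiffOn hg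
  have hgd : ∀ b ∈ U, HasFDerivAt g (fderiv ℝ g b) b := fun b hb =>
    ((hg.contDiffAt (hU.mem_nhds hb)).differentiableAt (by simp)).hasFDerivAt
  have hD : fderiv ℝ (π ∘ g) a = π.comp (fderiv ℝ g a) :=
    (π.hasFDerivAt.comp a (hgd a haU)).fderiv
  have hDs : Function.Surjective (fderiv ℝ (π ∘ g) a) := by
    rw [hD]
    rintro ⟨u, v, rfl⟩
    exact ⟨v, hπ ⟨_, v, rfl⟩⟩
  have hle : Module.finrank ℝ R ≤ Module.finrank ℝ E :=
    LinearMap.finrank_range_le (fderiv ℝ g a).toLinearMap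
  obtain ⟨e, hae, heU, he1, he2, he⟩ := hπg.exists_straightening hU haU hDs
    (k := Module.finrank ℝ E - Module.finrank ℝ R) (by omega)
  let h : R × EuclideanSpace ℝ (Fin (Module.finrank ℝ E - Module.finrank ℝ R)) → V := g ∘ e.symm
  have hh : ContDiffOn ℝ ∞ h e.target := hg.comp he2 fun z hz => heU (e.map_target hz)
  have hπh : ∀ z ∈ e.target, π (h z) = z.1 := fun z hz => by
    have := he _ (e.map_target hz)
    rw [e.right_inv hz] at this
    exact this.symm
  -- The derivative of `h` has rank at most `finrank R`, and it is a section of `π` in the first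
  -- variable. So it vanishes in the direction of the second variable.
  have hzero : ∀ z ∈ e.target, ∀ w, fderiv ℝ h z (0, w) = 0 := by
    intro z hz w
    have hhz : HasFDerivAt h (fderiv ℝ h z) z :=
      ((hh.contDiffAt (e.open_target.mem_nhds hz)).differentiableAt (by simp)).hasFDerivAt
    have h1 : ∀ x, π (fderiv ℝ h z x) = x.1 := by
      have := (π.hasFDerivAt.comp z hhz).unique
        ((hasFDerivAt_fst (𝕜 := ℝ) (p := z)).congr_of_eventuallyEq (by
          filter_upwards [e.open_target.mem_nhds hz] with y hy using hπh y hy))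
      exact fun x => DFunLike.congr_fun this x
    have h2 : fderiv ℝ h z = (fderiv ℝ g (e.symm z)).comp (fderiv ℝ e.symm z) :=
      ((hgd _ (heU (e.map_target hz))).comp z
        ((he2.contDiffAt (e.open_target.mem_nhds hz)).differentiableAt
          (by simp)).hasFDerivAt).fderiv
    let T := (fderiv ℝ g (e.symm z)).range
    let πT : T →ₗ[ℝ] R := π.toLinearMap ∘ₗ T.subtype
    have hmem : ∀ x, fderiv ℝ h z x ∈ T := fun x => by
      rw [h2]
      exact ⟨_, rfl⟩
    have hs : Function.Surjective πT := fun u => ⟨⟨_, hmem (u, 0)⟩, h1 (u, 0)⟩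
    have hfin : Module.finrank ℝ T = Module.finrank ℝ R :=
      le_antisymm (ha _ (heU (e.map_target hz))) (πT.finrank_le_finrank_of_surjective hs)
    have hi := (LinearMap.injective_iff_surjective_of_finrank_eq_finrank hfin).2 hs
    have : (⟨_, hmem (0, w)⟩ : T) = 0 := hi (by rw [map_zero]; exact h1 (0, w))
    exact congrArg Subtype.val this
  obtain ⟨ε, hε, hball⟩ := Metric.isOpen_iff.1 e.open_target _ (e.map_source hae)
  set u₀ := (e a).1
  set w₀ := (e a).2
  have hsub : ∀ u ∈ Metric.closedBall u₀ (ε / 2), ∀ w ∈ Metric.ball w₀ ε, (u, w) ∈ e.target := by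
    intro u hu w hw
    refine hball ?_
    rw [Metric.mem_ball, Prod.dist_eq, max_lt_iff]
    exact ⟨lt_of_le_of_lt (Metric.mem_closedBall.1 hu) (half_lt_self hε), hw⟩
  have hw₀ : w₀ ∈ Metric.ball w₀ ε := Metric.mem_ball_self hε
  have hconst : ∀ u ∈ Metric.closedBall u₀ (ε / 2), ∀ w ∈ Metric.ball w₀ ε,
      h (u, w) = h (u, w₀) := by
    intro u hu w hw
    have hd : ∀ w ∈ Metric.ball w₀ ε, HasFDerivAt (fun w => h (u, w))
        (0 : EuclideanSpace ℝ (Fin (Module.finrank ℝ E - Module.finrank ℝ R)) →L[ℝ] V) w := by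
      intro w hw
      have h1 : HasFDerivAt h (fderiv ℝ h (u, w)) (u, w) :=
        ((hh.contDiffAt (e.open_target.mem_nhds (hsub u hu w hw))).differentiableAt
          (by simp)).hasFDerivAt
      have h2 := h1.comp w (hasFDerivAt_prodMk_right (𝕜 := ℝ) u w)
      refine h2.congr_fderiv ?_
      ext x
      exact hzero _ (hsub u hu w hw) x
    exact Metric.isOpen_ball.is_const_of_fderiv_eq_zero (Metric.isPreconnected_ball)
      (fun w hw => (hd w hw).differentiableAt.differentiableWithinAt)
      (fun w hw => (hd w hw).fderiv) hw hw₀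
  have hcd : ContDiffOn ℝ ∞ (fun u => h (u, w₀)) (Metric.closedBall u₀ (ε / 2)) :=
    hh.comp (contDiff_id.prodMk contDiff_const).contDiffOn fun u hu => hsub u hu w₀ hw₀
  refine ⟨e.source ∩ e ⁻¹' (Metric.ball u₀ (ε / 2) ×ˢ Metric.ball w₀ ε),
    inter_subset_left.trans heU, e.isOpen_inter_preimage (Metric.isOpen_ball.prod Metric.isOpen_ball),
    ⟨a, hae, Metric.mem_ball_self (half_pos hε), hw₀⟩,
    (fun u => h (u, w₀)) '' Metric.closedBall u₀ (ε / 2),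
    (isCompact_closedBall _ _).image_of_continuousOn hcd.continuousOn, ?_, ?_⟩
  · refine (hcd.of_le (by simp)).dense_compl_image_of_dimH_lt_finrank (convex_closedBall _ _)
      subset_rfl ?_
    refine (dimH_mono (subset_univ _)).trans_lt ?_
    rw [Real.dimH_univ_eq_finrank]
    exact_mod_cast hlt
  · rintro y ⟨hy, hyu, hyw⟩
    refine ⟨(e y).1, Metric.ball_subset_closedBall hyu, ?_⟩
    change h ((e y).1, w₀) = _
    rw [← hconst _ (Metric.ball_subset_closedBall hyu) _ hyw]
    exact congrArg g (e.left_inv hy)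

namespace SmoothMfd

/-- `A` is nowhere dense: every nonempty open set contains a nonempty open set that is disjoint
from `A`. Unlike the condition on the closure of `A`, this form can be moved along open maps. -/
def AvoidsOpens {X : Type*} [TopologicalSpace X] (A : Set X) : Prop :=
  ∀ O : Set X, IsOpen O → O.Nonempty → ∃ O' ⊆ O, IsOpen O' ∧ O'.Nonempty ∧ Disjoint O' A

variable {M N : SmoothMfd.{u}}

/-- A smooth map either has a smooth local section through some point, or it maps some nonempty
open set onto a nowhere dense set. -/
theorem exists_section_or_avoidsOpens [Nonempty M] {f : M → N} (hf : Smooth f) :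
    (∃ x, ∃ σ : N → M, σ (f x) = x ∧
      ∀ᶠ y in 𝓝 (f x), ContMDiffAt (𝓡 N.dim) (𝓡 M.dim) ∞ σ y ∧ f (σ y) = y) ∨
    ∃ O : Set M, IsOpen O ∧ O.Nonempty ∧ AvoidsOpens (f '' O) := by
  let x₀ : M := Classical.arbitrary M
  set c := chartAt (EuclideanSpace ℝ (Fin M.dim)) x₀ with hc
  set d := chartAt (EuclideanSpace ℝ (Fin N.dim)) (f x₀) with hd
  have hcx : x₀ ∈ c.source := mem_chart_source _ x₀
  have hdx : f x₀ ∈ d.source := mem_chart_source _ (f x₀)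
  have hcm : c ∈ IsManifold.maximalAtlas (𝓡 M.dim) ∞ M := IsManifold.chart_mem_maximalAtlas x₀
  have hdm : d ∈ IsManifold.maximalAtlas (𝓡 N.dim) ∞ N := IsManifold.chart_mem_maximalAtlas _
  have hc1 := contMDiffOn_of_mem_maximalAtlas hcm
  have hc2 := contMDiffOn_symm_of_mem_maximalAtlas hcm
  have hd1 := contMDiffOn_of_mem_maximalAtlas hdm
  have hd2 := contMDiffOn_symm_of_mem_maximalAtlas hdm
  set U := c.target ∩ c.symm ⁻¹' (f ⁻¹' d.source) with hUdef
  have hU : IsOpen U := c.isOpen_inter_preimage_symm (d.open_source.preimage hf.continuous)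
  have hne : U.Nonempty := ⟨c x₀, c.map_source hcx, by simpa [c.left_inv hcx] using hdx⟩
  let g : EuclideanSpace ℝ (Fin M.dim) → EuclideanSpace ℝ (Fin N.dim) := d ∘ f ∘ c.symm
  have hg : ContDiffOn ℝ ∞ g U :=
    (hd1.comp (hf.comp_contMDiffOn (hc2.mono inter_subset_left)) fun y hy => hy.2).contDiffOn
  rcases hg.exists_surjective_fderiv_or_image_subset hU hne with ⟨a, haU, ha⟩ | H
  · left
    have hle := LinearMap.finrank_le_finrank_of_surjective (f := (fderiv ℝ g a).toLinearMap) ha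
    obtain ⟨e, hae, heU, he1, he2, he⟩ := hg.exists_straightening hU haU ha
      (k := M.dim - N.dim) (by simp at hle ⊢; omega)
    have hfa : f (c.symm a) ∈ d.source := haU.2
    have hga : (e a).1 = d (f (c.symm a)) := he a hae
    let τ : N → EuclideanSpace ℝ (Fin N.dim) × EuclideanSpace ℝ (Fin (M.dim - N.dim)) :=
      fun y => (d y, (e a).2)
    have hτ : ContMDiffOn (𝓡 N.dim) 𝓘(ℝ, EuclideanSpace ℝ (Fin N.dim) ×
        EuclideanSpace ℝ (Fin (M.dim - N.dim))) ∞ τ d.source :=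
      hd1.prodMk_space contMDiffOn_const
    have hτa : τ (f (c.symm a)) = e a := by
      simp only [τ, ← hga]
    set W := d.source ∩ τ ⁻¹' e.target with hW
    have hWo : IsOpen W := hτ.continuousOn.isOpen_inter_preimage d.open_source e.open_target
    refine ⟨c.symm a, fun y => c.symm (e.symm (τ y)), ?_, ?_⟩
    · simp only [hτa, e.left_inv hae]
    · have haW : f (c.symm a) ∈ W := ⟨hfa, by
        rw [mem_preimage, hτa]
        exact e.map_source hae⟩
      filter_upwards [hWo.mem_nhds haW] with y hy
      constructor
      · refine ContMDiffOn.contMDiffAt (s := W) ?_ (hWo.mem_nhds hy)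
        exact hc2.comp (he2.contMDiffOn.comp (hτ.mono inter_subset_left) fun y hy => hy.2)
          fun y hy => (heU (e.map_target hy.2)).1
      · have h1 := e.map_target hy.2
        refine d.injOn (heU h1).2 hy.1 ?_
        change g _ = _
        rw [← he _ h1, e.right_inv hy.2]
  · right
    obtain ⟨O, hOU, hO, ⟨z, hz⟩, K, hK, hKd, hOK⟩ := H
    have hmem : ∀ y ∈ c.source ∩ c ⁻¹' O, f y ∈ d.source ∧ d (f y) ∈ K := by
      rintro y ⟨hy, hyO⟩
      have h1 := (hOU hyO).2
      have h2 := hOK hyO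
      simp only [g, mem_preimage, Function.comp_apply, c.left_inv hy] at h1 h2
      exact ⟨h1, h2⟩
    refine ⟨c.source ∩ c ⁻¹' O, c.isOpen_inter_preimage hO,
      ⟨c.symm z, c.map_target (hOU hz).1, by simpa [c.right_inv (hOU hz).1] using hz⟩, ?_⟩
    intro A hA hAne
    by_cases hAd : (d.source ∩ A).Nonempty
    · refine ⟨A ∩ (d.source ∩ d ⁻¹' Kᶜ), inter_subset_left,
        hA.inter (d.isOpen_inter_preimage hK.isClosed.isOpen_compl), ?_, ?_⟩
      · have h1 : IsOpen (d '' (d.source ∩ A)) :=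
          d.isOpen_image_of_subset_source (d.open_source.inter hA) inter_subset_left
        obtain ⟨_, ⟨y, hy, rfl⟩, hyK⟩ := hKd.inter_open_nonempty _ h1 (hAd.image d)
        exact ⟨y, hy.2, hy.1, hyK⟩
      · rw [Set.disjoint_left]
        rintro _ hy ⟨y, hyO, rfl⟩
        exact hy.2.2 (hmem y hyO).2
    · refine ⟨A, subset_rfl, hA, hAne, ?_⟩
      rw [Set.disjoint_left]
      rintro _ hy ⟨y, hyO, rfl⟩
      exact hAd ⟨_, (hmem y hyO).1, hy⟩

/-- A nonempty manifold is not a countable union of nowhere dense sets. -/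
theorem not_subset_iUnion_avoidsOpens (x : N) {ι : Type*} [Countable ι] {A : ι → Set N}
    (hA : ∀ i, AvoidsOpens (A i)) : ¬ ∀ y : N, ∃ i, y ∈ A i := by
  intro hcov
  set d := chartAt (EuclideanSpace ℝ (Fin N.dim)) x with hd
  let B : ι → Set (EuclideanSpace ℝ (Fin N.dim)) := fun i => d.target ∩ d.symm ⁻¹' A i
  have hdense : ∀ i, Dense (closure (B i))ᶜ := by
    intro i
    rw [dense_iff_inter_open]
    intro O hO hOne
    by_cases hOd : (d.target ∩ O).Nonempty
    · have h1 : IsOpen (d.symm '' (d.target ∩ O)) :=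
        d.symm.isOpen_image_of_subset_source (d.open_target.inter hO) inter_subset_left
      obtain ⟨O', hO', hO'o, ⟨y, hy⟩, hdis⟩ := hA i _ h1 (hOd.image _)
      obtain ⟨v, hv, rfl⟩ := hO' hy
      refine ⟨v, hv.2, fun hcl => ?_⟩
      have h2 : IsOpen (d.target ∩ d.symm ⁻¹' O') := d.isOpen_inter_preimage_symm hO'o
      obtain ⟨w, hw, hwB⟩ := mem_closure_iff.1 hcl _ h2 ⟨hv.1, hy⟩
      exact Set.disjoint_left.1 hdis hw.2 hwB.2
    · obtain ⟨v, hv⟩ := hOne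
      refine ⟨v, hv, fun hcl => ?_⟩
      obtain ⟨w, hw, hwB⟩ := mem_closure_iff.1 hcl O hO hv
      exact hOd ⟨w, hwB.1, hw⟩
  have := dense_iInter_of_isOpen (fun i => isClosed_closure.isOpen_compl) hdense
  obtain ⟨v, hv, hvB⟩ := this.inter_open_nonempty _ d.open_target
    ⟨d x, d.map_source (mem_chart_source _ x)⟩
  obtain ⟨i, hi⟩ := hcov (d.symm v)
  exact mem_iInter.1 hvB i (subset_closure ⟨hv, hi⟩)

end SmoothMfd

/-! ### Transitive Lie groupoids -/

theorem SmoothMfd.SurjSubmersion.isOpenMap {M N : SmoothMfd.{u}} {f : M → N}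
    (h : SurjSubmersion f) : IsOpenMap f := by
  intro U hU
  rw [isOpen_iff_mem_nhds]
  rintro _ ⟨x, hx, rfl⟩
  obtain ⟨σ, hσ₀, hσ⟩ := h.exists_section x
  have h1 : ∀ᶠ y in 𝓝 (f x), σ y ∈ U :=
    hσ.self_of_nhds.1.continuousAt (by rw [hσ₀]; exact hU.mem_nhds hx)
  filter_upwards [h1, hσ] with y hy hy'
  exact ⟨σ y, hy, hy'.2⟩

/-- The inverse of the chart at `x`, translated so that it maps `0` to `x`. -/
theorem SmoothMfd.chartAt_symm_add_contMDiffAt {N : SmoothMfd.{u}} (x : N) :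
    ContMDiffAt (𝓡 N.dim) (𝓡 N.dim) ∞ (fun v : EuclideanSpace ℝ (Fin N.dim) =>
      (chartAt (EuclideanSpace ℝ (Fin N.dim)) x).symm
        (v + chartAt (EuclideanSpace ℝ (Fin N.dim)) x x)) 0 := by
  set d := chartAt (EuclideanSpace ℝ (Fin N.dim)) x
  have hd : ContMDiffAt (𝓡 N.dim) (𝓡 N.dim) ∞ d.symm (0 + d x) := by
    rw [zero_add]
    exact (contMDiffOn_symm_of_mem_maximalAtlas
      (IsManifold.chart_mem_maximalAtlas (I := 𝓡 N.dim) (n := ∞) x)).contMDiffAt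
      (d.open_target.mem_nhds (d.map_source (mem_chart_source _ x)))
  exact hd.comp (0 : EuclideanSpace ℝ (Fin N.dim))
    (contDiff_id.add contDiff_const).contMDiff.contMDiffAt

theorem SmoothMfd.eventually_chartAt_symm_add {N : SmoothMfd.{u}} (x : N) :
    ∀ᶠ v in 𝓝 (0 : EuclideanSpace ℝ (Fin N.dim)), chartAt (EuclideanSpace ℝ (Fin N.dim)) x
      ((chartAt (EuclideanSpace ℝ (Fin N.dim)) x).symm
        (v + chartAt (EuclideanSpace ℝ (Fin N.dim)) x x)) -
          chartAt (EuclideanSpace ℝ (Fin N.dim)) x x = v := by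
  set d := chartAt (EuclideanSpace ℝ (Fin N.dim)) x
  have hc : ContinuousAt (fun v : EuclideanSpace ℝ (Fin N.dim) => v + d x) 0 := by fun_prop
  have := hc.eventually (p := fun v => v ∈ d.target)
    (d.open_target.mem_nhds (by
      simp only [zero_add]
      exact d.map_source (mem_chart_source _ x)))
  filter_upwards [this] with v hv
  rw [d.right_inv hv, add_sub_cancel_right]

namespace LieGroupoid

variable {P : SmoothMfd.{u}} {Γ : LieGroupoid P} {x : P} {F : SmoothMfd.{u}} {ι : F → Γ.Arr}
  {ρ : Γ.Arr → F}

/-- `ι` identifies the manifold `F` with the embedded submanifold of arrows with source `x`, and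
`ρ` is a left inverse of `ι`, whose values on other arrows are irrelevant. -/
structure IsSrcFibre (Γ : LieGroupoid P) (x : P) (ι : F → Γ.Arr) (ρ : Γ.Arr → F) : Prop where
  isSmoothEmbedding : Manifold.IsSmoothEmbedding (𝓡 F.dim) (𝓡 Γ.Arr.dim) ∞ ι
  src_apply : ∀ y, Γ.src (ι y) = x
  apply_lift : ∀ g, Γ.src g = x → ι (ρ g) = g

variable (Γ x) in
/-- The source fibres of a Lie groupoid are embedded submanifolds. -/
theorem exists_isSrcFibre : ∃ (F : SmoothMfd.{u}) (ι : F → Γ.Arr) (ρ : Γ.Arr → F),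
    Γ.IsSrcFibre x ι ρ := by
  classical
  let X := {g : Γ.Arr // Γ.src g = x}
  have : Nonempty X := ⟨⟨Γ.unit x, Γ.src_unit x⟩⟩
  set d := chartAt (EuclideanSpace ℝ (Fin P.dim)) x
  have hd1 := contMDiffOn_of_mem_maximalAtlas
    (IsManifold.chart_mem_maximalAtlas (I := 𝓡 P.dim) (n := ∞) x)
  have hdx : x ∈ d.source := mem_chart_source _ x
  obtain ⟨k, C, hC, hι⟩ := SmoothMfd.exists_isSmoothEmbedding
    (V := EuclideanSpace ℝ (Fin P.dim)) (ι := (Subtype.val : X → Γ.Arr)) .subtypeVal (by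
      intro g
      obtain ⟨σ, hσ₀, hσ⟩ := Γ.src_submersion.exists_section g.1
      rw [g.2] at hσ₀ hσ
      have hx : d.symm (0 + d x) = x := by rw [zero_add, d.left_inv hdx]
      have hs := chartAt_symm_add_contMDiffAt x
      refine ⟨Γ.src ⁻¹' d.source, d.open_source.preimage Γ.src_submersion.smooth.continuous,
        by rwa [mem_preimage, g.2], fun h => d (Γ.src h) - d x, ?_, fun h hh => ?_,
        fun v => σ (d.symm (v + d x)), ?_, by simp only [hx, hσ₀], ?_⟩
      · exact ((hd1.comp Γ.src_submersion.smooth.contMDiffOn fun h hh => hh).sub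
          contMDiffOn_const)
      · constructor
        · rintro ⟨g, rfl⟩
          exact sub_eq_zero.2 (congrArg d g.2)
        · exact fun e => ⟨⟨h, d.injOn hh hdx (sub_eq_zero.1 e)⟩, rfl⟩
      · refine ContMDiffAt.comp (g := σ) (0 : EuclideanSpace ℝ (Fin P.dim)) ?_ hs
        rw [hx]
        exact hσ.self_of_nhds.1
      · have h1 := hs.continuousAt.eventually (p := fun y => Γ.src (σ y) = y) (by
          change ∀ᶠ y in 𝓝 (d.symm (0 + d x)), _
          rw [hx]
          exact hσ.mono fun y hy => hy.2)
        filter_upwards [h1, eventually_chartAt_symm_add x] with v hv hv'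
        rw [hv]
        exact hv')
  exact ⟨{ carrier := X, dim := k }, Subtype.val, Function.invFun Subtype.val, hι, fun g => g.2,
    fun g hg => Function.invFun_eq ⟨⟨g, hg⟩, rfl⟩⟩

namespace IsSrcFibre

theorem apply_injective (h : Γ.IsSrcFibre x ι ρ) : Function.Injective ι :=
  h.isSmoothEmbedding.isEmbedding.injective

theorem smooth (h : Γ.IsSrcFibre x ι ρ) : Smooth ι := h.isSmoothEmbedding.contMDiff

theorem lift_apply (h : Γ.IsSrcFibre x ι ρ) (y : F) : ρ (ι y) = y :=
  h.apply_injective (h.apply_lift _ (h.src_apply y))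

theorem apply_lift_mul (h : Γ.IsSrcFibre x ι ρ) {g : Γ.Arr} {y : F}
    (e : Γ.src g = Γ.tgt (ι y)) : ι (ρ (Γ.mul g (ι y))) = Γ.mul g (ι y) :=
  h.apply_lift _ (by rw [Γ.src_mul _ _ e, h.src_apply])

theorem smooth_tgt (h : Γ.IsSrcFibre x ι ρ) : Smooth fun y => Γ.tgt (ι y) :=
  ContMDiff.comp Γ.tgt_submersion.smooth h.smooth

section Smooth

variable {𝕏 H Z : Type*} [NormedAddCommGroup 𝕏] [NormedSpace ℝ 𝕏] [TopologicalSpace H]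
  {I : ModelWithCorners ℝ 𝕏 H} [TopologicalSpace Z] [ChartedSpace H Z] {s : Set Z} {z : Z}

theorem smooth_lift (h : Γ.IsSrcFibre x ι ρ) {a : Z → Γ.Arr}
    (ha : ContMDiffWithinAt I (𝓡 Γ.Arr.dim) ∞ a s z) (hz : z ∈ s)
    (hs : ∀ᶠ w in 𝓝[s] z, Γ.src (a w) = x) :
    ContMDiffWithinAt I (𝓡 F.dim) ∞ (fun w => ρ (a w)) s z := by
  refine h.isSmoothEmbedding.contMDiffWithinAt_of_comp (ha.congr_of_eventuallyEq ?_ ?_)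
  · exact hs.mono fun w hw => h.apply_lift _ hw
  · exact h.apply_lift _ (hs.self_of_nhdsWithin hz)

theorem smooth_lift_mul (h : Γ.IsSrcFibre x ι ρ) {a : Z → Γ.Arr} {b : Z → F}
    (ha : ContMDiffWithinAt I (𝓡 Γ.Arr.dim) ∞ a s z) (hb : ContMDiffWithinAt I (𝓡 F.dim) ∞ b s z)
    (hz : z ∈ s) (hs : ∀ᶠ w in 𝓝[s] z, Γ.src (a w) = Γ.tgt (ι (b w))) :
    ContMDiffWithinAt I (𝓡 F.dim) ∞ (fun w => ρ (Γ.mul (a w) (ι (b w)))) s z :=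
  h.smooth_lift (Γ.smooth_mul.comp_within ha (h.smooth.comp_within hb) hz hs) hz
    (hs.mono fun w hw => by rw [Γ.src_mul _ _ hw, h.src_apply])

end Smooth

/-- If the target map sends some nonempty open set of the source fibre onto a nowhere dense set,
then it does so near every point: translation by arrows `k` near a given one moves a neighbourhood
of the point into that open set. -/
theorem exists_nhds_avoidsOpens (h : Γ.IsSrcFibre x ι ρ) {O : Set F} (hO : IsOpen O) {y₀ : F}
    (hy₀ : y₀ ∈ O) (hA : AvoidsOpens ((fun y => Γ.tgt (ι y)) '' O)) (y : F) :
    ∃ W ∈ 𝓝 y, AvoidsOpens ((fun y => Γ.tgt (ι y)) '' W) := by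
  have e₀ : Γ.src (ι y) = Γ.tgt (Γ.inv (ι y₀)) := by
    rw [Γ.tgt_inv, h.src_apply, h.src_apply]
  have e₁ : Γ.src (Γ.inv (ι y)) = Γ.tgt (ι y) := Γ.src_inv _
  set k := Γ.mul (ι y) (Γ.inv (ι y₀)) with hk
  have hkt : Γ.tgt k = Γ.tgt (ι y) := Γ.tgt_mul _ _ e₀
  let D : Set (Γ.Arr × F) := {z | Γ.tgt z.1 = Γ.tgt (ι z.2)}
  let m : Γ.Arr × F → F := fun z => ρ (Γ.mul (Γ.inv z.1) (ι z.2))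
  have hD : ∀ z ∈ D, Γ.src (Γ.inv z.1) = Γ.tgt (ι z.2) := fun z hz => (Γ.src_inv _).trans hz
  have hm : ContinuousWithinAt m D (k, y) :=
    (h.smooth_lift_mul (I := (𝓡 Γ.Arr.dim).prod (𝓡 F.dim))
      (Smooth.comp_within Γ.smooth_inv contMDiffWithinAt_fst) contMDiffWithinAt_snd hkt
      (eventually_mem_nhdsWithin.mono hD)).continuousWithinAt
  have hmk : m (k, y) = y₀ := by
    have : Γ.mul (Γ.inv k) (ι y) = ι y₀ := by
      rw [hk, Γ.mul_inv_rev e₀, Γ.inv_inv, Γ.mul_assoc _ _ _ (by rw [Γ.tgt_inv, h.src_apply,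
        h.src_apply]) e₁, Γ.inv_mul, h.src_apply, ← h.src_apply y₀, Γ.mul_unit]
    change ρ (Γ.mul (Γ.inv k) (ι y)) = y₀
    rw [this, h.lift_apply]
  have hmO : m ⁻¹' O ∈ 𝓝[D] (k, y) := hm (by rw [hmk]; exact hO.mem_nhds hy₀)
  obtain ⟨T, hT, hkT, hTO⟩ := mem_nhdsWithin.1 hmO
  obtain ⟨K, W, hK, hkK, hW, hyW, hKW⟩ := mem_nhds_prod_iff'.1 (hT.mem_nhds hkT)
  have htK : IsOpen (Γ.tgt '' K) := Γ.tgt_submersion.isOpenMap _ hK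
  refine ⟨W ∩ (fun y => Γ.tgt (ι y)) ⁻¹' (Γ.tgt '' K), (hW.inter
    (htK.preimage h.smooth_tgt.continuous)).mem_nhds ⟨hyW, k, hkK, hkt⟩, ?_⟩
  intro A hAo hAne
  by_cases hAK : (A ∩ Γ.tgt '' K).Nonempty
  · obtain ⟨_, hgA, g, hgK, rfl⟩ := hAK
    have hc := Γ.tgt_submersion.smooth.continuous
    have hB : IsOpen (K ∩ Γ.tgt ⁻¹' A) := hK.inter (hAo.preimage hc)
    obtain ⟨A', hA', hA'o, ⟨v, hv⟩, hdis⟩ := hA _ (Γ.src_submersion.isOpenMap _ hB)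
      ⟨_, g, ⟨hgK, hgA⟩, rfl⟩
    obtain ⟨g', ⟨hg'K, hg'A⟩, rfl⟩ := hA' hv
    refine ⟨Γ.tgt '' (K ∩ Γ.tgt ⁻¹' A ∩ Γ.src ⁻¹' A'), ?_, Γ.tgt_submersion.isOpenMap _
      (hB.inter (hA'o.preimage Γ.src_submersion.smooth.continuous)),
      ⟨_, g', ⟨⟨hg'K, hg'A⟩, hv⟩, rfl⟩, ?_⟩
    · rintro _ ⟨g, hg, rfl⟩
      exact hg.1.2
    · rw [Set.disjoint_left]
      rintro _ ⟨g, ⟨⟨hgK, -⟩, hgA'⟩, rfl⟩ ⟨w, ⟨hwW, -⟩, hw⟩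
      have hgw : (g, w) ∈ D := Eq.symm hw
      refine Set.disjoint_left.1 hdis hgA' ⟨m (g, w), hTO ⟨hKW ⟨hgK, hwW⟩, hgw⟩, ?_⟩
      change Γ.tgt (ι (ρ (Γ.mul (Γ.inv g) (ι w)))) = _
      rw [h.apply_lift_mul (hD _ hgw), Γ.tgt_mul _ _ (hD _ hgw), Γ.tgt_inv]
  · refine ⟨A, subset_rfl, hAo, hAne, ?_⟩
    rw [Set.disjoint_left]
    rintro _ hv ⟨w, hw, rfl⟩
    exact hAK ⟨_, hv, hw.2⟩

/-- For a transitive second countable Lie groupoid, the target map is a submersion from each source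
fibre onto the base. By Baire's theorem the image of this map is not a countable union of nowhere
dense sets, so the map has a local section through some point; translation gives local sections
through all others. -/
theorem surjSubmersion_tgt (h : Γ.IsSrcFibre x ι ρ) [SecondCountableTopology Γ.Arr]
    (hΓ : Γ.IsTransitive) : SurjSubmersion fun y => Γ.tgt (ι y) := by
  have hsurj : Function.Surjective fun y => Γ.tgt (ι y) := by
    intro z
    obtain ⟨g, hg, rfl⟩ := hΓ x z
    exact ⟨ρ g, by simp only [h.apply_lift g hg]⟩
  have : Nonempty F := ⟨ρ (Γ.unit x)⟩
  have : SecondCountableTopology F :=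
    h.isSmoothEmbedding.isEmbedding.isInducing.secondCountableTopology
  rcases exists_section_or_avoidsOpens h.smooth_tgt with ⟨y₀, τ, hτ₀, hτ⟩ | ⟨O, hO, ⟨y₀, hy₀⟩, hA⟩
  · refine surjSubmersion_of_section h.smooth_tgt hsurj fun y => ?_
    have e₀ : Γ.src (ι y) = Γ.tgt (Γ.inv (ι y₀)) := by
      rw [Γ.tgt_inv, h.src_apply, h.src_apply]
    set k := Γ.mul (ι y) (Γ.inv (ι y₀)) with hk
    have hkt : Γ.tgt k = Γ.tgt (ι y) := Γ.tgt_mul _ _ e₀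
    have hks : Γ.src k = Γ.tgt (ι y₀) := by rw [hk, Γ.src_mul _ _ e₀, Γ.src_inv]
    obtain ⟨κ, hκ₀, hκ⟩ := Γ.tgt_submersion.exists_section k
    rw [hkt] at hκ₀ hκ
    have hev : ∀ᶠ z in 𝓝 (Γ.tgt (ι y)),
        (ContMDiffAt (𝓡 P.dim) (𝓡 Γ.Arr.dim) ∞ κ z ∧ Γ.tgt (κ z) = z) ∧
        ContMDiffAt (𝓡 P.dim) (𝓡 F.dim) ∞ τ (Γ.src (κ z)) ∧
          Γ.tgt (ι (τ (Γ.src (κ z)))) = Γ.src (κ z) := by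
      refine hκ.and ?_
      have hc : ContinuousAt (fun z => Γ.src (κ z)) (Γ.tgt (ι y)) :=
        Γ.src_submersion.smooth.continuous.continuousAt.comp hκ.self_of_nhds.1.continuousAt
      exact hc.eventually (p := fun w => ContMDiffAt (𝓡 P.dim) (𝓡 F.dim) ∞ τ w ∧ Γ.tgt (ι (τ w)) = w)
        (by simp only [hκ₀, hks]; exact hτ)
    -- For a local section `κ` of the target map of `Γ` through `k = y y₀⁻¹`, the translate by `κ` of
    -- the section `τ` at `y₀` is a section at `y`.
    refine ⟨fun z => ρ (Γ.mul (κ z) (ι (τ (Γ.src (κ z))))), ?_, ?_⟩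
    · change ρ (Γ.mul (κ (Γ.tgt (ι y))) (ι (τ (Γ.src (κ (Γ.tgt (ι y))))))) = y
      rw [hκ₀, hks, hτ₀, hk, Γ.mul_assoc _ _ _ e₀ (Γ.src_inv _), Γ.inv_mul, h.src_apply,
        ← h.src_apply y, Γ.mul_unit, h.lift_apply]
    · filter_upwards [eventually_eventually_nhds.2 hev] with z hz
      have hz₀ := hz.self_of_nhds
      have hτκ : ContMDiffAt (𝓡 P.dim) (𝓡 F.dim) ∞ (fun z => τ (Γ.src (κ z))) z :=
        ContMDiffAt.comp (g := τ) z hz₀.2.1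
          (ContMDiffAt.comp (g := Γ.src) z (Γ.src_submersion.smooth _) hz₀.1.1)
      constructor
      · have := h.smooth_lift_mul (s := univ) hz₀.1.1.contMDiffWithinAt hτκ.contMDiffWithinAt
          (mem_univ z) (by
            rw [nhdsWithin_univ]
            exact hz.mono fun w hw => hw.2.2.symm)
        exact this.contMDiffAt univ_mem
      · rw [h.apply_lift_mul hz₀.2.2.symm, Γ.tgt_mul _ _ hz₀.2.2.symm, hz₀.1.2]
  · exfalso
    choose W hW hWA using h.exists_nhds_avoidsOpens hO hy₀ hA
    obtain ⟨S, hS, hSW⟩ := TopologicalSpace.countable_cover_nhds hW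
    have : Countable S := hS
    refine not_subset_iUnion_avoidsOpens x (ι := S) (fun y => hWA y) fun z => ?_
    obtain ⟨y, rfl⟩ := hsurj z
    have : y ∈ ⋃ y ∈ S, W y := by rw [hSW]; trivial
    obtain ⟨s, hs, hys⟩ := mem_iUnion₂.1 this
    exact ⟨⟨s, hs⟩, y, hys, rfl⟩

/-- The isotropy group is an embedded Lie group if the target map is a submersion on the source
fibre, because then `(s, t) : Γ → P × P` has local sections. -/
theorem exists_lieGroup_isotropy (h : Γ.IsSrcFibre x ι ρ)
    (ht : SurjSubmersion fun y => Γ.tgt (ι y)) :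
    ∃ (n : ℕ) (_ : ChartedSpace (EuclideanSpace ℝ (Fin n)) (Γ.Isotropy x)),
      LieGroup (𝓡 n) ∞ (Γ.Isotropy x) ∧ Manifold.IsSmoothEmbedding (𝓡 n) (𝓡 Γ.Arr.dim) ∞
        (Isotropy.val : Γ.Isotropy x → Γ.Arr) := by
  set d := chartAt (EuclideanSpace ℝ (Fin P.dim)) x
  have hd1 := contMDiffOn_of_mem_maximalAtlas
    (IsManifold.chart_mem_maximalAtlas (I := 𝓡 P.dim) (n := ∞) x)
  have hdx : x ∈ d.source := mem_chart_source _ x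
  have hx : d.symm (0 + d x) = x := by rw [zero_add, d.left_inv hdx]
  have hemb : Topology.IsEmbedding (Isotropy.val : Γ.Isotropy x → Γ.Arr) :=
    ⟨⟨rfl⟩, fun g k e => Isotropy.ext e⟩
  obtain ⟨n, C, hC, hv⟩ := SmoothMfd.exists_isSmoothEmbedding
    (V := EuclideanSpace ℝ (Fin P.dim) × EuclideanSpace ℝ (Fin P.dim)) hemb (by
      intro g
      obtain ⟨τ₁, h₁, hτ₁⟩ := ht.exists_section (ρ g.val)
      obtain ⟨τ₂, h₂, hτ₂⟩ := ht.exists_section (ρ (Γ.unit x))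
      simp only [h.apply_lift _ g.src_val, g.tgt_val] at h₁ hτ₁
      simp only [h.apply_lift _ (Γ.src_unit x), Γ.tgt_unit] at h₂ hτ₂
      have hs := chartAt_symm_add_contMDiffAt x
      let j : EuclideanSpace ℝ (Fin P.dim) → P := fun v => d.symm (v + d x)
      have hj₀ : j 0 = x := hx
      have hj1 : ContMDiffAt 𝓘(ℝ, EuclideanSpace ℝ (Fin P.dim) × EuclideanSpace ℝ (Fin P.dim))
          (𝓡 P.dim) ∞
            (fun v : EuclideanSpace ℝ (Fin P.dim) × EuclideanSpace ℝ (Fin P.dim) => j v.1) 0 :=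
        ContMDiffAt.comp (g := j) (0 : EuclideanSpace ℝ (Fin P.dim) × EuclideanSpace ℝ (Fin P.dim))
          hs contDiff_fst.contMDiff.contMDiffAt
      have hj2 : ContMDiffAt 𝓘(ℝ, EuclideanSpace ℝ (Fin P.dim) × EuclideanSpace ℝ (Fin P.dim))
          (𝓡 P.dim) ∞
            (fun v : EuclideanSpace ℝ (Fin P.dim) × EuclideanSpace ℝ (Fin P.dim) => j v.2) 0 :=
        ContMDiffAt.comp (g := j) (0 : EuclideanSpace ℝ (Fin P.dim) × EuclideanSpace ℝ (Fin P.dim))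
          hs contDiff_snd.contMDiff.contMDiffAt
      have ev1 : ∀ᶠ v in 𝓝 (0 : EuclideanSpace ℝ (Fin P.dim) × EuclideanSpace ℝ (Fin P.dim)),
          Γ.tgt (ι (τ₂ (j v.1))) = j v.1 ∧ d (j v.1) - d x = v.1 :=
        (hj1.continuousAt.eventually (p := fun y => Γ.tgt (ι (τ₂ y)) = y) (by
          simp only [Prod.fst_zero, hj₀]
          exact hτ₂.mono fun y hy => hy.2)).and
        ((continuous_fst.tendsto
          (0 : EuclideanSpace ℝ (Fin P.dim) × EuclideanSpace ℝ (Fin P.dim))).eventually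
          (p := fun v => d (j v) - d x = v) (eventually_chartAt_symm_add x))
      have ev2 : ∀ᶠ v in 𝓝 (0 : EuclideanSpace ℝ (Fin P.dim) × EuclideanSpace ℝ (Fin P.dim)),
          Γ.tgt (ι (τ₁ (j v.2))) = j v.2 ∧ d (j v.2) - d x = v.2 :=
        (hj2.continuousAt.eventually (p := fun y => Γ.tgt (ι (τ₁ y)) = y) (by
          simp only [Prod.snd_zero, hj₀]
          exact hτ₁.mono fun y hy => hy.2)).and
        ((continuous_snd.tendsto
          (0 : EuclideanSpace ℝ (Fin P.dim) × EuclideanSpace ℝ (Fin P.dim))).eventually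
          (p := fun v => d (j v) - d x = v) (eventually_chartAt_symm_add x))
      have hsrc : ∀ y z, Γ.src (ι y) = Γ.tgt (Γ.inv (ι z)) := fun y z => by
        rw [Γ.tgt_inv, h.src_apply, h.src_apply]
      -- Near `g` the isotropy group is the zero set of the coordinates of `(s, t)`, which have the
      -- local section `(z, y) ↦ τ₁(y) τ₂(z)⁻¹` through `g`.
      refine ⟨Γ.src ⁻¹' d.source ∩ Γ.tgt ⁻¹' d.source,
        (d.open_source.preimage Γ.src_submersion.smooth.continuous).inter
          (d.open_source.preimage Γ.tgt_submersion.smooth.continuous),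
        ⟨by rwa [mem_preimage, g.src_val], by rwa [mem_preimage, g.tgt_val]⟩,
        fun k => (d (Γ.src k) - d x, d (Γ.tgt k) - d x), ?_, fun k hk => ?_,
        fun v => Γ.mul (ι (τ₁ (j v.2))) (Γ.inv (ι (τ₂ (j v.1)))), ?_, ?_, ?_⟩
      · exact ((hd1.comp Γ.src_submersion.smooth.contMDiffOn fun k hk => hk.1).sub
          contMDiffOn_const).prodMk_space
          ((hd1.comp Γ.tgt_submersion.smooth.contMDiffOn fun k hk => hk.2).sub contMDiffOn_const)
      · rw [Prod.mk_eq_zero, sub_eq_zero, sub_eq_zero]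
        constructor
        · rintro ⟨k, rfl⟩
          rw [k.src_val, k.tgt_val]
          exact ⟨rfl, rfl⟩
        · rintro ⟨e1, e2⟩
          exact ⟨⟨k, d.injOn hk.1 hdx e1, d.injOn hk.2 hdx e2⟩, rfl⟩
      · have k1 : ContMDiffAt 𝓘(ℝ, EuclideanSpace ℝ (Fin P.dim) × EuclideanSpace ℝ (Fin P.dim))
            (𝓡 F.dim) ∞
            (fun v : EuclideanSpace ℝ (Fin P.dim) × EuclideanSpace ℝ (Fin P.dim) => τ₁ (j v.2)) 0 :=
          ContMDiffAt.comp (g := τ₁)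
            (0 : EuclideanSpace ℝ (Fin P.dim) × EuclideanSpace ℝ (Fin P.dim))
            (by simp only [Prod.snd_zero, hj₀]; exact hτ₁.self_of_nhds.1) hj2
        have k2 : ContMDiffAt 𝓘(ℝ, EuclideanSpace ℝ (Fin P.dim) × EuclideanSpace ℝ (Fin P.dim))
            (𝓡 F.dim) ∞
            (fun v : EuclideanSpace ℝ (Fin P.dim) × EuclideanSpace ℝ (Fin P.dim) => τ₂ (j v.1)) 0 :=
          ContMDiffAt.comp (g := τ₂)
            (0 : EuclideanSpace ℝ (Fin P.dim) × EuclideanSpace ℝ (Fin P.dim))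
            (by simp only [Prod.fst_zero, hj₀]; exact hτ₂.self_of_nhds.1) hj1
        exact (Γ.smooth_mul.comp_within (A := univ)
          (h.smooth.comp_within k1.contMDiffWithinAt)
          (Smooth.comp_within Γ.smooth_inv (h.smooth.comp_within k2.contMDiffWithinAt))
          (mem_univ _) (.of_forall fun v => hsrc _ _)).contMDiffAt univ_mem
      · change Γ.mul (ι (τ₁ (j 0))) (Γ.inv (ι (τ₂ (j 0)))) = g.val
        rw [hj₀, h₁, h₂, h.apply_lift _ g.src_val, h.apply_lift _ (Γ.src_unit x), Γ.inv_unit]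
        exact (congrArg (fun y => Γ.mul g.val (Γ.unit y)) g.src_val.symm).trans (Γ.mul_unit g.val)
      · filter_upwards [ev1, ev2] with v hv1 hv2
        rw [Γ.src_mul _ _ (hsrc _ _), Γ.tgt_mul _ _ (hsrc _ _), Γ.src_inv, hv1.1, hv2.1, hv1.2,
          hv2.2])
  refine ⟨n, C, { hC with contMDiff_mul := fun z => ?_, contMDiff_inv := fun g => ?_ }, hv⟩
  · have := hv.contMDiffWithinAt_of_comp (I := (𝓡 n).prod (𝓡 n)) (s := univ)
      (φ := fun z : Γ.Isotropy x × Γ.Isotropy x => z.1 * z.2) (z := z)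
      (Γ.smooth_mul.comp_within (I := (𝓡 n).prod (𝓡 n)) (A := univ)
        (X := Γ.Isotropy x × Γ.Isotropy x) (f := fun z => z.1.val)
        (g := fun z => z.2.val) (hv.contMDiff.contMDiffAt.comp_contMDiffWithinAt z
          contMDiffWithinAt_fst) (hv.contMDiff.contMDiffAt.comp_contMDiffWithinAt z
          contMDiffWithinAt_snd) (mem_univ z)
        (.of_forall fun z => z.1.src_val.trans z.2.tgt_val.symm))
    exact this.contMDiffAt univ_mem
  · have := hv.contMDiffWithinAt_of_comp (I := 𝓡 n) (s := univ)
      (φ := fun g : Γ.Isotropy x => g⁻¹) (z := g)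
      (Smooth.comp_within Γ.smooth_inv hv.contMDiff.contMDiffAt.contMDiffWithinAt)
    exact this.contMDiffAt univ_mem

/-- The source fibre at `x` is a biprincipal bibundle of `Γ` and the isotropy group at `x`, with
respect to left and right multiplication. -/
theorem exists_isBiprincipal (h : Γ.IsSrcFibre x ι ρ) (ht : SurjSubmersion fun y => Γ.tgt (ι y))
    {n : ℕ} [ChartedSpace (EuclideanSpace ℝ (Fin n)) (Γ.Isotropy x)]
    [LieGroup (𝓡 n) ∞ (Γ.Isotropy x)]
    (hv : Manifold.IsSmoothEmbedding (𝓡 n) (𝓡 Γ.Arr.dim) ∞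
      (Isotropy.val : Γ.Isotropy x → Γ.Arr)) :
    ∃ S : Bibundle Γ (LieGroup.toLieGroupoid (n := n) (Γ.Isotropy x)), S.IsBiprincipal := by
  have : Nonempty F := ⟨ρ (Γ.unit x)⟩
  have hval : ∀ (y : F) (k : Γ.Isotropy x), Γ.src (ι y) = Γ.tgt k.val := fun y k => by
    rw [h.src_apply, k.tgt_val]
  have hR : ∀ (y : F) (k : Γ.Isotropy x), ι (ρ (Γ.mul (ι y) k.val)) = Γ.mul (ι y) k.val :=
    fun y k => h.apply_lift _ (by rw [Γ.src_mul _ _ (hval y k), k.src_val])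
  let l : LeftAction Γ F :=
    { moment := fun y => Γ.tgt (ι y)
      act := fun g y => ρ (Γ.mul g (ι y))
      smooth_moment := h.smooth_tgt
      smooth_act := fun z hz => h.smooth_lift_mul contMDiffWithinAt_fst contMDiffWithinAt_snd hz
        (eventually_mem_nhdsWithin.mono fun w hw => hw)
      moment_act := fun g y e => by rw [h.apply_lift_mul e, Γ.tgt_mul _ _ e]
      unit_act := fun y => by rw [Γ.unit_mul, h.lift_apply]
      mul_act := fun g k y e e' => by
        rw [h.apply_lift_mul e', Γ.mul_assoc _ _ _ e e'] }
  let r : RightAction (LieGroup.toLieGroupoid (n := n) (Γ.Isotropy x)) F :=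
    { moment := fun _ => default
      act := fun (y : F) (k : Γ.Isotropy x) => ρ (Γ.mul (ι y) k.val)
      smooth_moment := contMDiff_const
      smooth_act := fun z hz => by
        have hval' : Smooth (M := (LieGroup.toLieGroupoid (n := n) (Γ.Isotropy x)).Arr)
            Isotropy.val :=
          hv.contMDiff
        refine h.smooth_lift (Γ.smooth_mul.comp_within (h.smooth.comp_within contMDiffWithinAt_fst)
          (hval'.comp_within contMDiffWithinAt_snd) hz (.of_forall fun w => hval w.1 w.2)) hz
          (.of_forall fun w => ?_)
        exact (Γ.src_mul _ _ (hval w.1 w.2)).trans w.2.src_val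
      moment_act := fun _ _ _ => rfl
      act_unit := fun y => by
        change ρ (Γ.mul (ι y) (Γ.unit x)) = y
        rw [← h.src_apply y, Γ.mul_unit, h.lift_apply]
      act_mul := fun (y : F) (g k : Γ.Isotropy x) _ _ => by
        change ρ (Γ.mul (ι y) (Γ.mul g.val k.val)) = ρ (Γ.mul (ι (ρ (Γ.mul (ι y) g.val))) k.val)
        rw [hR, Γ.mul_assoc _ _ _ (hval y g) (g.src_val.trans k.tgt_val.symm)] }
  have hinv : ∀ y z : F, Γ.src (ι y) = Γ.tgt (Γ.inv (ι z)) := fun y z => by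
    rw [Γ.tgt_inv, h.src_apply, h.src_apply]
  have hdivl : ∀ y z : F, Γ.src (Γ.mul (ι y) (Γ.inv (ι z))) = Γ.tgt (ι z) ∧
      l.act (Γ.mul (ι y) (Γ.inv (ι z))) z = y := fun y z => by
    refine ⟨by rw [Γ.src_mul _ _ (hinv y z), Γ.src_inv], ?_⟩
    change ρ (Γ.mul (Γ.mul (ι y) (Γ.inv (ι z))) (ι z)) = y
    rw [Γ.mul_assoc _ _ _ (hinv y z) (Γ.src_inv _), Γ.inv_mul, h.src_apply, ← h.src_apply y,
      Γ.mul_unit, h.lift_apply]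
  let δ : F × F → Γ.Isotropy x := fun z =>
    Function.invFun Isotropy.val (Γ.mul (Γ.inv (ι z.1)) (ι z.2))
  have hδ : ∀ y z : F, Γ.tgt (ι y) = Γ.tgt (ι z) →
      (δ (y, z)).val = Γ.mul (Γ.inv (ι y)) (ι z) := fun y z e => by
    have e' : Γ.src (Γ.inv (ι y)) = Γ.tgt (ι z) := by rw [Γ.src_inv, e]
    exact Function.invFun_eq ⟨⟨Γ.mul (Γ.inv (ι y)) (ι z),
      by rw [Γ.src_mul _ _ e', h.src_apply], by rw [Γ.tgt_mul _ _ e', Γ.tgt_inv, h.src_apply]⟩, rfl⟩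
  have hdivr : ∀ y z : F, Γ.tgt (ι y) = Γ.tgt (ι z) → r.act y (δ (y, z)) = z := fun y z e => by
    change ρ (Γ.mul (ι y) (δ (y, z)).val) = z
    rw [hδ y z e, ← Γ.mul_assoc _ _ _ (Γ.tgt_inv _).symm (by rw [Γ.src_inv, e]), Γ.mul_inv, e,
      Γ.unit_mul, h.lift_apply]
  refine ⟨{ space := F, left := l, right := r, right_moment_left := fun _ _ _ => rfl,
            left_moment_right := fun y (k : Γ.Isotropy x) _ => ?_,
            comm := fun g y (k : Γ.Isotropy x) e _ => ?_ },
    ⟨surjSubmersion_point F, fun _ _ _ => rfl, fun g y e e' => ?_,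
      fun y z _ => ⟨_, hdivl y z⟩,
      fun z => Γ.mul (ι z.1) (Γ.inv (ι z.2)), ?_, fun y z _ => hdivl y z⟩,
    ⟨ht, fun y (k : Γ.Isotropy x) _ => ?_, fun y (k : Γ.Isotropy x) _ e => ?_,
      fun y z e => ⟨δ (y, z), rfl, hdivr y z e⟩, δ, fun z hz => ?_,
      fun y z e => ⟨rfl, hdivr y z e⟩⟩⟩
  · change Γ.tgt (ι (ρ (Γ.mul (ι y) k.val))) = Γ.tgt (ι y)
    rw [hR, Γ.tgt_mul _ _ (hval y k)]
  · change ρ (Γ.mul (ι (ρ (Γ.mul g (ι y)))) k.val) = ρ (Γ.mul g (ι (ρ (Γ.mul (ι y) k.val))))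
    rw [h.apply_lift_mul e, hR, Γ.mul_assoc _ _ _ e (hval y k)]
  · have e1 : Γ.mul g (ι y) = ι y := by rw [← h.apply_lift_mul e]; exact congrArg ι e'
    exact Γ.unitBibundle_isBiprincipal.1.free g (ι y) e e1
  · exact fun z _ => Γ.smooth_mul.comp_within (f := fun z : F × F => ι z.1)
      (g := fun z : F × F => Γ.inv (ι z.2)) (h.smooth.comp_within contMDiffWithinAt_fst)
      (Smooth.comp_within Γ.smooth_inv (h.smooth.comp_within contMDiffWithinAt_snd)) ‹_›
      (.of_forall fun w => hinv w.1 w.2)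
  · change Γ.tgt (ι (ρ (Γ.mul (ι y) k.val))) = Γ.tgt (ι y)
    rw [hR, Γ.tgt_mul _ _ (hval y k)]
  · have e1 : Γ.mul (ι y) k.val = ι y := by rw [← hR]; exact congrArg ι e
    refine Isotropy.ext ((Γ.unitBibundle_isBiprincipal.2.free (ι y) k.val (hval y k) e1).trans ?_)
    exact congrArg Γ.unit (h.src_apply y)
  · refine hv.contMDiffWithinAt_of_comp (ContMDiffWithinAt.congr_of_eventuallyEq
      (Γ.smooth_mul.comp_within (f := fun z : F × F => Γ.inv (ι z.1))
      (g := fun z : F × F => ι z.2)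
      (Smooth.comp_within Γ.smooth_inv (h.smooth.comp_within contMDiffWithinAt_fst))
      (h.smooth.comp_within contMDiffWithinAt_snd) hz
      (eventually_mem_nhdsWithin.mono fun w hw => (Γ.src_inv _).trans hw))
      (eventually_mem_nhdsWithin.mono fun w hw => hδ w.1 w.2 hw) (hδ z.1 z.2 hz))

end IsSrcFibre

end LieGroupoid

/-! ### Picard groups of gauge groupoids and of transitive groupoids -/

/-- A Lie groupoid that is Morita equivalent to a Lie group `G` has the Picard group `Out(G)`. -/
theorem Bibundle.IsBiprincipal.nonempty_picardGroup_mulEquiv_out {P : SmoothMfd.{u}}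
    {Γ : LieGroupoid P} {n : ℕ} {G : Type u} [TopologicalSpace G]
    [ChartedSpace (EuclideanSpace ℝ (Fin n)) G] [Group G] [LieGroup (𝓡 n) ∞ G]
    {S : Bibundle Γ (LieGroup.toLieGroupoid (n := n) G)} (hS : S.IsBiprincipal) :
    Nonempty (@MulEquiv Γ.Pic (LieGroup.Out (n := n) G) Γ.picardGroup.toMul _) := by
  obtain ⟨e⟩ := hS.nonempty_picardGroup_mulEquiv
  obtain ⟨e'⟩ := LieGroup.nonempty_picardGroup_mulEquiv_out (n := n) (G := G)
  let _ := Γ.picardGroup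
  let _ := (LieGroup.toLieGroupoid (n := n) G).picardGroup
  exact ⟨e.trans e'⟩

theorem mainTheorem7 :
    -- principal bundles of Lie groupoids
    (∀ (P B E : SmoothMfd.{u}) (Γ : LieGroupoid P) (a : RightAction Γ E) (p : E → B),
      a.IsPrincipal p → SurjSubmersion a.moment →
        (∃ 𝒢 : LieGroupoid B, IsGaugeGroupoid a p 𝒢) ∧
        ∀ 𝒢 : LieGroupoid B, IsGaugeGroupoid a p 𝒢 →
          ∃ (grp₁ : Group 𝒢.Pic) (grp₂ : Group Γ.Pic),
            𝒢.IsPicardGroup grp₁ ∧ Γ.IsPicardGroup grp₂ ∧ Nonempty (𝒢.Pic ≃* Γ.Pic)) ∧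
    -- principal bundles of Lie groups
    (∀ (n : ℕ) (G : Type u) [TopologicalSpace G] [ChartedSpace (EuclideanSpace ℝ (Fin n)) G]
      [Group G] [LieGroup (𝓡 n) ∞ G] (B E : SmoothMfd.{u})
      (a : RightAction (LieGroup.toLieGroupoid (n := n) G) E) (p : E → B),
      a.IsPrincipal p → SurjSubmersion a.moment →
        ∀ 𝒢 : LieGroupoid B, IsGaugeGroupoid a p 𝒢 →
          ∃ grp : Group 𝒢.Pic,
            𝒢.IsPicardGroup grp ∧ Nonempty (𝒢.Pic ≃* LieGroup.Out (n := n) G)) ∧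
    -- transitive Lie groupoids
    (∀ (P : SmoothMfd.{u}) (Γ : LieGroupoid P) [SecondCountableTopology Γ.Arr],
      Γ.IsTransitive → ∀ x : P,
        (∃ (n : ℕ) (_ : ChartedSpace (EuclideanSpace ℝ (Fin n)) (Γ.Isotropy x)),
          LieGroup (𝓡 n) ∞ (Γ.Isotropy x) ∧
          Manifold.IsSmoothEmbedding (𝓡 n) (𝓡 Γ.Arr.dim) ∞
            (LieGroupoid.Isotropy.val : Γ.Isotropy x → Γ.Arr)) ∧
        ∀ (n : ℕ) [ChartedSpace (EuclideanSpace ℝ (Fin n)) (Γ.Isotropy x)]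
          [LieGroup (𝓡 n) ∞ (Γ.Isotropy x)],
          Manifold.IsSmoothEmbedding (𝓡 n) (𝓡 Γ.Arr.dim) ∞
            (LieGroupoid.Isotropy.val : Γ.Isotropy x → Γ.Arr) →
          ∃ grp : Group Γ.Pic,
            Γ.IsPicardGroup grp ∧ Nonempty (Γ.Pic ≃* LieGroup.Out (n := n) (Γ.Isotropy x))) := by
  refine ⟨fun P B E Γ a p ha hJ => ⟨exists_isGaugeGroupoid ha hJ, fun 𝒢 h => ?_⟩,
    fun n G _ _ _ _ B E a p ha hJ 𝒢 h => ?_, fun P Γ _ hΓ x => ?_⟩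
  · obtain ⟨S, hS⟩ := h.exists_isBiprincipal ha hJ
    exact ⟨𝒢.picardGroup, Γ.picardGroup, 𝒢.isPicardGroup_picardGroup,
      Γ.isPicardGroup_picardGroup, hS.nonempty_picardGroup_mulEquiv⟩
  · obtain ⟨S, hS⟩ := h.exists_isBiprincipal ha hJ
    exact ⟨𝒢.picardGroup, 𝒢.isPicardGroup_picardGroup, hS.nonempty_picardGroup_mulEquiv_out⟩
  · obtain ⟨F, ι, ρ, h⟩ := Γ.exists_isSrcFibre x
    have ht := h.surjSubmersion_tgt hΓ
    refine ⟨h.exists_lieGroup_isotropy ht, fun n _ _ hv => ?_⟩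
    obtain ⟨S, hS⟩ := h.exists_isBiprincipal ht hv
    exact ⟨Γ.picardGroup, Γ.isPicardGroup_picardGroup, hS.nonempty_picardGroup_mulEquiv_out⟩
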